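/- Let $b,\varepsilon\in(0,1)$. Write $\mathbb T$ for the unit circle, $C_\varepsilon=\{\varepsilon<|z|<1/\varepsilon\}$ and $\Delta_\varepsilon=\{|z|>\varepsilon\}$. For a function $u$ holomorphic in $\{\varepsilon<|z|<1\}$ put $$\|u\|_{(\varepsilon)}=\sup_{\varepsilon<\rho<1}\Big(\int_0^{2\pi}|u(\rho e^{i\theta})|^2d\theta\Big)^{1/2}\in[0,\infty]$$ (the $L^2(\mathbb T)$ norm of the boundary value $u(\varepsilon\,\cdot)$ in the sense of Hardy spaces) and, for $u$ holomorphic in $\Delta_\varepsilon$, $$[u]_{(\varepsilon)}=\sup_{\varepsilon<\rho<1}\Big\|\omega\mapsto\int_{\mathbb T}\frac{u(\rho\tau)-u(\rho\omega)}{|\tau-\omega|}\frac{d\tau}{\tau}\Big\|_{L^2(\mathbb T)}\in[0,\infty].$$ For an integer $k\ge 0$ let $X^{k+\log}$ be the space of holomorphic functions $h$ on $\Delta_\varepsilon$ of the form $h(z)=\sum_{n\ge1}h_nz^{-n}$ with $h_n\in\mathbb R$ and $$\|h\|_{X^{k+\log}}:=\|h\|_{(\varepsilon)}+\|\partial_z^kh\|_{(\varepsilon)}+[\partial_z^kh]_{(\varepsilon)}<\infty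 ,$$ and let $V_r=\{f\in X^{k+\log}:\ \|f\|_{X^{k+\log}}\le r\}$. For an integer $l\ge0$ let $Y^{l}$ be the space of holomorphic functions $h$ on $C_\varepsilon$ of the form $h(z)=i\sum_{n\ge1}h_n(z^n-z^{-n})$ with $h_n\in\mathbb R$ and with $\|h\|_{(\varepsilon)}<\infty$, $\|\partial_z^{l}h\|_{(\varepsilon)}<\infty$. A real function on $\mathbb T$ is said to belong to $Y^l$ if it is the restriction to $\mathbb T$ of an element of $Y^l$. For $f_1,f_2\in X^{k+\log}$ set $\Phi_1(z)=z+f_1(z)$, $\Phi_2(z)=bz+f_2(z)$, and for $\Omega\in\mathbb R$, $j\in\{1,2\}$, $\omega\in\mathbb T$, $$G_j(\Omega,f_1,f_2)(\omega)=\operatorname{Im}\Big\{\big(\Omega\Phi_j(\omega)-S(\Phi_1,\Phi_j)(\omega)+S(\Phi_2,\Phi_j)(\omega)\big)\overline{\Phi_j'(\omega)}\,\overline{\omega}\Big\},$$ $$S(\Phi_i,\Phi_j)(\omega)=\frac1{2\pi i}\int_{\mathbb T}\frac{\tau\Phi_i'(\tau)-\omega\Phi_j'(\omega)}{|\Phi_i(\tau)-\Phi_j(\omega)|}\frac{d\tau}{\tau}.$$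 Proposition. For every $j\in\{1,2\}$ and every integer $k\ge3$ there is $r\in(0,1)$ such that $$G_j:\ \mathbb R\times V_r\times V_r\to Y^{k-1},\qquad(\Omega,f_1,f_2)\mapsto G_j(\Omega,f_1,f_2)$$ is well defined. That is, for all $\Omega\in\mathbb R$ and $f_1,f_2\in V_r$: for every $\omega\in\mathbb T$ and $i\in\{1,2\}$, $\Phi_i(\tau)\ne\Phi_j(\omega)$ for all $\tau\in\mathbb T$ (with $\tau\ne\omega$ if $i=j$) and the integrand of $S(\Phi_i,\Phi_j)(\omega)$ is integrable over $\mathbb T$; and there is exactly one element of $Y^{k-1}$ whose restriction to $\mathbb T$ is $G_j(\Omega,f_1,f_2)$. -/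

import Mathlib

noncomputable section

namespace VState

/-- The open annulus `C_ε = {ε < |z| < 1/ε}`. -/
def annulus (ε : ℝ) : Set ℂ := {z | ε < ‖z‖ ∧ ‖z‖ < 1 / ε}

/-- The exterior domain `Δ_ε = {ε < |z|}`. -/
def exterior (ε : ℝ) : Set ℂ := {z | ε < ‖z‖}

/-- The space `𝒜_ε`: holomorphic functions on `Δ_ε` of the form `∑_{n ≥ 1} h_n z^{-n}` with real
`h_n` (here `c n = h_{n+1}`). Values outside `Δ_ε` are irrelevant. -/
def spaceA (ε : ℝ) : Set (ℂ → ℂ) :=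
  {h | DifferentiableOn ℂ h (exterior ε) ∧
    ∃ c : ℕ → ℝ, ∀ z ∈ exterior ε, HasSum (fun n : ℕ => (c n : ℂ) * (z ^ (n + 1))⁻¹) (h z)}

/-- The space of holomorphic functions on `C_ε` of the form `i ∑_{n ≥ 1} h_n (z^n - z^{-n})` with
real `h_n` (here `c n = h_{n+1}`). Values outside `C_ε` are irrelevant. -/
def spaceAhat (ε : ℝ) : Set (ℂ → ℂ) :=
  {h | DifferentiableOn ℂ h (annulus ε) ∧
    ∃ c : ℕ → ℝ, ∀ z ∈ annulus ε,
      HasSum (fun n : ℕ => Complex.I * ((c n : ℂ) * (z ^ (n + 1) - (z ^ (n + 1))⁻¹))) (h z)}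

/-- The `L²(𝕋)` norm `(∫_0^{2π} |g(e^{iθ})|² dθ)^{1/2}`, with values in `[0,∞]`. -/
def circleNorm (g : ℂ → ℂ) : ENNReal :=
  MeasureTheory.eLpNorm (fun θ : ℝ => g (circleMap 0 1 θ)) 2
    (MeasureTheory.volume.restrict (Set.Ioc 0 (2 * Real.pi)))

/-- The `L²` norm of `h(ε ·)` on `𝕋`, for `h` holomorphic near `{ε < |z| < 1}`, in the usual sense
of Hardy spaces: the supremum of the `L²` norms on the circles `|z| = ρ`, `ε < ρ < 1`. -/
def boundaryNorm (ε : ℝ) (h : ℂ → ℂ) : ENNReal :=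
  ⨆ ρ ∈ Set.Ioo ε 1, circleNorm (fun ω => h ((ρ : ℂ) * ω))

/-- The singular integral `ω ↦ ∫_𝕋 (u(ρ τ) - u(ρ ω)) / |τ - ω| dτ / τ`. -/
def logIntegral (u : ℂ → ℂ) (ρ : ℝ) (ω : ℂ) : ℂ :=
  ∮ τ in C(0, 1), (u ((ρ : ℂ) * τ) - u ((ρ : ℂ) * ω)) / (‖τ - ω‖ : ℂ) / τ

/-- The `L²(𝕋)` norm of `∫_𝕋 (u(ε τ) - u(ε ·)) / |τ - ·| dτ / τ`, where the value on the boundary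
circle `|z| = ε` is again obtained from the circles `|z| = ρ`, `ε < ρ < 1`. -/
def boundaryLogNorm (ε : ℝ) (u : ℂ → ℂ) : ENNReal :=
  ⨆ ρ ∈ Set.Ioo ε 1, circleNorm (logIntegral u ρ)

/-- The norm of `X^{k+log}`. -/
def normX (ε : ℝ) (k : ℕ) (h : ℂ → ℂ) : ENNReal :=
  boundaryNorm ε h + boundaryNorm ε (iteratedDeriv k h) + boundaryLogNorm ε (iteratedDeriv k h)

/-- The space `X^{k+log}`. -/
def spaceX (ε : ℝ) (k : ℕ) : Set (ℂ → ℂ) := {h | h ∈ spaceA ε ∧ normX ε k h < ⊤}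

/-- The closed ball `V_r` of `X^{k+log}`. -/
def ballV (ε : ℝ) (k : ℕ) (r : ℝ) : Set (ℂ → ℂ) :=
  {f | f ∈ spaceX ε k ∧ normX ε k f ≤ ENNReal.ofReal r}

/-- The space `Y^l`. -/
def spaceY (ε : ℝ) (l : ℕ) : Set (ℂ → ℂ) :=
  {h | h ∈ spaceAhat ε ∧ boundaryNorm ε h < ⊤ ∧ boundaryNorm ε (iteratedDeriv l h) < ⊤}

/-- The parametrizations `Φ_1 = Id + f_1` (index `0`) and `Φ_2 = b Id + f_2` (index `1`). -/
def conformal (b : ℝ) (f : Fin 2 → ℂ → ℂ) (j : Fin 2) (z : ℂ) : ℂ :=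
  (b : ℂ) ^ (j : ℕ) * z + f j z

/-- The integrand `(τ Φ'(τ) - ω Ψ'(ω)) / |Φ(τ) - Ψ(ω)| · 1/τ` of `S(Φ, Ψ)(ω)`. -/
def kernelS (Φ Ψ : ℂ → ℂ) (ω τ : ℂ) : ℂ :=
  (τ * deriv Φ τ - ω * deriv Ψ ω) / (‖Φ τ - Ψ ω‖ : ℂ) / τ

/-- `S(Φ, Ψ)(ω) = (1 / 2πi) ∫_𝕋 (τ Φ'(τ) - ω Ψ'(ω)) / |Φ(τ) - Ψ(ω)| dτ / τ`. -/
def S (Φ Ψ : ℂ → ℂ) (ω : ℂ) : ℂ :=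
  (2 * (Real.pi : ℂ) * Complex.I)⁻¹ * ∮ τ in C(0, 1), kernelS Φ Ψ ω τ

/-- The V-state functional `G_j(Ω, f_1, f_2)(ω)`; the index `0` stands for `j = 1` and the index `1`
for `j = 2`. -/
def G (b : ℝ) (j : Fin 2) (Ω : ℝ) (f : Fin 2 → ℂ → ℂ) (ω : ℂ) : ℝ :=
  (((Ω : ℂ) * conformal b f j ω - S (conformal b f 0) (conformal b f j) ω
      + S (conformal b f 1) (conformal b f j) ω)
    * (starRingEnd ℂ) (deriv (conformal b f j) ω) * (starRingEnd ℂ) ω).im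

end VState

end

/-!
In the coordinate `z = e^ζ` the unit circle is the imaginary axis, the annulus `C_ε` is the strip
`|Re ζ| < -log ε`, and complex conjugation on the axis is the reflection `ζ ↦ -ζ`, which is
holomorphic. With `φ(ζ) = Φ_i(e^ζ)`, `ψ(ζ) = Φ_j(e^ζ)` and `τ = ω e^{iθ}`, the function
`S(Φ_i, Φ_j)` therefore extends holomorphically to the strip once the modulus in its denominator
does. Divide `φ(ζ + iθ) - ψ(ζ)` by its value `κ(θ) = β_i e^{iθ} - β_j` for unperturbed circles, up to
the factor `e^ζ`; the quotient `famA` is close to `e^ζ` for `f_1`, `f_2` in a small ball. The product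
`famP` of `famA` and its reflection is close to `1`, and on the axis it is `|Φ_i(τ) - Φ_j(ω)|² / |κ|²`.
Hence its inverse square root `famW` is holomorphic, and
`extS = (1 / 2π) ∫ (κ / |κ|) famA' famW dθ` extends `S` (`S_eq_extS`). The same closeness to `e^ζ`
shows that the curves do not meet (`conformal_ne_conformal`). Taking the imaginary part amounts to
taking the odd part, so `extG` extends `G`. It is odd, `2πi`-periodic and real on the axis, which
gives the sine expansion required in `spaceAhat` (`exists_hasSum_sine`). Uniqueness is the identity
theorem (`eqOn_annulus_of_eq_circle`).

The norms of `spaceY` are uniform `L²` bounds on the lines `log ε < Re ζ < 0`, and `k - 1` derivatives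
have to be controlled there (`comp_log_mem_spaceY`). By Parseval and the Cauchy–Schwarz inequality,
the norm of `f` bounds the derivatives of order less than `k` in the supremum norm, with a Hölder
exponent `1/4` to spare (`CoefBd`). Differentiating under the integral sign, every term is then
dominated by the integrable weight `1 + |θ|^{-3/4}`, except the one in which all `k - 1` derivatives
fall on the factor `famA'` (`regL2_integral`). If `i ≠ j`, the kernel of that term is not singular
and the `L²` bound on `f^{(k)}` suffices (`CoefBd.topBd`). If `i = j`, freezing `famW` at `θ = 0` and
replacing the Euler derivative `(z d/dz)^k f` by `z^k f^{(k)}` changes the term by an integrable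
error, and what is left is a bounded multiple of the singular integral of `f^{(k)}`, which the third
part of the norm of `X^{k+log}` controls (`CoefBd.topBd_self`). The reflected factors involve `f`
only outside the unit disc, far from `|z| = ε`, where it is smooth.
-/

noncomputable section

namespace VState

open MeasureTheory Set Filter Topology

/-! ### Towers of derivatives -/

/-- The family `a i`, `i ∈ I`, is bounded on `U`, uniformly in `i`. -/
def UBdd {ι : Type*} (U : Set ℂ) (I : Set ι) (a : ι → ℂ → ℂ) : Prop :=
  ∃ C : ℝ, ∀ i ∈ I, ∀ z ∈ U, ‖a i z‖ ≤ C

/-- `Tower U I Q n a`: every `a i` is `n` times complex differentiable on `U`, the derivatives of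
order less than `n` are bounded on `U` uniformly in `i ∈ I`, and the family of the derivatives of
order `n` satisfies `Q`. -/
def Tower {ι : Type*} (U : Set ℂ) (I : Set ι) (Q : (ι → ℂ → ℂ) → Prop) :
    ℕ → (ι → ℂ → ℂ) → Prop
  | 0, a => Q a
  | n + 1, a => UBdd U I a ∧
      ∃ a' : ι → ℂ → ℂ, (∀ i ∈ I, ∀ z ∈ U, HasDerivAt (a i) (a' i z) z) ∧ Tower U I Q n a'

/-- The properties of the top condition `Q` under which the classes `Tower U I Q n` are stable
under sums, products and lowering of `n`: `Q` is a module over the bounded holomorphic families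
and contains them. -/
structure IsTop {ι : Type*} (U : Set ℂ) (I : Set ι) (Q : (ι → ℂ → ℂ) → Prop) : Prop where
  of_bdd : ∀ a, UBdd U I a → (∀ i ∈ I, DifferentiableOn ℂ (a i) U) → Q a
  add : ∀ a b, Q a → Q b → Q (fun i z => a i z + b i z)
  mul : ∀ a b, Q a → UBdd U I b → (∀ i ∈ I, DifferentiableOn ℂ (b i) U) →
    Q (fun i z => a i z * b i z)
  congr : ∀ a b, (∀ i ∈ I, ∀ z ∈ U, a i z = b i z) → Q a → Q b

section Tower

variable {ι : Type*} {U : Set ℂ} {I : Set ι} {Q : (ι → ℂ → ℂ) → Prop}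

lemma UBdd.add {a b : ι → ℂ → ℂ} (ha : UBdd U I a) (hb : UBdd U I b) :
    UBdd U I (fun i z => a i z + b i z) := by
  obtain ⟨C, hC⟩ := ha
  obtain ⟨D, hD⟩ := hb
  exact ⟨C + D, fun i hi z hz => (norm_add_le _ _).trans (add_le_add (hC i hi z hz) (hD i hi z hz))⟩

lemma UBdd.mul {a b : ι → ℂ → ℂ} (ha : UBdd U I a) (hb : UBdd U I b) :
    UBdd U I (fun i z => a i z * b i z) := by
  obtain ⟨C, hC⟩ := ha
  obtain ⟨D, hD⟩ := hb
  refine ⟨C * D, fun i hi z hz => ?_⟩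
  rw [norm_mul]
  exact mul_le_mul (hC i hi z hz) (hD i hi z hz) (norm_nonneg _)
    ((norm_nonneg _).trans (hC i hi z hz))

lemma UBdd.congr {a b : ι → ℂ → ℂ} (h : ∀ i ∈ I, ∀ z ∈ U, a i z = b i z) (ha : UBdd U I a) :
    UBdd U I b := by
  obtain ⟨C, hC⟩ := ha
  exact ⟨C, fun i hi z hz => h i hi z hz ▸ hC i hi z hz⟩

lemma Tower.congr (hU : IsOpen U) (hQ : IsTop U I Q) {n : ℕ} {a b : ι → ℂ → ℂ}
    (h : ∀ i ∈ I, ∀ z ∈ U, a i z = b i z) (ha : Tower U I Q n a) : Tower U I Q n b := by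
  cases n with
  | zero => exact hQ.congr a b h ha
  | succ n =>
    obtain ⟨h1, a', h2, h3⟩ := ha
    refine ⟨h1.congr h, a', fun i hi z hz => (h2 i hi z hz).congr_of_eventuallyEq ?_, h3⟩
    filter_upwards [hU.mem_nhds hz] with w hw using (h i hi w hw).symm

lemma Tower.differentiableOn {n : ℕ} {a : ι → ℂ → ℂ} (ha : Tower U I Q (n + 1) a) :
    ∀ i ∈ I, DifferentiableOn ℂ (a i) U := by
  obtain ⟨-, a', h2, -⟩ := ha
  exact fun i hi z hz => (h2 i hi z hz).differentiableAt.differentiableWithinAt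

lemma Tower.pred (hQ : IsTop U I Q) {n : ℕ} {a : ι → ℂ → ℂ} (ha : Tower U I Q (n + 1) a) :
    Tower U I Q n a := by
  induction n generalizing a with
  | zero => exact hQ.of_bdd a ha.1 ha.differentiableOn
  | succ n ih =>
    obtain ⟨h1, a', h2, h3⟩ := ha
    exact ⟨h1, a', h2, ih h3⟩

lemma Tower.mono (hQ : IsTop U I Q) {n m : ℕ} (hnm : n ≤ m) {a : ι → ℂ → ℂ}
    (ha : Tower U I Q m a) : Tower U I Q n a := by
  induction m, hnm using Nat.le_induction with
  | base => exact ha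
  | succ m _ ih => exact ih (ha.pred hQ)

lemma Tower.add (hQ : IsTop U I Q) {n : ℕ} {a b : ι → ℂ → ℂ} (ha : Tower U I Q n a)
    (hb : Tower U I Q n b) : Tower U I Q n (fun i z => a i z + b i z) := by
  induction n generalizing a b with
  | zero => exact hQ.add a b ha hb
  | succ n ih =>
    obtain ⟨h1, a', h2, h3⟩ := ha
    obtain ⟨k1, b', k2, k3⟩ := hb
    exact ⟨h1.add k1, _, fun i hi z hz => (h2 i hi z hz).add (k2 i hi z hz), ih h3 k3⟩

/-- In a product, only one factor can carry the unbounded top derivative, so the other one has to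
be bounded: this is why the second factor needs one more derivative. -/
lemma Tower.mul_succ (hQ : IsTop U I Q) {n : ℕ} {a b : ι → ℂ → ℂ} (ha : Tower U I Q n a)
    (hb : Tower U I Q (n + 1) b) : Tower U I Q n (fun i z => a i z * b i z) := by
  induction n generalizing a b with
  | zero => exact hQ.mul a b ha hb.1 hb.differentiableOn
  | succ n ih =>
    have ha0 := ha
    have hb0 := hb
    obtain ⟨h1, a', h2, h3⟩ := ha
    obtain ⟨k1, b', k2, k3⟩ := hb
    refine ⟨h1.mul k1, fun i z => a' i z * b i z + a i z * b' i z,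
      fun i hi z hz => (h2 i hi z hz).mul (k2 i hi z hz), ?_⟩
    have e2 := ih (k3.pred hQ) ha0
    simp only [mul_comm (b' _ _)] at e2
    exact (ih h3 (hb0.pred hQ)).add hQ e2

/-- The classes are algebras for `1 ≤ n`: in the Leibniz formula, the factor that does not carry the
top derivative is then bounded. -/
lemma Tower.mul (hQ : IsTop U I Q) {n m : ℕ} (hm : n ≤ m) (hm1 : 1 ≤ m) {a b : ι → ℂ → ℂ}
    (ha : Tower U I Q n a) (hb : Tower U I Q m b) :
    Tower U I Q n (fun i z => a i z * b i z) := by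
  cases n with
  | zero => exact ha.mul_succ hQ (hb.mono hQ hm1)
  | succ n =>
    have hb0 := hb.mono hQ hm
    have ha0 := ha
    obtain ⟨h1, a', h2, h3⟩ := ha
    have hb1 := hb0
    obtain ⟨k1, b', k2, k3⟩ := hb0
    refine ⟨h1.mul k1, fun i z => a' i z * b i z + a i z * b' i z,
      fun i hi z hz => (h2 i hi z hz).mul (k2 i hi z hz), ?_⟩
    have e2 := k3.mul_succ hQ ha0
    simp only [mul_comm (b' _ _)] at e2
    exact (h3.mul_succ hQ hb1).add hQ e2

lemma Tower.const_mul (hQ : IsTop U I Q) {n : ℕ} {a : ι → ℂ → ℂ} (c : ι → ℂ)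
    (hc : ∃ C : ℝ, ∀ i ∈ I, ‖c i‖ ≤ C) (ha : Tower U I Q n a) :
    Tower U I Q n (fun i z => c i * a i z) := by
  obtain ⟨C, hC⟩ := hc
  induction n generalizing a with
  | zero =>
    have := hQ.mul a (fun i _ => c i) ha ⟨C, fun i hi z _ => hC i hi⟩
      fun i _ => differentiableOn_const _
    exact hQ.congr _ _ (fun i _ z _ => mul_comm _ _) this
  | succ n ih =>
    obtain ⟨h1, a', h2, h3⟩ := ha
    refine ⟨UBdd.mul ⟨C, fun i hi z _ => hC i hi⟩ h1, _,
      fun i hi z hz => (h2 i hi z hz).const_mul (c i), ih h3⟩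

lemma Tower.of_seq {n : ℕ} {a : ℕ → ι → ℂ → ℂ}
    (hd : ∀ l < n, ∀ i ∈ I, ∀ z ∈ U, HasDerivAt (a l i) (a (l + 1) i z) z)
    (hb : ∀ l < n, UBdd U I (a l)) (ht : Q (a n)) : Tower U I Q n (a 0) := by
  induction n generalizing a with
  | zero => exact ht
  | succ n ih =>
    exact ⟨hb 0 n.succ_pos, a 1, hd 0 n.succ_pos,
      ih (a := fun l => a (l + 1)) (fun l hl => hd (l + 1) (by omega))
        (fun l hl => hb (l + 1) (by omega)) ht⟩

/-- A bounded solution `W` of `W' = -(1/2) W ^ 3 P'` gains one derivative over `P'`. The solution in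
use is an inverse square root `W = P ^ (-1/2)`. -/
lemma Tower.of_cube (hU : IsOpen U) (hQ : IsTop U I Q) {n : ℕ} {P' W : ι → ℂ → ℂ}
    (hP' : Tower U I Q n P') (hW : UBdd U I W)
    (hW' : ∀ i ∈ I, ∀ z ∈ U, HasDerivAt (W i) (-(1 / 2) * W i z ^ 3 * P' i z) z) :
    Tower U I Q (n + 1) W := by
  induction n with
  | zero =>
    refine ⟨hW, _, hW', ?_⟩
    have hWd : ∀ i ∈ I, DifferentiableOn ℂ (W i) U :=
      fun i hi z hz => (hW' i hi z hz).differentiableAt.differentiableWithinAt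
    have h3 : UBdd U I (fun i z => -(1 / 2) * W i z ^ 3) := by
      obtain ⟨C, hC⟩ := hW
      refine ⟨‖(-(1 / 2) : ℂ)‖ * C ^ 3, fun i hi z hz => ?_⟩
      rw [norm_mul, norm_pow]
      gcongr
      exact hC i hi z hz
    have := hQ.mul P' (fun i z => -(1 / 2) * W i z ^ 3) hP' h3
      fun i hi => ((hWd i hi).pow 3).const_mul _
    exact hQ.congr _ _ (fun i _ z _ => mul_comm _ _) this
  | succ n ih =>
    have hWn := ih (hP'.pred hQ)
    refine ⟨hW, _, hW', ?_⟩
    have h2 := hWn.mul hQ le_rfl (by omega) hWn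
    have h3 := h2.mul hQ le_rfl (by omega) hWn
    have h4 := (h3.const_mul hQ (fun _ => -(1 / 2)) ⟨_, fun _ _ => le_rfl⟩).mul hQ le_rfl
      (by omega) hP'
    refine h4.congr hU hQ fun i _ z _ => ?_
    ring

end Tower

/-! ### Holomorphic dependence of integrals -/

/-- Differentiation under the integral sign for holomorphic integrands: domination of the integrand
alone suffices, since Cauchy's estimate then dominates the derivative. -/
lemma hasDerivAt_integral_of_holomorphic {μ : Measure ℝ} {I : Set ℝ} (hI : ∀ᵐ θ ∂μ, θ ∈ I)
    {U : Set ℂ} (hU : IsOpen U) {a a' : ℝ → ℂ → ℂ} {q : ℝ → ℝ} (hq : Integrable q μ)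
    (hd : ∀ θ ∈ I, ∀ z ∈ U, HasDerivAt (a θ) (a' θ z) z)
    (hm : ∀ z ∈ U, AEStronglyMeasurable (fun θ => a θ z) μ)
    (hb : ∀ θ ∈ I, ∀ z ∈ U, ‖a θ z‖ ≤ q θ) {z : ℂ} (hz : z ∈ U) :
    AEStronglyMeasurable (fun θ => a' θ z) μ ∧
      HasDerivAt (fun z => ∫ θ, a θ z ∂μ) (∫ θ, a' θ z ∂μ) z := by
  have hmeas : ∀ z ∈ U, AEStronglyMeasurable (fun θ => a' θ z) μ := by
    intro z hz
    obtain ⟨δ, hδ, hball⟩ := Metric.isOpen_iff.1 hU z hz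
    -- difference quotients along `z + δ / (n + 2)`
    have hpos : ∀ n : ℕ, (0 : ℝ) < δ / (n + 2) := fun n => by positivity
    have hmem : ∀ n : ℕ, z + ((δ / (n + 2) : ℝ) : ℂ) ∈ U := by
      intro n
      apply hball
      rw [Metric.mem_ball, dist_eq_norm, add_sub_cancel_left, Complex.norm_real, Real.norm_eq_abs,
        abs_of_pos (hpos n), div_lt_iff₀ (by positivity)]
      nlinarith [(Nat.cast_nonneg n : (0 : ℝ) ≤ n)]
    have hlim : Tendsto (fun n : ℕ => ((δ / (n + 2) : ℝ) : ℂ)) atTop (𝓝[≠] 0) := by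
      rw [tendsto_nhdsWithin_iff]
      refine ⟨?_, Eventually.of_forall fun n => by
        simpa using Complex.ofReal_ne_zero.2 (hpos n).ne'⟩
      have : Tendsto (fun n : ℕ => δ / ((n : ℝ) + 2)) atTop (𝓝 0) :=
        tendsto_const_nhds.div_atTop (tendsto_atTop_add_const_right _ _ tendsto_natCast_atTop_atTop)
      exact_mod_cast (Complex.continuous_ofReal.tendsto 0).comp this
    refine aestronglyMeasurable_of_tendsto_ae atTop
      (f := fun (n : ℕ) θ => ((δ / (n + 2) : ℝ) : ℂ)⁻¹ • (a θ (z + ((δ / (n + 2) : ℝ) : ℂ)) - a θ z))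
      (fun n => ((hm _ (hmem n)).sub (hm z hz)).const_smul (((δ / (n + 2) : ℝ) : ℂ)⁻¹)) ?_
    filter_upwards [hI] with θ hθ
    exact (hasDerivAt_iff_tendsto_slope_zero.1 (hd θ hθ z hz)).comp hlim
  refine ⟨hmeas z hz, ?_⟩
  obtain ⟨δ, hδ, hball⟩ := Metric.isOpen_iff.1 hU z hz
  have hsub : ∀ x ∈ Metric.ball z (δ / 2), Metric.closedBall x (δ / 4) ⊆ U := by
    intro x hx y hy
    apply hball
    rw [Metric.mem_ball] at hx ⊢
    rw [Metric.mem_closedBall] at hy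
    linarith [dist_triangle y x z]
  have hbound : ∀ θ ∈ I, ∀ x ∈ Metric.ball z (δ / 2), ‖a' θ x‖ ≤ q θ / (δ / 4) := by
    intro θ hθ x hx
    have hxU : x ∈ U := hsub x hx (Metric.mem_closedBall_self (by positivity))
    rw [← (hd θ hθ x hxU).deriv]
    refine Complex.norm_deriv_le_of_forall_mem_sphere_norm_le (by positivity) ?_ ?_
    · apply DifferentiableOn.diffContOnCl
      rw [closure_ball _ (by positivity)]
      exact fun y hy => (hd θ hθ y (hsub x hx hy)).differentiableAt.differentiableWithinAt
    · exact fun y hy => hb θ hθ y (hsub x hx (Metric.sphere_subset_closedBall hy))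
  refine (hasDerivAt_integral_of_dominated_loc_of_deriv_le (F := fun z θ => a θ z)
    (F' := fun z θ => a' θ z) (bound := fun θ => q θ / (δ / 4))
    (Metric.ball_mem_nhds z (half_pos hδ)) ?_ ?_ (hmeas z hz) ?_ (hq.div_const _) ?_).2
  · filter_upwards [hU.mem_nhds hz] with w hw using hm w hw
  · exact hq.mono' (hm z hz) (by filter_upwards [hI] with θ hθ using hb θ hθ z hz)
  · filter_upwards [hI] with θ hθ using hbound θ hθ
  · filter_upwards [hI] with θ hθ x hx
    exact hd θ hθ x (hsub x hx (Metric.mem_closedBall_self (by positivity)))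

/-! ### Exponential series -/

/-- The function `ζ ↦ ∑ d_n e^{-(n+1)ζ}`, that is `∑_{n ≥ 1} d_{n-1} z^{-n}` in the logarithmic
coordinate `z = e^ζ`. -/
def expS (d : ℕ → ℝ) (ζ : ℂ) : ℂ := ∑' n : ℕ, (d n : ℂ) * Complex.exp (-((n : ℂ) + 1) * ζ)

/-- The weight `e^{-(n+1)ξ}` of the `n`-th term of an exponential series on `Re ζ = ξ`. -/
def wt (ξ : ℝ) (n : ℕ) : ℝ := Real.exp (-((n : ℝ) + 1) * ξ)

/-- The series `expS d` converges absolutely on the half-plane `Re ζ > L`. -/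
def Decay (L : ℝ) (d : ℕ → ℝ) : Prop := ∀ ξ, L < ξ → Summable fun n => |d n| * wt ξ n

/-- The coefficients of the `l`-th derivative of `expS d`. -/
def dcoef (d : ℕ → ℝ) (l : ℕ) (n : ℕ) : ℝ := (-((n : ℝ) + 1)) ^ l * d n

lemma wt_pos (ξ : ℝ) (n : ℕ) : 0 < wt ξ n := Real.exp_pos _

lemma wt_anti {ξ ξ' : ℝ} (h : ξ ≤ ξ') (n : ℕ) : wt ξ' n ≤ wt ξ n := by
  unfold wt
  apply Real.exp_le_exp.2
  have : (0 : ℝ) < n + 1 := by positivity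
  nlinarith

lemma norm_exp_term (n : ℕ) (ζ : ℂ) : ‖Complex.exp (-((n : ℂ) + 1) * ζ)‖ = wt ζ.re n := by
  rw [Complex.norm_exp, wt]
  congr 1
  have : (-((n : ℂ) + 1) : ℂ) = ((-((n : ℝ) + 1) : ℝ) : ℂ) := by push_cast; ring
  rw [this, Complex.re_ofReal_mul]

lemma norm_term (d : ℕ → ℝ) (n : ℕ) (ζ : ℂ) :
    ‖(d n : ℂ) * Complex.exp (-((n : ℂ) + 1) * ζ)‖ = |d n| * wt ζ.re n := by
  rw [norm_mul, norm_exp_term, Complex.norm_real, Real.norm_eq_abs]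

lemma dcoef_zero (d : ℕ → ℝ) : dcoef d 0 = d := by ext n; simp [dcoef]

lemma dcoef_succ (d : ℕ → ℝ) (l : ℕ) : dcoef d (l + 1) = dcoef (dcoef d l) 1 := by
  ext n; simp only [dcoef, pow_succ]; ring

lemma abs_dcoef (d : ℕ → ℝ) (l n : ℕ) : |dcoef d l n| = ((n : ℝ) + 1) ^ l * |d n| := by
  rw [dcoef, abs_mul, abs_pow, abs_neg, abs_of_nonneg (by positivity : (0 : ℝ) ≤ n + 1)]

lemma Decay.of_le {L : ℝ} {d e : ℕ → ℝ} (hd : Decay L d) (C : ℝ)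
    (h : ∀ n, |e n| ≤ C * (((n : ℝ) + 1) * |d n|)) : Decay L e := by
  intro ξ hξ
  set δ := (ξ - L) / 2 with hδ
  have hδ0 : 0 < δ := by rw [hδ]; linarith
  have hC : ∀ n, |e n| * wt ξ n ≤ |C| * δ⁻¹ * (|d n| * wt (ξ - δ) n) := by
    intro n
    have h1 : ((n : ℝ) + 1) * wt ξ n ≤ δ⁻¹ * wt (ξ - δ) n := by
      have e1 : wt (ξ - δ) n = wt ξ n * Real.exp (((n : ℝ) + 1) * δ) := by
        rw [wt, wt, ← Real.exp_add]; congr 1; ring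
      have e2 := Real.add_one_le_exp (((n : ℝ) + 1) * δ)
      rw [e1]
      have e3 : ((n : ℝ) + 1) ≤ δ⁻¹ * Real.exp (((n : ℝ) + 1) * δ) := by
        rw [inv_mul_eq_div, le_div_iff₀ hδ0]; linarith
      nlinarith [wt_pos ξ n]
    calc |e n| * wt ξ n ≤ |C| * (((n : ℝ) + 1) * |d n|) * wt ξ n := by
          gcongr
          · exact (wt_pos _ _).le
          · exact (h n).trans (by gcongr; exact le_abs_self C)
      _ = |C| * |d n| * (((n : ℝ) + 1) * wt ξ n) := by ring
      _ ≤ |C| * |d n| * (δ⁻¹ * wt (ξ - δ) n) := by gcongr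
      _ = _ := by ring
  exact Summable.of_nonneg_of_le (fun n => by have := wt_pos ξ n; positivity) hC
    ((hd (ξ - δ) (by rw [hδ]; linarith)).mul_left _)

lemma Decay.dcoef {L : ℝ} {d : ℕ → ℝ} (hd : Decay L d) (l : ℕ) : Decay L (dcoef d l) := by
  induction l with
  | zero => rwa [dcoef_zero]
  | succ l ih =>
    rw [dcoef_succ]
    exact ih.of_le 1 fun n => by rw [abs_dcoef]; simp

lemma Decay.summable {L : ℝ} {d : ℕ → ℝ} (hd : Decay L d) {ζ : ℂ} (hζ : L < ζ.re) :
    Summable fun n : ℕ => (d n : ℂ) * Complex.exp (-((n : ℂ) + 1) * ζ) := by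
  apply Summable.of_norm
  simpa only [norm_term] using hd _ hζ

lemma hasDerivAt_expS {L : ℝ} {d : ℕ → ℝ} (hd : Decay L d) {ζ : ℂ} (hζ : L < ζ.re) :
    HasDerivAt (expS d) (expS (dcoef d 1) ζ) ζ := by
  set ξ := (L + ζ.re) / 2 with hξ
  have h1 : L < ξ := by rw [hξ]; linarith
  have h2 : ξ < ζ.re := by rw [hξ]; linarith
  have ht : IsOpen {w : ℂ | ξ < w.re} := isOpen_lt continuous_const Complex.continuous_re
  refine hasDerivAt_tsum_of_isPreconnected (𝕜 := ℂ) (t := {w : ℂ | ξ < w.re}) (y₀ := ζ)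
    (u := fun n => |dcoef d 1 n| * wt ξ n)
    (g := fun (n : ℕ) (ζ : ℂ) => (d n : ℂ) * Complex.exp (-((n : ℂ) + 1) * ζ))
    (g' := fun (n : ℕ) (ζ : ℂ) => (dcoef d 1 n : ℂ) * Complex.exp (-((n : ℂ) + 1) * ζ))
    ((hd.dcoef 1) ξ h1) ht (convex_halfSpace_re_gt ξ).isPreconnected ?_ ?_ h2 (hd.summable hζ) h2
  · intro n y _
    have := ((hasDerivAt_id y).const_mul (-((n : ℂ) + 1))).cexp.const_mul (d n : ℂ)
    refine this.congr_deriv ?_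
    simp only [dcoef, id]
    push_cast
    ring
  · intro n y hy
    rw [norm_term]
    gcongr
    exact wt_anti (le_of_lt hy) n

lemma hasDerivAt_expS_dcoef {L : ℝ} {d : ℕ → ℝ} (hd : Decay L d) (l : ℕ) {ζ : ℂ}
    (hζ : L < ζ.re) : HasDerivAt (expS (dcoef d l)) (expS (dcoef d (l + 1)) ζ) ζ := by
  rw [dcoef_succ]
  exact hasDerivAt_expS (hd.dcoef l) hζ

lemma continuousOn_expS {L : ℝ} {d : ℕ → ℝ} (hd : Decay L d) :
    ContinuousOn (expS d) {ζ | L < ζ.re} :=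
  fun _ hζ => (hasDerivAt_expS hd hζ).continuousAt.continuousWithinAt

lemma continuous_expS_line {L : ℝ} {d : ℕ → ℝ} (hd : Decay L d) {ξ : ℝ} (hξ : L < ξ) :
    Continuous fun t : ℝ => expS d (ξ + t * Complex.I) := by
  refine (continuousOn_expS hd).comp_continuous (by fun_prop) fun t => ?_
  simpa using hξ

lemma norm_expS_le {d : ℕ → ℝ} {ξ : ℝ} (hs : Summable fun n => |d n| * wt ξ n) {ζ : ℂ}
    (hζ : ξ ≤ ζ.re) : ‖expS d ζ‖ ≤ ∑' n, |d n| * wt ξ n := by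
  refine tsum_of_norm_bounded hs.hasSum fun n => ?_
  rw [norm_term]
  gcongr
  exact wt_anti hζ n

lemma expS_periodic (d : ℕ → ℝ) : Function.Periodic (expS d) (2 * Real.pi * Complex.I) := by
  intro ζ
  unfold expS
  congr 1
  ext n
  congr 1
  rw [Complex.exp_eq_exp_iff_exists_int]
  exact ⟨-(n + 1), by push_cast; ring⟩

lemma expS_conj (d : ℕ → ℝ) (ζ : ℂ) :
    expS d ((starRingEnd ℂ) ζ) = (starRingEnd ℂ) (expS d ζ) := by
  unfold expS
  rw [Complex.conj_tsum]
  congr 1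
  ext n
  rw [map_mul, Complex.conj_ofReal, ← Complex.exp_conj]
  simp

/-- Linear combinations of vertical translates of an exponential series are bounded term by
term. -/
lemma norm_expS_comb_le {L : ℝ} {d e : ℕ → ℝ} (hd : Decay L d) (he : Decay L e) {ζ η c : ℂ}
    (hζ : L < ζ.re) (hη : η.re = ζ.re) {ξ : ℝ} (hξ : ξ ≤ ζ.re) {p : ℕ → ℝ} {t : ℝ}
    (hs : Summable fun n => p n * wt ξ n)
    (hp : ∀ n : ℕ, ‖(d n : ℂ) * (Complex.exp (-((n : ℂ) + 1) * (η - ζ)) - 1) - e n * c‖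
      ≤ p n * t) :
    ‖expS d η - expS d ζ - expS e ζ * c‖ ≤ t * ∑' n, p n * wt ξ n := by
  have h1 := ((hd.summable (ζ := η) (hη ▸ hζ)).sub (hd.summable hζ)).sub
    ((he.summable hζ).mul_right c)
  have e1 : expS d η - expS d ζ - expS e ζ * c
      = ∑' n : ℕ, ((d n : ℂ) * Complex.exp (-((n : ℂ) + 1) * η)
        - (d n : ℂ) * Complex.exp (-((n : ℂ) + 1) * ζ)
        - (e n : ℂ) * Complex.exp (-((n : ℂ) + 1) * ζ) * c) := by
    rw [((hd.summable (ζ := η) (hη ▸ hζ)).sub (hd.summable hζ)).tsum_sub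
      ((he.summable hζ).mul_right c), (hd.summable (ζ := η) (hη ▸ hζ)).tsum_sub
      (hd.summable hζ), tsum_mul_right]
    rfl
  rw [e1, ← tsum_mul_left]
  refine tsum_of_norm_bounded (hs.mul_left t).hasSum fun n => ?_
  have e2 : (d n : ℂ) * Complex.exp (-((n : ℂ) + 1) * η)
        - (d n : ℂ) * Complex.exp (-((n : ℂ) + 1) * ζ)
        - (e n : ℂ) * Complex.exp (-((n : ℂ) + 1) * ζ) * c
      = ((d n : ℂ) * (Complex.exp (-((n : ℂ) + 1) * (η - ζ)) - 1) - e n * c)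
        * Complex.exp (-((n : ℂ) + 1) * ζ) := by
    have : Complex.exp (-((n : ℂ) + 1) * η)
      = Complex.exp (-((n : ℂ) + 1) * (η - ζ)) * Complex.exp (-((n : ℂ) + 1) * ζ) := by
      rw [← Complex.exp_add]; congr 1; ring
    rw [this]; ring
  rw [e2, norm_mul, norm_exp_term]
  have h2 := hp n
  have h3 := wt_anti hξ n
  have h4 := wt_pos ζ.re n
  calc _ ≤ p n * t * wt ζ.re n := by gcongr
    _ ≤ p n * t * wt ξ n := by
      have : 0 ≤ p n * t := (norm_nonneg _).trans h2
      gcongr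
    _ = _ := by ring

lemma norm_exp_I_sub_one_le (x : ℝ) : ‖Complex.exp (x * Complex.I) - 1‖ ≤ |x| := by
  have := Real.norm_exp_I_mul_ofReal_sub_one_le (x := x)
  rwa [mul_comm, Real.norm_eq_abs] at this

lemma norm_exp_I_sub_one_le_two (x : ℝ) : ‖Complex.exp (x * Complex.I) - 1‖ ≤ 2 := by
  refine (norm_sub_le _ _).trans ?_
  rw [Complex.norm_exp_ofReal_mul_I, norm_one]; norm_num

lemma norm_exp_I_sub_one_le_rpow (x : ℝ) :
    ‖Complex.exp (x * Complex.I) - 1‖ ≤ 2 * |x| ^ (1 / 4 : ℝ) := by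
  rcases le_total |x| 1 with h | h
  · have h1 : |x| ≤ |x| ^ (1 / 4 : ℝ) := by
      rcases (abs_nonneg x).eq_or_lt with h0 | h0
      · rw [← h0]; positivity
      · simpa using Real.rpow_le_rpow_of_exponent_ge h0 h (by norm_num : (1 / 4 : ℝ) ≤ 1)
    have : 0 ≤ |x| ^ (1 / 4 : ℝ) := by positivity
    linarith [norm_exp_I_sub_one_le x]
  · have := Real.one_le_rpow h (by norm_num : (0 : ℝ) ≤ 1 / 4)
    linarith [norm_exp_I_sub_one_le_two x]

lemma norm_exp_I_sub_one_sub_le (x : ℝ) :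
    ‖Complex.exp (x * Complex.I) - 1 - x * Complex.I‖ ≤ 2 * x ^ 2 := by
  have hx : ‖(x * Complex.I : ℂ)‖ = |x| := by simp
  rcases le_total |x| 1 with h | h
  · have := Complex.norm_exp_sub_one_sub_id_le (x := x * Complex.I) (by rwa [hx])
    rw [hx, sq_abs] at this
    nlinarith [sq_nonneg x]
  · have h1 := norm_exp_I_sub_one_le x
    have h2 := norm_sub_le (Complex.exp (x * Complex.I) - 1) (x * Complex.I)
    rw [hx] at h2
    nlinarith [sq_abs x]

lemma neg_mul_shift (n : ℕ) (ζ : ℂ) (θ : ℝ) :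
    Complex.exp (-((n : ℂ) + 1) * (ζ + θ * Complex.I - ζ))
      = Complex.exp (((-((n : ℝ) + 1) * θ : ℝ) : ℂ) * Complex.I) := by
  congr 1; push_cast; ring

/-- Lipschitz bound in the vertical direction. -/
lemma norm_expS_shift_le {L : ℝ} {d : ℕ → ℝ} (hd : Decay L d) {ζ : ℂ} (hζ : L < ζ.re) {ξ : ℝ}
    (hξ : ξ ≤ ζ.re) (hs : Summable fun n : ℕ => ((n : ℝ) + 1) * |d n| * wt ξ n) (θ : ℝ) :
    ‖expS d (ζ + θ * Complex.I) - expS d ζ‖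
      ≤ |θ| * ∑' n : ℕ, ((n : ℝ) + 1) * |d n| * wt ξ n := by
  have := norm_expS_comb_le hd hd (η := ζ + θ * Complex.I) (c := 0) hζ (by simp) hξ
    (p := fun (n : ℕ) => ((n : ℝ) + 1) * |d n|) (t := |θ|) hs ?_
  · simpa using this
  intro n
  rw [mul_zero, sub_zero, norm_mul, neg_mul_shift, Complex.norm_real, Real.norm_eq_abs]
  calc |d n| * _ ≤ |d n| * |-((n : ℝ) + 1) * θ| := by gcongr; exact norm_exp_I_sub_one_le _
    _ = _ := by
      rw [abs_mul, abs_neg, abs_of_nonneg (by positivity : (0 : ℝ) ≤ n + 1)]; ring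

/-- Hölder bound in the vertical direction. -/
lemma norm_expS_shift_le_rpow {L : ℝ} {d : ℕ → ℝ} (hd : Decay L d) {ζ : ℂ} (hζ : L < ζ.re)
    {ξ : ℝ} (hξ : ξ ≤ ζ.re)
    (hs : Summable fun n : ℕ => ((n : ℝ) + 1) ^ (1 / 4 : ℝ) * |d n| * wt ξ n) (θ : ℝ) :
    ‖expS d (ζ + θ * Complex.I) - expS d ζ‖
      ≤ 2 * |θ| ^ (1 / 4 : ℝ) * ∑' n : ℕ, ((n : ℝ) + 1) ^ (1 / 4 : ℝ) * |d n| * wt ξ n := by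
  have := norm_expS_comb_le hd hd (η := ζ + θ * Complex.I) (c := 0) hζ (by simp) hξ
    (p := fun (n : ℕ) => ((n : ℝ) + 1) ^ (1 / 4 : ℝ) * |d n|) (t := 2 * |θ| ^ (1 / 4 : ℝ)) hs ?_
  · simpa using this
  intro n
  rw [mul_zero, sub_zero, norm_mul, neg_mul_shift, Complex.norm_real, Real.norm_eq_abs]
  calc |d n| * _ ≤ |d n| * (2 * |-((n : ℝ) + 1) * θ| ^ (1 / 4 : ℝ)) := by
        gcongr; exact norm_exp_I_sub_one_le_rpow _
    _ = _ := by
      rw [abs_mul, abs_neg, abs_of_nonneg (by positivity : (0 : ℝ) ≤ n + 1),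
        Real.mul_rpow (by positivity) (abs_nonneg _)]; ring

/-- First order expansion in the vertical direction, with increment `e^{iθ} - 1`. -/
lemma norm_expS_taylor_le {L : ℝ} {d : ℕ → ℝ} (hd : Decay L d) {ζ : ℂ} (hζ : L < ζ.re) {ξ : ℝ}
    (hξ : ξ ≤ ζ.re) (hs : Summable fun n : ℕ => ((n : ℝ) + 1) ^ 2 * |d n| * wt ξ n) (θ : ℝ) :
    ‖expS d (ζ + θ * Complex.I) - expS d ζ
        - expS (dcoef d 1) ζ * (Complex.exp (θ * Complex.I) - 1)‖
      ≤ (4 * θ ^ 2) * ∑' n : ℕ, ((n : ℝ) + 1) ^ 2 * |d n| * wt ξ n := by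
  refine norm_expS_comb_le hd (hd.dcoef 1) hζ (by simp) hξ hs fun n => ?_
  rw [neg_mul_shift]
  have e : (d n : ℂ) * (Complex.exp (((-((n : ℝ) + 1) * θ : ℝ) : ℂ) * Complex.I) - 1)
      - (dcoef d 1 n : ℝ) * (Complex.exp (θ * Complex.I) - 1)
      = d n * ((Complex.exp (((-((n : ℝ) + 1) * θ : ℝ) : ℂ) * Complex.I) - 1
          - ((-((n : ℝ) + 1) * θ : ℝ) : ℂ) * Complex.I)
        + ((n : ℝ) + 1 : ℝ) * (Complex.exp (θ * Complex.I) - 1 - θ * Complex.I)) := by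
    simp only [dcoef]; push_cast; ring
  rw [e, norm_mul, Complex.norm_real, Real.norm_eq_abs]
  have h1 := norm_exp_I_sub_one_sub_le (-((n : ℝ) + 1) * θ)
  have h2 := norm_exp_I_sub_one_sub_le θ
  have hn : (0 : ℝ) ≤ n := Nat.cast_nonneg n
  calc |d n| * _ ≤ |d n| * (2 * (-((n : ℝ) + 1) * θ) ^ 2 + ((n : ℝ) + 1) * (2 * θ ^ 2)) := by
        gcongr
        refine (norm_add_le _ _).trans (add_le_add h1 ?_)
        rw [norm_mul, Complex.norm_real, Real.norm_eq_abs,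
          abs_of_nonneg (by positivity : (0 : ℝ) ≤ n + 1)]
        gcongr
    _ ≤ |d n| * (4 * θ ^ 2 * ((n : ℝ) + 1) ^ 2) := by
        gcongr
        nlinarith [mul_nonneg hn (sq_nonneg θ), mul_nonneg (mul_nonneg hn hn) (sq_nonneg θ)]
    _ = _ := by ring

/-! ### Parseval -/

lemma integral_exp_int {m : ℤ} (hm : m ≠ 0) :
    ∫ t in (0 : ℝ)..(2 * Real.pi), Complex.exp (m * t * Complex.I) = 0 := by
  have h0 : (m * Complex.I : ℂ) ≠ 0 := by simp [hm]
  have := integral_exp_mul_complex (a := 0) (b := 2 * Real.pi) h0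
  have e : ∀ t : ℝ, (m * t * Complex.I : ℂ) = m * Complex.I * t := fun t => by ring
  simp only [e]
  rw [this, div_eq_zero_iff]
  left
  rw [sub_eq_zero, Complex.exp_eq_exp_iff_exists_int]
  exact ⟨m, by push_cast; ring⟩

lemma integral_expS_mul_exp {L : ℝ} {d : ℕ → ℝ} (hd : Decay L d) {ξ : ℝ} (hξ : L < ξ) (m : ℕ) :
    ∫ t in (0 : ℝ)..(2 * Real.pi),
      Complex.exp (((m : ℂ) + 1) * t * Complex.I) * expS d (ξ + t * Complex.I)
      = 2 * Real.pi * (d m * wt ξ m : ℝ) := by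
  have key := intervalIntegral.hasSum_integral_of_dominated_convergence
    (a := 0) (b := 2 * Real.pi) (μ := volume)
    (F := fun (n : ℕ) (t : ℝ) => Complex.exp (((m : ℂ) + 1) * t * Complex.I)
      * ((d n : ℂ) * Complex.exp (-((n : ℂ) + 1) * (ξ + t * Complex.I))))
    (f := fun t => Complex.exp (((m : ℂ) + 1) * t * Complex.I) * expS d (ξ + t * Complex.I))
    (fun n _ => |d n| * wt ξ n) (fun n => by fun_prop) ?_ ?_ ?_ ?_
  · have hterm : ∀ n : ℕ, ∫ t in (0 : ℝ)..(2 * Real.pi), Complex.exp (((m : ℂ) + 1) * t * Complex.I)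
        * ((d n : ℂ) * Complex.exp (-((n : ℂ) + 1) * (ξ + t * Complex.I)))
        = (d n * wt ξ n : ℝ) * (∫ t in (0 : ℝ)..(2 * Real.pi),
          Complex.exp (((m - n : ℤ) : ℂ) * t * Complex.I)) := by
      intro n
      rw [← intervalIntegral.integral_const_mul]
      congr 1
      ext t
      rw [wt, Complex.ofReal_mul, Complex.ofReal_exp, mul_left_comm, ← Complex.exp_add,
        mul_assoc (d n : ℂ), ← Complex.exp_add]
      congr 2
      push_cast
      ring
    simp only [hterm] at key
    have h2 := hasSum_ite_eq m (2 * Real.pi * (d m * wt ξ m : ℝ) : ℂ)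
    refine key.unique (h2.congr_fun fun n => ?_)
    split_ifs with h
    · subst h; simp; ring
    · rw [integral_exp_int (by omega), mul_zero]
  · intro n
    filter_upwards with t _
    rw [norm_mul, norm_term]
    have : ‖Complex.exp (((m : ℂ) + 1) * t * Complex.I)‖ = 1 := by
      have : (((m : ℂ) + 1) * t * Complex.I) = (((m + 1) * t : ℝ) : ℂ) * Complex.I := by
        push_cast; ring
      rw [this, Complex.norm_exp_ofReal_mul_I]
    rw [this, one_mul]
    simp
  · filter_upwards with t _ using hd ξ hξ
  · simp
  · filter_upwards with t _
    exact (hd.summable (by simpa using hξ)).hasSum.mul_left _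

/-- The `L²` norm on the vertical segment `Re ζ = ξ`, `0 < Im ζ ≤ 2π`. -/
def lineNorm (a : ℂ → ℂ) (ξ : ℝ) : ENNReal :=
  eLpNorm (fun t : ℝ => a (ξ + t * Complex.I)) 2 (volume.restrict (Ioc 0 (2 * Real.pi)))

lemma sum_sq_le_of_lineNorm_le {L : ℝ} {d : ℕ → ℝ} (hd : Decay L d) {ξ : ℝ} (hξ : L < ξ) {r : ℝ}
    (hr : 0 ≤ r) (h : lineNorm (expS d) ξ ≤ ENNReal.ofReal r) (N : ℕ) :
    ∑ n ∈ Finset.range N, (d n * wt ξ n) ^ 2 ≤ r ^ 2 := by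
  have hpi : (0 : ℝ) < 2 * Real.pi := by positivity
  have hL2 : MemLp (fun t : ℝ => expS d (ξ + t * Complex.I)) 2
      (volume.restrict (Ioc 0 (2 * Real.pi))) :=
    ⟨(continuous_expS_line hd hξ).aestronglyMeasurable, h.trans_lt ENNReal.ofReal_lt_top⟩
  have h1 := hasSum_sq_fourierCoeffOn hpi hL2
  have hint : ∫ t in (0 : ℝ)..(2 * Real.pi), ‖expS d (ξ + t * Complex.I)‖ ^ 2 ≤ r ^ 2 := by
    have h2 := h
    rw [lineNorm, hL2.eLpNorm_eq_integral_rpow_norm (by norm_num) (by norm_num),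
      ENNReal.ofReal_le_ofReal_iff hr] at h2
    rw [intervalIntegral.integral_of_le hpi.le]
    simp only [ENNReal.toReal_ofNat, Real.rpow_ofNat] at h2
    have h3 : 0 ≤ ∫ a in Ioc 0 (2 * Real.pi), ‖expS d (ξ + a * Complex.I)‖ ^ 2 :=
      integral_nonneg fun _ => by positivity
    rw [← one_div, ← Real.sqrt_eq_rpow] at h2
    exact (Real.sqrt_le_left hr).1 h2
  have hc : ∀ n : ℕ, fourierCoeffOn hpi (fun t : ℝ => expS d (ξ + t * Complex.I)) (-(n + 1))
      = (d n * wt ξ n : ℝ) := by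
    intro n
    rw [fourierCoeffOn_eq_integral]
    have h4 := integral_expS_mul_exp hd hξ n
    have h5 : ∀ x : ℝ, fourier (-(-((n : ℤ) + 1))) (x : AddCircle (2 * Real.pi - 0))
        = Complex.exp (((n : ℂ) + 1) * x * Complex.I) := by
      intro x
      rw [fourier_coe_apply]
      congr 1
      have : (Real.pi : ℂ) ≠ 0 := Complex.ofReal_ne_zero.2 Real.pi_ne_zero
      push_cast
      field_simp
      ring
    simp only [h5, smul_eq_mul, h4, sub_zero]
    rw [Complex.real_smul]
    have : (Real.pi : ℂ) ≠ 0 := Complex.ofReal_ne_zero.2 Real.pi_ne_zero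
    push_cast
    field_simp
  have h5 := sum_le_hasSum (((Finset.range N).image fun n : ℕ => (-(n + 1) : ℤ)))
    (fun i _ => by positivity) h1
  rw [Finset.sum_image (by intro a _ b _ hab; simpa using hab)] at h5
  simp only [hc, Complex.norm_real, Real.norm_eq_abs, sq_abs] at h5
  refine h5.trans (le_trans ?_ hint)
  rw [smul_eq_mul, sub_zero]
  refine mul_le_of_le_one_left ?_ (inv_le_one_of_one_le₀ ?_)
  · exact intervalIntegral.integral_nonneg hpi.le fun _ _ => by positivity
  · linarith [Real.pi_gt_three]

/-! ### Logarithmic coordinates -/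

/-- The function `ζ ↦ z^m h^{(m)}(z)`, `z = e^ζ`. -/
def eulerPow (h : ℂ → ℂ) (m : ℕ) (ζ : ℂ) : ℂ :=
  Complex.exp ζ ^ m * iteratedDeriv m h (Complex.exp ζ)

lemma hasDerivAt_eulerPow {h : ℂ → ℂ} {V : Set ℂ} (hV : IsOpen V) (hh : DifferentiableOn ℂ h V)
    (m : ℕ) {ζ : ℂ} (hζ : Complex.exp ζ ∈ V) :
    HasDerivAt (eulerPow h m) (m * eulerPow h m ζ + eulerPow h (m + 1) ζ) ζ := by
  have han : AnalyticAt ℂ h (Complex.exp ζ) := hh.analyticAt (hV.mem_nhds hζ)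
  have hd : HasDerivAt (iteratedDeriv m h) (iteratedDeriv (m + 1) h (Complex.exp ζ))
      (Complex.exp ζ) := by
    rw [iteratedDeriv_succ]
    have : AnalyticAt ℂ (iteratedDeriv m h) (Complex.exp ζ) := by
      rw [iteratedDeriv_eq_iterate]; exact han.iterated_deriv m
    exact this.differentiableAt.hasDerivAt
  have he := Complex.hasDerivAt_exp ζ
  refine ((he.pow m).mul (hd.comp ζ he)).congr_deriv ?_
  simp only [eulerPow, Pi.pow_apply, Function.comp]
  rcases m with _ | m
  · simp; ring
  · simp only [Nat.add_sub_cancel]; push_cast; ring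

lemma expS_comb {L : ℝ} {d e : ℕ → ℝ} (hd : Decay L d) (he : Decay L e) (a : ℝ) {ζ : ℂ}
    (hζ : L < ζ.re) : expS (fun n => d n - a * e n) ζ = expS d ζ - a * expS e ζ := by
  unfold expS
  rw [← tsum_mul_left, ← (hd.summable hζ).tsum_sub ((he.summable hζ).mul_left _)]
  congr 1
  ext n
  push_cast
  ring

/-- The coefficients of `z^m h^{(m)}(z)` for `h(z) = ∑ c_n z^{-(n+1)}`. -/
def fallCoef (c : ℕ → ℝ) : ℕ → ℕ → ℝ
  | 0 => c
  | m + 1 => fun n => dcoef (fallCoef c m) 1 n - m * fallCoef c m n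

/-- The factor of `c n` in `fallCoef c m n` is `±(n+1)(n+2)⋯(n+m)`. -/
lemma le_abs_fallCoef (c : ℕ → ℝ) (m n : ℕ) :
    ((n : ℝ) + 1) ^ m * |c n| ≤ |fallCoef c m n| := by
  induction m with
  | zero => simp [fallCoef]
  | succ m ih =>
    have e : fallCoef c (m + 1) n = -((n : ℝ) + 1 + m) * fallCoef c m n := by
      simp only [fallCoef, dcoef]; ring
    rw [e, abs_mul, abs_neg, abs_of_nonneg (by positivity : (0 : ℝ) ≤ n + 1 + m)]
    calc ((n : ℝ) + 1) ^ (m + 1) * |c n| = ((n : ℝ) + 1) * (((n : ℝ) + 1) ^ m * |c n|) := by ring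
      _ ≤ ((n : ℝ) + 1) * |fallCoef c m n| := by gcongr
      _ ≤ _ := mul_le_mul_of_nonneg_right (by simp) (abs_nonneg _)

lemma Decay.fallCoef {L : ℝ} {c : ℕ → ℝ} (hc : Decay L c) (m : ℕ) : Decay L (fallCoef c m) := by
  induction m with
  | zero => exact hc
  | succ m ih =>
    refine ih.of_le (m + 1) fun n => ?_
    have e : VState.fallCoef c (m + 1) n = -((n : ℝ) + 1 + m) * VState.fallCoef c m n := by
      simp only [VState.fallCoef, VState.dcoef]; ring
    rw [e, abs_mul, abs_neg, abs_of_nonneg (by positivity : (0 : ℝ) ≤ n + 1 + m), ← mul_assoc]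
    gcongr
    nlinarith [(Nat.cast_nonneg n : (0 : ℝ) ≤ n), (Nat.cast_nonneg m : (0 : ℝ) ≤ m),
      mul_nonneg (Nat.cast_nonneg n : (0 : ℝ) ≤ n) (Nat.cast_nonneg m : (0 : ℝ) ≤ m)]

/-- `z^m h^{(m)}` and `(z d/dz)^m h` agree up to terms of lower order. -/
lemma exists_abs_dcoef_sub_fallCoef_le (m : ℕ) : ∃ C : ℝ, 0 ≤ C ∧ ∀ (c : ℕ → ℝ) (n : ℕ),
    |dcoef c (m + 1) n - fallCoef c (m + 1) n| ≤ C * (((n : ℝ) + 1) ^ m * |c n|) := by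
  induction m with
  | zero => exact ⟨0, le_rfl, fun c n => by simp [fallCoef]⟩
  | succ m ih =>
    obtain ⟨C, hC, h⟩ := ih
    refine ⟨C * (m + 2) + (m + 1), by positivity, fun c n => ?_⟩
    have e : dcoef c (m + 2) n - fallCoef c (m + 2) n
        = -((n : ℝ) + 1 + (m + 1)) * (dcoef c (m + 1) n - fallCoef c (m + 1) n)
          + (m + 1) * dcoef c (m + 1) n := by
      rw [fallCoef, dcoef_succ c (m + 1)]
      simp only [dcoef]; push_cast; ring
    have h1 := h c n
    rw [e]
    refine (abs_add_le _ _).trans ?_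
    rw [abs_mul, abs_mul, abs_dcoef, abs_neg,
      abs_of_nonneg (by positivity : (0 : ℝ) ≤ n + 1 + (m + 1)),
      abs_of_nonneg (by positivity : (0 : ℝ) ≤ m + 1)]
    have hn : ((n : ℝ) + 1 + (m + 1)) ≤ ((n : ℝ) + 1) * (m + 2) := by
      nlinarith [(Nat.cast_nonneg n : (0 : ℝ) ≤ n), (Nat.cast_nonneg m : (0 : ℝ) ≤ m),
        mul_nonneg (Nat.cast_nonneg n : (0 : ℝ) ≤ n) (Nat.cast_nonneg m : (0 : ℝ) ≤ m)]
    calc _ ≤ ((n : ℝ) + 1) * (m + 2) * (C * (((n : ℝ) + 1) ^ m * |c n|))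
          + (m + 1) * (((n : ℝ) + 1) ^ (m + 1) * |c n|) := by gcongr
      _ = _ := by ring

lemma log_exp_mem {ε : ℝ} (hε : 0 < ε) {ζ : ℂ} : Real.log ε < ζ.re ↔ ε < ‖Complex.exp ζ‖ := by
  rw [Complex.norm_exp, Real.log_lt_iff_lt_exp hε]

lemma isOpen_exterior (ε : ℝ) : IsOpen (exterior ε) := isOpen_lt continuous_const continuous_norm

/-- The derivatives of an element of `spaceA` as exponential series in the coordinate `ζ`. -/
lemma exists_coef {ε : ℝ} (hε : 0 < ε) {f : ℂ → ℂ} (hf : f ∈ spaceA ε) :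
    ∃ c : ℕ → ℝ, Decay (Real.log ε) c ∧ ∀ m, ∀ ζ : ℂ, Real.log ε < ζ.re →
      eulerPow f m ζ = expS (fallCoef c m) ζ := by
  obtain ⟨hd, c, hc⟩ := hf
  have key : ∀ (n : ℕ) (ζ : ℂ), (Complex.exp ζ ^ (n + 1))⁻¹ = Complex.exp (-((n : ℂ) + 1) * ζ) := by
    intro n ζ
    rw [← Complex.exp_nat_mul, ← Complex.exp_neg]; congr 1; push_cast; ring
  have hdec : Decay (Real.log ε) c := by
    intro ξ hξ
    have h1 := (hc (Complex.exp ξ) ((log_exp_mem hε).1 (by simpa using hξ))).summable.norm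
    simpa only [key, norm_term, Complex.ofReal_re] using h1
  refine ⟨c, hdec, fun m => ?_⟩
  induction m with
  | zero =>
    intro ζ hζ
    have h1 := hc (Complex.exp ζ) ((log_exp_mem hε).1 hζ)
    simp only [key] at h1
    simp only [eulerPow, pow_zero, one_mul, iteratedDeriv_zero, fallCoef]
    exact h1.tsum_eq.symm
  | succ m ih =>
    intro ζ hζ
    have h1 := hasDerivAt_eulerPow (isOpen_exterior ε) hd m ((log_exp_mem hε).1 hζ)
    have h2 : HasDerivAt (eulerPow f m) (expS (dcoef (fallCoef c m) 1) ζ) ζ := by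
      refine (hasDerivAt_expS (hdec.fallCoef m) hζ).congr_of_eventuallyEq ?_
      filter_upwards [(isOpen_lt continuous_const Complex.continuous_re).mem_nhds hζ] with w hw
        using ih w hw
    have h3 := h1.unique h2
    rw [fallCoef, expS_comb ((hdec.fallCoef m).dcoef 1) (hdec.fallCoef m) _ hζ, ← h3, ih ζ hζ]
    push_cast
    ring

lemma exp_line (ξ t : ℝ) :
    Complex.exp (ξ + t * Complex.I) = (Real.exp ξ : ℂ) * circleMap 0 1 t := by
  rw [Complex.exp_add, circleMap]; simp

lemma lineNorm_eulerPow_le (h : ℂ → ℂ) (m : ℕ) {ξ : ℝ} (hξ : ξ ≤ 0) :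
    lineNorm (eulerPow h m) ξ ≤ circleNorm (fun ω => iteratedDeriv m h ((Real.exp ξ : ℂ) * ω)) := by
  refine eLpNorm_mono fun t => ?_
  simp only [eulerPow, exp_line]
  rw [norm_mul]
  refine mul_le_of_le_one_left (norm_nonneg _) ?_
  rw [norm_pow, norm_mul, norm_circleMap_zero, Complex.norm_real, Real.norm_eq_abs,
    abs_of_pos (Real.exp_pos _), abs_one, mul_one]
  exact pow_le_one₀ (Real.exp_pos _).le (Real.exp_le_one_iff.2 hξ)

lemma circleNorm_le_lineNorm_eulerPow (h : ℂ → ℂ) (m : ℕ) (ξ : ℝ) :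
    circleNorm (fun ω => iteratedDeriv m h ((Real.exp ξ : ℂ) * ω))
      ≤ ENNReal.ofReal (Real.exp (-ξ) ^ m) * lineNorm (eulerPow h m) ξ := by
  refine eLpNorm_le_mul_eLpNorm_of_ae_le_mul (Eventually.of_forall fun t => ?_) 2
  simp only [eulerPow, exp_line]
  rw [norm_mul, norm_pow, norm_mul, norm_circleMap_zero, Complex.norm_real, Real.norm_eq_abs,
    abs_of_pos (Real.exp_pos _), abs_one, mul_one, ← mul_assoc, ← mul_pow, ← Real.exp_add]
  simp

/-! ### Coefficient bounds -/

/-- The coefficients `c` decay so fast that the derivatives of order less than `k` of `expS c` are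
bounded by `B` up to the boundary `Re ζ = L`, with a Hölder exponent `1/4` to spare. Only `1 ≤ k` is
meant, so that `k - 1` is not truncated. -/
structure CoefBd (L : ℝ) (k : ℕ) (B : ℝ) (c : ℕ → ℝ) : Prop where
  decay : Decay L c
  summable : Summable fun n : ℕ =>
    ((n : ℝ) + 1) ^ (1 / 4 : ℝ) * (((n : ℝ) + 1) ^ (k - 1) * |c n|) * wt L n
  tsum_le : ∑' n : ℕ,
    ((n : ℝ) + 1) ^ (1 / 4 : ℝ) * (((n : ℝ) + 1) ^ (k - 1) * |c n|) * wt L n ≤ B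

/-- The constant in the Cauchy–Schwarz estimate of coefficient sums by `L²` norms. -/
def csConst : ℝ := √(∑' n : ℕ, ((n : ℝ) + 1) ^ (-(3 / 2) : ℝ))

lemma summable_csConst : Summable fun n : ℕ => ((n : ℝ) + 1) ^ (-(3 / 2) : ℝ) := by
  have := (summable_nat_add_iff 1).2 (Real.summable_nat_rpow.2 (by norm_num : (-(3 / 2) : ℝ) < -1))
  simpa using this

/-- By the Cauchy–Schwarz inequality, passing from square summable to summable coefficients costs
`3/4` of a derivative, since the weight `(n+1)^{-3/4}` is square summable. -/
lemma coefBd_of_sum_sq_le {L : ℝ} {k : ℕ} (hk : 1 ≤ k) {c : ℕ → ℝ} (hc : Decay L c) {r : ℝ}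
    (hr : 0 ≤ r)
    (h : ∀ N, ∑ n ∈ Finset.range N, (((n : ℝ) + 1) ^ k * |c n| * wt L n) ^ 2 ≤ r ^ 2) :
    CoefBd L k (r * csConst) c := by
  have key : ∀ N, ∑ n ∈ Finset.range N,
      ((n : ℝ) + 1) ^ (1 / 4 : ℝ) * (((n : ℝ) + 1) ^ (k - 1) * |c n|) * wt L n ≤ r * csConst := by
    intro N
    have e : ∀ n : ℕ, ((n : ℝ) + 1) ^ (1 / 4 : ℝ) * (((n : ℝ) + 1) ^ (k - 1) * |c n|) * wt L n
        = (((n : ℝ) + 1) ^ k * |c n| * wt L n) * ((n : ℝ) + 1) ^ (-(3 / 4) : ℝ) := by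
      intro n
      have hn : (0 : ℝ) < n + 1 := by positivity
      have e1 : ((n : ℝ) + 1) ^ (1 / 4 : ℝ) = ((n : ℝ) + 1) * ((n : ℝ) + 1) ^ (-(3 / 4) : ℝ) := by
        rw [← Real.rpow_one_add' hn.le (by norm_num)]; norm_num
      have e2 : ((n : ℝ) + 1) ^ k = ((n : ℝ) + 1) ^ (k - 1) * ((n : ℝ) + 1) := by
        rw [← pow_succ, Nat.sub_add_cancel hk]
      rw [e1, e2]; ring
    simp only [e]
    have h1 := Finset.sum_mul_sq_le_sq_mul_sq (Finset.range N)
      (fun n : ℕ => ((n : ℝ) + 1) ^ k * |c n| * wt L n)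
      (fun n : ℕ => ((n : ℝ) + 1) ^ (-(3 / 4) : ℝ))
    have h2 : ∑ n ∈ Finset.range N, (((n : ℝ) + 1) ^ (-(3 / 4) : ℝ)) ^ 2 ≤ csConst ^ 2 := by
      rw [csConst, Real.sq_sqrt (tsum_nonneg fun n => by positivity)]
      refine le_trans (le_of_eq ?_) (summable_csConst.sum_le_tsum (Finset.range N)
        fun n _ => by positivity)
      refine Finset.sum_congr rfl fun n _ => ?_
      rw [← Real.rpow_natCast, ← Real.rpow_mul (by positivity)]
      norm_num
    refine le_of_sq_le_sq ?_ (by unfold csConst; positivity)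
    rw [mul_pow]
    exact h1.trans (mul_le_mul (h N) h2 (Finset.sum_nonneg fun _ _ => by positivity) (by positivity))
  have hnn : ∀ n : ℕ, 0 ≤ ((n : ℝ) + 1) ^ (1 / 4 : ℝ) * (((n : ℝ) + 1) ^ (k - 1) * |c n|) * wt L n :=
    fun n => by have := wt_pos L n; positivity
  exact ⟨hc, summable_of_sum_range_le hnn key, Real.tsum_le_of_sum_range_le hnn key⟩

/-- Parseval on the lines `Re ζ = ξ`, in the limit `ξ → L`. -/
lemma coefBd_of_lineNorm_le {L : ℝ} (hL : L < 0) {k : ℕ} (hk : 1 ≤ k) {c : ℕ → ℝ}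
    (hc : Decay L c) {r : ℝ} (hr : 0 ≤ r)
    (h : ∀ ξ ∈ Ioo L 0, lineNorm (expS (fallCoef c k)) ξ ≤ ENNReal.ofReal r) :
    CoefBd L k (r * csConst) c := by
  refine coefBd_of_sum_sq_le hk hc hr fun N => ?_
  have h1 : ∑ n ∈ Finset.range N, (fallCoef c k n * wt L n) ^ 2 ≤ r ^ 2 := by
    have hcont : Continuous fun ξ : ℝ => ∑ n ∈ Finset.range N, (fallCoef c k n * wt ξ n) ^ 2 := by
      unfold wt; fun_prop
    refine le_of_tendsto (hcont.continuousWithinAt (s := Ioi L) (x := L)) ?_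
    filter_upwards [Ioo_mem_nhdsGT hL] with ξ hξ
    exact sum_sq_le_of_lineNorm_le (hc.fallCoef k) hξ.1 hr (h ξ hξ) N
  refine le_trans (Finset.sum_le_sum fun n _ => ?_) h1
  rw [← sq_abs (fallCoef c k n * wt L n), abs_mul, abs_of_pos (wt_pos L n)]
  have := wt_pos L n
  gcongr
  exact le_abs_fallCoef c k n

section CoefBd

variable {L B : ℝ} {k : ℕ} {c : ℕ → ℝ}

lemma CoefBd.nonneg (h : CoefBd L k B c) : 0 ≤ B :=
  (tsum_nonneg fun n => by have := wt_pos L n; positivity).trans h.tsum_le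

lemma CoefBd.summable_of_le (h : CoefBd L k B c) {p : ℕ → ℝ} {M : ℝ} (hM : 0 ≤ M)
    (hp0 : ∀ n, 0 ≤ p n)
    (hp : ∀ n : ℕ, p n ≤ M * (((n : ℝ) + 1) ^ (1 / 4 : ℝ) * (((n : ℝ) + 1) ^ (k - 1) * |c n|))) :
    Summable (fun n => p n * wt L n) ∧ ∑' n, p n * wt L n ≤ M * B := by
  have hle : ∀ n : ℕ, p n * wt L n ≤
      M * (((n : ℝ) + 1) ^ (1 / 4 : ℝ) * (((n : ℝ) + 1) ^ (k - 1) * |c n|) * wt L n) := by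
    intro n
    have := mul_le_mul_of_nonneg_right (hp n) (wt_pos L n).le
    linarith
  have hs := Summable.of_nonneg_of_le (fun n => mul_nonneg (hp0 n) (wt_pos L n).le) hle
    (h.summable.mul_left M)
  refine ⟨hs, (hs.tsum_le_tsum hle (h.summable.mul_left M)).trans ?_⟩
  rw [tsum_mul_left]
  exact mul_le_mul_of_nonneg_left h.tsum_le hM

lemma CoefBd.pow (h : CoefBd L k B c) {m : ℕ} (hm : m + 1 ≤ k) :
    Summable (fun n : ℕ => ((n : ℝ) + 1) ^ m * |c n| * wt L n) ∧
      ∑' n : ℕ, ((n : ℝ) + 1) ^ m * |c n| * wt L n ≤ B := by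
  have := h.summable_of_le (p := fun n : ℕ => ((n : ℝ) + 1) ^ m * |c n|) (M := 1)
    zero_le_one (fun n => by positivity) fun n => ?_
  · simpa only [one_mul] using this
  · have h1 : (1 : ℝ) ≤ (n : ℝ) + 1 := by simp
    rw [one_mul, ← mul_assoc]
    have h2 : (1 : ℝ) ≤ ((n : ℝ) + 1) ^ (1 / 4 : ℝ) := Real.one_le_rpow h1 (by norm_num)
    have h3 : ((n : ℝ) + 1) ^ m ≤ ((n : ℝ) + 1) ^ (k - 1) := pow_le_pow_right₀ h1 (by omega)
    have h4 : (0 : ℝ) ≤ ((n : ℝ) + 1) ^ (k - 1) := by positivity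
    gcongr
    nlinarith

lemma CoefBd.norm_le (h : CoefBd L k B c) {l : ℕ} (hl : l + 1 ≤ k) {ζ : ℂ} (hζ : L < ζ.re) :
    ‖expS (dcoef c l) ζ‖ ≤ B := by
  have h1 := h.pow hl
  simp only [← abs_dcoef] at h1
  exact (norm_expS_le h1.1 hζ.le).trans h1.2

lemma CoefBd.shift_le (h : CoefBd L k B c) {l : ℕ} (hl : l + 2 ≤ k) {ζ : ℂ} (hζ : L < ζ.re)
    (θ : ℝ) : ‖expS (dcoef c l) (ζ + θ * Complex.I) - expS (dcoef c l) ζ‖ ≤ B * |θ| := by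
  have h1 := h.pow (m := l + 1) (by omega)
  have e : ∀ n : ℕ, ((n : ℝ) + 1) ^ (l + 1) * |c n| = ((n : ℝ) + 1) * |dcoef c l n| := by
    intro n; rw [abs_dcoef]; ring
  simp only [e] at h1
  have h2 := norm_expS_shift_le (h.decay.dcoef l) hζ hζ.le h1.1 θ
  have := mul_le_mul_of_nonneg_left h1.2 (abs_nonneg θ)
  linarith

lemma CoefBd.shift_le_rpow (h : CoefBd L k B c) {d : ℕ → ℝ} (hd : Decay L d)
    {C : ℝ} (hC : 0 ≤ C) (hdc : ∀ n : ℕ, |d n| ≤ C * (((n : ℝ) + 1) ^ (k - 1) * |c n|))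
    {ζ : ℂ} (hζ : L < ζ.re) (θ : ℝ) :
    ‖expS d (ζ + θ * Complex.I) - expS d ζ‖ ≤ 2 * (C * B) * |θ| ^ (1 / 4 : ℝ) := by
  have h1 := h.summable_of_le (p := fun n : ℕ => ((n : ℝ) + 1) ^ (1 / 4 : ℝ) * |d n|) (M := C)
    hC (fun n => by positivity) fun n => by
      have := hdc n
      rw [mul_left_comm C]
      gcongr
  have h2 := norm_expS_shift_le_rpow hd hζ hζ.le h1.1 θ
  have := mul_le_mul_of_nonneg_left h1.2 (by positivity : 0 ≤ 2 * |θ| ^ (1 / 4 : ℝ))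
  linarith

lemma CoefBd.taylor_le (h : CoefBd L k B c) (hk : 3 ≤ k) {ζ : ℂ} (hζ : L < ζ.re) (θ : ℝ) :
    ‖expS c (ζ + θ * Complex.I) - expS c ζ
        - expS (dcoef c 1) ζ * (Complex.exp (θ * Complex.I) - 1)‖ ≤ 4 * B * θ ^ 2 := by
  have h1 := h.pow (m := 2) (by omega)
  have h2 := norm_expS_taylor_le h.decay hζ hζ.le h1.1 θ
  have := mul_le_mul_of_nonneg_left h1.2 (by positivity : 0 ≤ 4 * θ ^ 2)
  linarith

end CoefBd

/-- Away from the boundary, all derivatives are bounded and Lipschitz in the vertical direction. -/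
lemma Decay.exists_bound {L : ℝ} {c : ℕ → ℝ} (hc : Decay L c) {ξ : ℝ} (hξ : L < ξ) (l : ℕ) :
    ∃ C : ℝ, 0 ≤ C ∧ ∀ ζ : ℂ, ξ ≤ ζ.re → ‖expS (VState.dcoef c l) ζ‖ ≤ C ∧
      ∀ θ : ℝ, ‖expS (VState.dcoef c l) (ζ + θ * Complex.I) - expS (VState.dcoef c l) ζ‖
        ≤ C * |θ| := by
  have h1 := hc.dcoef l ξ hξ
  have h2 := hc.dcoef (l + 1) ξ hξ
  have e : ∀ n : ℕ, |VState.dcoef c (l + 1) n| = ((n : ℝ) + 1) * |VState.dcoef c l n| := by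
    intro n; rw [abs_dcoef, abs_dcoef]; ring
  simp only [e] at h2
  refine ⟨max (∑' n, |VState.dcoef c l n| * wt ξ n)
    (∑' n : ℕ, ((n : ℝ) + 1) * |VState.dcoef c l n| * wt ξ n),
    le_max_of_le_left (tsum_nonneg fun n => mul_nonneg (abs_nonneg _) (wt_pos _ _).le),
    fun ζ hζ => ⟨(norm_expS_le h1 hζ).trans (le_max_left _ _), fun θ => ?_⟩⟩
  have := norm_expS_shift_le (hc.dcoef l) (hξ.trans_le hζ) hζ h2 θ
  rw [mul_comm _ |θ|]
  exact this.trans (mul_le_mul_of_nonneg_left (le_max_right _ _) (abs_nonneg _))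

/-! ### Laurent expansion of odd periodic functions -/

/-- The vertical strip `a < Re ζ < b`. -/
def strip (a b : ℝ) : Set ℂ := {ζ | a < ζ.re ∧ ζ.re < b}

lemma isOpen_strip (a b : ℝ) : IsOpen (strip a b) :=
  (isOpen_lt continuous_const Complex.continuous_re).inter
    (isOpen_lt Complex.continuous_re continuous_const)

lemma strip_subset {a b a' b' : ℝ} (ha : a' ≤ a) (hb : b ≤ b') : strip a b ⊆ strip a' b' :=
  fun _ h => ⟨ha.trans_lt h.1, h.2.trans_le hb⟩

lemma mem_strip_line {a b ξ : ℝ} (t : ℝ) : ((ξ : ℂ) + t * Complex.I) ∈ strip a b ↔ ξ ∈ Ioo a b := by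
  simp [strip]

lemma continuous_line {a b : ℝ} {H : ℂ → ℂ} (hH : ContinuousOn H (strip a b)) {ξ : ℝ}
    (hξ : ξ ∈ Ioo a b) : Continuous fun t : ℝ => H (ξ + t * Complex.I) :=
  hH.comp_continuous (by fun_prop) fun t => (mem_strip_line t).2 hξ

/-- The `n`-th Laurent coefficient, up to the factor `2π`, computed on the line `Re ζ = ξ`. -/
def laurentInt (H : ℂ → ℂ) (n : ℤ) (ξ : ℝ) : ℂ :=
  ∫ t in (0 : ℝ)..(2 * Real.pi), H (ξ + t * Complex.I) * Complex.exp (-n * (ξ + t * Complex.I))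

/-- The coefficients do not depend on the line: integrate over a rectangle of height `2π`, whose
horizontal sides cancel by periodicity. -/
lemma laurentInt_eq {a b : ℝ} {H : ℂ → ℂ} (hH : DifferentiableOn ℂ H (strip a b))
    (hper : Function.Periodic H (2 * Real.pi * Complex.I)) (n : ℤ) {ξ ξ' : ℝ} (hξ : ξ ∈ Ioo a b)
    (hξ' : ξ' ∈ Ioo a b) : laurentInt H n ξ = laurentInt H n ξ' := by
  set F : ℂ → ℂ := fun ζ => H ζ * Complex.exp (-n * ζ) with hF
  have hFper : ∀ x : ℝ, F (x + (2 * Real.pi : ℝ) * Complex.I) = F x := by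
    intro x
    simp only [hF]
    have h1 : H (x + (2 * Real.pi : ℝ) * Complex.I) = H x := by
      have := hper x; push_cast; exact this
    have h2 : Complex.exp (-n * (x + (2 * Real.pi : ℝ) * Complex.I)) = Complex.exp (-n * x) := by
      rw [Complex.exp_eq_exp_iff_exists_int]
      exact ⟨-n, by push_cast; ring⟩
    rw [h1, h2]
  have h := Complex.integral_boundary_rect_eq_zero_of_differentiableOn F ξ
    (ξ' + (2 * Real.pi : ℝ) * Complex.I) ?_
  · simp only [Complex.add_re, Complex.ofReal_re, Complex.mul_re, Complex.I_re, mul_zero,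
      Complex.ofReal_im, Complex.I_im, mul_one, sub_self, add_zero, Complex.add_im, Complex.mul_im,
      zero_add, zero_mul, Complex.ofReal_zero] at h
    simp only [hFper, sub_self, zero_add, ← smul_sub] at h
    have h2 := (smul_eq_zero.1 h).resolve_left Complex.I_ne_zero
    exact (sub_eq_zero.1 h2).symm
  · intro ζ hζ
    have : ζ ∈ strip a b := by
      have h1 : ζ.re ∈ uIcc ξ ξ' := by simpa using hζ.1
      exact ordConnected_Ioo.uIcc_subset hξ hξ' h1
    exact ((hH.differentiableAt ((isOpen_strip a b).mem_nhds this)).mul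
      (by fun_prop)).differentiableWithinAt

lemma norm_exp_int_mul (n : ℤ) (ξ t : ℝ) :
    ‖Complex.exp (-n * (ξ + t * Complex.I))‖ = Real.exp (-n * ξ) := by
  rw [Complex.norm_exp]; simp

lemma exists_norm_laurentInt_le {a b : ℝ} {H : ℂ → ℂ} (hH : ContinuousOn H (strip a b)) {ξ : ℝ}
    (hξ : ξ ∈ Ioo a b) : ∃ M : ℝ, ∀ n : ℤ, ‖laurentInt H n ξ‖ ≤ M * Real.exp (-n * ξ) := by
  obtain ⟨M, hM⟩ := (isCompact_Icc (a := (0 : ℝ)) (b := 2 * Real.pi)).exists_bound_of_continuousOn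
    (continuous_line hH hξ).continuousOn
  have hpi : (0 : ℝ) ≤ 2 * Real.pi := by positivity
  refine ⟨M * (2 * Real.pi), fun n => ?_⟩
  have := intervalIntegral.norm_integral_le_of_norm_le_const (a := 0) (b := 2 * Real.pi)
    (C := M * Real.exp (-n * ξ))
    (f := fun t : ℝ => H (ξ + t * Complex.I) * Complex.exp (-n * (ξ + t * Complex.I))) ?_
  · rw [sub_zero, abs_of_nonneg hpi] at this
    refine this.trans (le_of_eq (by ring))
  · intro t ht
    rw [uIoc_of_le hpi] at ht
    rw [norm_mul, norm_exp_int_mul]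
    gcongr
    exact hM t ⟨ht.1.le, ht.2⟩

/-- The Laurent series, as the Fourier series on the vertical line through `ζ`. Its coefficients are
summable because they can be computed on lines slightly to the right or to the left. -/
lemma hasSum_laurent {a b : ℝ} {H : ℂ → ℂ} (hH : DifferentiableOn ℂ H (strip a b))
    (hper : Function.Periodic H (2 * Real.pi * Complex.I)) {ζ : ℂ} (hζ : ζ ∈ strip a b) {ξ₀ : ℝ}
    (hξ₀ : ξ₀ ∈ Ioo a b) :
    HasSum (fun n : ℤ => (2 * Real.pi : ℂ)⁻¹ * laurentInt H n ξ₀ * Complex.exp (n * ζ)) (H ζ) := by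
  have hpi : (0 : ℝ) < 2 * Real.pi := by positivity
  have hpi0 : (Real.pi : ℂ) ≠ 0 := Complex.ofReal_ne_zero.2 Real.pi_ne_zero
  have : Fact (0 < 2 * Real.pi) := ⟨hpi⟩
  set ξ := ζ.re with hξ
  have hζ' : ζ = ξ + ζ.im * Complex.I := (Complex.re_add_im ζ).symm
  have hξm : ξ ∈ Ioo a b := hζ
  have hcont := continuous_line hH.continuousOn hξm
  have hp : Function.Periodic (fun t : ℝ => H (ξ + t * Complex.I)) (2 * Real.pi) := by
    intro t
    have := hper (ξ + t * Complex.I)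
    simp only
    rw [← this]
    congr 1
    push_cast
    ring
  set f : C(AddCircle (2 * Real.pi), ℂ) :=
    ⟨hp.lift, continuous_coinduced_dom.2 hcont⟩ with hf
  have hfv : ∀ t : ℝ, f (t : AddCircle (2 * Real.pi)) = H (ξ + t * Complex.I) :=
    fun t => hp.lift_coe t
  have hcoef : ∀ n : ℤ, fourierCoeff f n
      = (2 * Real.pi : ℂ)⁻¹ * laurentInt H n ξ₀ * Complex.exp (n * ξ) := by
    intro n
    rw [laurentInt_eq hH hper n hξ₀ hξm, fourierCoeff_eq_intervalIntegral _ _ 0, zero_add,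
      laurentInt, Complex.real_smul, mul_assoc, ← intervalIntegral.integral_mul_const]
    congr 1
    · push_cast; simp
    · congr 1
      ext t
      rw [hfv, fourier_coe_apply, smul_eq_mul, mul_comm, mul_assoc (H _), ← Complex.exp_add]
      congr 2
      push_cast
      field_simp
      ring
  obtain ⟨η, hη0, hη1, hη2⟩ : ∃ η : ℝ, 0 < η ∧ ξ - η ∈ Ioo a b ∧ ξ + η ∈ Ioo a b := by
    refine ⟨min (ξ - a) (b - ξ) / 2, ?_, ?_, ?_⟩
    · have : 0 < min (ξ - a) (b - ξ) := lt_min (by linarith [hξm.1]) (by linarith [hξm.2])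
      linarith
    all_goals
      have h1 : 0 < min (ξ - a) (b - ξ) := lt_min (by linarith [hξm.1]) (by linarith [hξm.2])
      have h2 := min_le_left (ξ - a) (b - ξ)
      have h3 := min_le_right (ξ - a) (b - ξ)
      constructor <;> linarith
  obtain ⟨M₁, hM₁⟩ := exists_norm_laurentInt_le hH.continuousOn hη1
  obtain ⟨M₂, hM₂⟩ := exists_norm_laurentInt_le hH.continuousOn hη2
  have hgeo : Summable fun n : ℕ => Real.exp (-η) ^ n :=
    summable_geometric_of_lt_one (Real.exp_pos _).le (by rw [← Real.exp_zero]; exact Real.exp_lt_exp.2 (by linarith))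
  have h1 : ‖(2 * Real.pi : ℂ)⁻¹‖ ≤ 1 := by
    rw [norm_inv]
    refine inv_le_one_of_one_le₀ ?_
    simp only [norm_mul, Complex.norm_ofNat, Complex.norm_real, Real.norm_eq_abs,
      abs_of_pos Real.pi_pos]
    linarith [Real.pi_gt_three]
  have hsum : Summable (fourierCoeff f) := by
    refine Summable.of_nat_of_neg ?_ ?_
    · refine Summable.of_norm_bounded (g := fun n : ℕ => M₂ * Real.exp (-η) ^ n)
        (hgeo.mul_left _) fun n => ?_
      rw [hcoef, norm_mul, norm_mul, laurentInt_eq hH hper n hξ₀ hη2]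
      have h2 : ‖Complex.exp ((n : ℤ) * ξ)‖ = Real.exp (n * ξ) := by
        rw [Complex.norm_exp]; simp
      calc _ ≤ 1 * (M₂ * Real.exp (-(n : ℤ) * (ξ + η))) * Real.exp (n * ξ) := by
            rw [h2]; gcongr; exact hM₂ n
        _ = M₂ * (Real.exp (-(n : ℤ) * (ξ + η)) * Real.exp (n * ξ)) := by ring
        _ = _ := by
          rw [← Real.exp_add, ← Real.exp_nat_mul]
          congr 2
          push_cast
          ring
    · refine Summable.of_norm_bounded (g := fun n : ℕ => M₁ * Real.exp (-η) ^ n)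
        (hgeo.mul_left _) fun n => ?_
      rw [hcoef, norm_mul, norm_mul, laurentInt_eq hH hper _ hξ₀ hη1]
      have h2 : ‖Complex.exp ((-(n : ℤ) : ℤ) * ξ)‖ = Real.exp (-n * ξ) := by
        rw [Complex.norm_exp]; simp
      calc _ ≤ 1 * (M₁ * Real.exp (-(-(n : ℤ) : ℤ) * (ξ - η))) * Real.exp (-n * ξ) := by
            rw [h2]; gcongr; exact hM₁ _
        _ = M₁ * (Real.exp (-(-(n : ℤ) : ℤ) * (ξ - η)) * Real.exp (-n * ξ)) := by ring
        _ = _ := by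
          rw [← Real.exp_add, ← Real.exp_nat_mul]
          congr 2
          push_cast
          ring
  have key := has_pointwise_sum_fourier_series_of_summable hsum (ζ.im : AddCircle (2 * Real.pi))
  rw [hfv, ← hζ'] at key
  refine key.congr_fun fun n => ?_
  rw [hcoef, fourier_coe_apply, smul_eq_mul, mul_assoc _ (Complex.exp _), ← Complex.exp_add]
  congr 2
  nth_rw 1 [hζ']
  push_cast
  field_simp

/-- An odd `2πi`-periodic holomorphic function on a symmetric strip that is real on the imaginary
axis is a sine series with coefficients of the form required in `spaceAhat`. -/
lemma exists_hasSum_sine {L : ℝ} (hL : L < 0) {H : ℂ → ℂ}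
    (hH : DifferentiableOn ℂ H (strip L (-L)))
    (hper : Function.Periodic H (2 * Real.pi * Complex.I)) (hodd : ∀ ζ, H (-ζ) = -H ζ)
    (hreal : ∀ t : ℝ, (starRingEnd ℂ) (H (t * Complex.I)) = H (t * Complex.I)) :
    ∃ c : ℕ → ℝ, ∀ ζ ∈ strip L (-L), HasSum (fun n : ℕ => Complex.I *
      ((c n : ℂ) * (Complex.exp ζ ^ (n + 1) - (Complex.exp ζ ^ (n + 1))⁻¹))) (H ζ) := by
  have h0 : (0 : ℝ) ∈ Ioo L (-L) := ⟨hL, by linarith⟩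
  have hpi0 : (Real.pi : ℂ) ≠ 0 := Complex.ofReal_ne_zero.2 Real.pi_ne_zero
  set q : ℤ → ℂ := fun n => laurentInt H n 0 with hq
  have hperG : ∀ n : ℤ, Function.Periodic
      (fun t : ℝ => H (t * Complex.I) * Complex.exp (-n * (t * Complex.I))) (2 * Real.pi) := by
    intro n t
    have h1 : H ((t + 2 * Real.pi : ℝ) * Complex.I) = H (t * Complex.I) := by
      rw [← hper (t * Complex.I)]; congr 1; push_cast; ring
    have h2 : Complex.exp (-n * ((t + 2 * Real.pi : ℝ) * Complex.I))
        = Complex.exp (-n * (t * Complex.I)) := by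
      rw [Complex.exp_eq_exp_iff_exists_int]
      exact ⟨-n, by push_cast; ring⟩
    simp only [h1, h2]
  have hneg : ∀ n, q (-n) = -q n := by
    intro n
    have e1 : q n = ∫ t in (0 : ℝ)..(2 * Real.pi),
        H (t * Complex.I) * Complex.exp (-n * (t * Complex.I)) := by
      simp [hq, laurentInt]
    have e2 : q (-n) = -∫ t in (0 : ℝ)..(2 * Real.pi),
        H ((-t : ℝ) * Complex.I) * Complex.exp (-n * ((-t : ℝ) * Complex.I)) := by
      rw [← intervalIntegral.integral_neg]
      simp only [hq, laurentInt]
      congr 1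
      ext t
      have := hodd (t * Complex.I)
      push_cast
      rw [neg_mul (t : ℂ), this, zero_add, neg_mul (H _), neg_neg, neg_neg, neg_mul_neg]
    rw [e2, e1, neg_inj]
    have h1 := intervalIntegral.integral_comp_neg (a := 0) (b := 2 * Real.pi)
      (fun t : ℝ => H (t * Complex.I) * Complex.exp (-n * (t * Complex.I)))
    rw [h1]
    have h2 := (hperG n).intervalIntegral_add_eq (-(2 * Real.pi)) 0
    simpa using h2
  have hconj : ∀ n, (starRingEnd ℂ) (q n) = q (-n) := by
    intro n
    simp only [hq, laurentInt]
    rw [← intervalIntegral.intervalIntegral_conj]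
    congr 1
    ext t
    have := hreal t
    rw [map_mul, Complex.ofReal_zero, zero_add, this, ← Complex.exp_conj]
    congr 2
    simp
  have him : ∀ n, q n = Complex.I * (q n).im := by
    intro n
    have h1 : (starRingEnd ℂ) (q n) = -q n := (hconj n).trans (hneg n)
    have h2 : (q n).re = 0 := by
      have := congrArg Complex.re h1
      simp only [Complex.conj_re, Complex.neg_re] at this
      linarith
    apply Complex.ext <;> simp [h2]
  have hq0 : q 0 = 0 := by
    have := hneg 0
    rw [neg_zero] at this
    exact self_eq_neg.1 this
  refine ⟨fun n => (2 * Real.pi)⁻¹ * (q (n + 1)).im, fun ζ hζ => ?_⟩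
  have h1 := (hasSum_laurent hH hper hζ h0).nat_add_neg
  have h2 := (hasSum_nat_add_iff' 1).2 h1
  have hz : laurentInt H 0 0 = 0 := hq0
  simp only [Finset.sum_range_one, Nat.cast_zero, neg_zero, hz, mul_zero, zero_mul, add_zero,
    sub_zero] at h2
  refine h2.congr_fun fun n => ?_
  have h3 := hneg (n + 1)
  have h4 := him (n + 1)
  simp only [hq] at h3 h4
  push_cast
  rw [h3]
  have e1 : Complex.exp ζ ^ (n + 1) = Complex.exp (((n : ℂ) + 1) * ζ) := by
    rw [← Complex.exp_nat_mul]; push_cast; rfl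
  have e2 : Complex.exp (-((n : ℂ) + 1) * ζ) = (Complex.exp (((n : ℂ) + 1) * ζ))⁻¹ := by
    rw [← Complex.exp_neg]; congr 1; ring
  rw [e1, e2, h4]
  simp only [hq]
  ring

/-! ### Functions on the annulus from functions on the strip -/

lemma exp_mem_annulus {ε : ℝ} (hε : 0 < ε) {ζ : ℂ} :
    Complex.exp ζ ∈ annulus ε ↔ ζ ∈ strip (Real.log ε) (-Real.log ε) := by
  rw [annulus, strip, mem_ofPred_eq, mem_ofPred_eq, ← log_exp_mem hε, Complex.norm_exp, one_div,
    ← Real.log_inv, ← Real.lt_log_iff_exp_lt (inv_pos.2 hε)]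

lemma ne_zero_of_mem_annulus {ε : ℝ} (hε : 0 < ε) {z : ℂ} (hz : z ∈ annulus ε) : z ≠ 0 :=
  norm_pos_iff.1 (hε.trans hz.1)

lemma isOpen_annulus (ε : ℝ) : IsOpen (annulus ε) :=
  (isOpen_lt continuous_const continuous_norm).inter (isOpen_lt continuous_norm continuous_const)

lemma periodic_comp_log {H : ℂ → ℂ} (hper : Function.Periodic H (2 * Real.pi * Complex.I)) (ζ : ℂ) :
    H (Complex.log (Complex.exp ζ)) = H ζ := by
  have h1 : Complex.exp (Complex.log (Complex.exp ζ)) = Complex.exp ζ :=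
    Complex.exp_log (Complex.exp_ne_zero ζ)
  obtain ⟨n, hn⟩ := Complex.exp_eq_exp_iff_exists_int.1 h1
  rw [hn]
  exact hper.int_mul n ζ

lemma differentiableOn_comp_log {ε : ℝ} (hε : 0 < ε) {H : ℂ → ℂ}
    (hH : DifferentiableOn ℂ H (strip (Real.log ε) (-Real.log ε)))
    (hper : Function.Periodic H (2 * Real.pi * Complex.I)) :
    DifferentiableOn ℂ (fun z => H (Complex.log z)) (annulus ε) := by
  intro z hz
  have hz0 := ne_zero_of_mem_annulus hε hz
  -- near `z`, use the branch `log z + log (w / z)` of the logarithm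
  have hb : ∀ᶠ w in 𝓝 z, H (Complex.log w) = H (Complex.log z + Complex.log (w / z)) := by
    filter_upwards [isOpen_ne.mem_nhds hz0] with w hw
    rw [← periodic_comp_log hper (Complex.log z + Complex.log (w / z)), Complex.exp_add,
      Complex.exp_log hz0, Complex.exp_log (div_ne_zero hw hz0), mul_div_cancel₀ _ hz0]
  have hlog : DifferentiableAt ℂ (fun w => Complex.log z + Complex.log (w / z)) z := by
    refine DifferentiableAt.const_add _ (DifferentiableAt.clog (by fun_prop) ?_)
    rw [div_self hz0]; exact Complex.one_mem_slitPlane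
  have hmem : Complex.log z ∈ strip (Real.log ε) (-Real.log ε) := by
    rw [← exp_mem_annulus hε, Complex.exp_log hz0]; exact hz
  have h2 : DifferentiableAt ℂ H (Complex.log z + Complex.log (z / z)) := by
    rw [div_self hz0, Complex.log_one, add_zero]
    exact hH.differentiableAt ((isOpen_strip _ _).mem_nhds hmem)
  exact ((h2.comp z hlog).congr_of_eventuallyEq hb).differentiableWithinAt

/-- Holomorphic functions on the annulus that agree on the unit circle are equal. -/
lemma eqOn_annulus_of_eq_circle {ε : ℝ} (hε : 0 < ε) (hε1 : ε < 1) {h h' : ℂ → ℂ}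
    (hh : DifferentiableOn ℂ h (annulus ε)) (hh' : DifferentiableOn ℂ h' (annulus ε))
    (heq : ∀ ω : ℂ, ‖ω‖ = 1 → h ω = h' ω) : EqOn h h' (annulus ε) := by
  have hL := Real.log_neg hε hε1
  have hmaps : MapsTo Complex.exp (strip (Real.log ε) (-Real.log ε)) (annulus ε) :=
    fun ζ hζ => (exp_mem_annulus hε).2 hζ
  have ha : ∀ {g : ℂ → ℂ}, DifferentiableOn ℂ g (annulus ε) →
      AnalyticOnNhd ℂ (g ∘ Complex.exp) (strip (Real.log ε) (-Real.log ε)) := fun hg =>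
    (hg.comp Complex.differentiable_exp.differentiableOn hmaps).analyticOnNhd (isOpen_strip _ _)
  have hconn : IsPreconnected (strip (Real.log ε) (-Real.log ε)) :=
    ((convex_halfSpace_re_gt _).inter (convex_halfSpace_re_lt _)).isPreconnected
  have h0 : (0 : ℂ) ∈ strip (Real.log ε) (-Real.log ε) := by simp [strip, hL]
  have hfreq : ∃ᶠ ζ in 𝓝[≠] (0 : ℂ), (h ∘ Complex.exp) ζ = (h' ∘ Complex.exp) ζ := by
    have hlim : Tendsto (fun n : ℕ => ((1 / ((n : ℝ) + 1) : ℝ) : ℂ) * Complex.I) atTop (𝓝[≠] 0) := by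
      rw [tendsto_nhdsWithin_iff]
      refine ⟨?_, Eventually.of_forall fun n => ?_⟩
      · have h1 : Tendsto (fun n : ℕ => ((1 / ((n : ℝ) + 1) : ℝ) : ℂ)) atTop (𝓝 0) := by
          exact_mod_cast (Complex.continuous_ofReal.tendsto 0).comp
            tendsto_one_div_add_atTop_nhds_zero_nat
        simpa using h1.mul_const Complex.I
      · have : (0 : ℝ) < 1 / ((n : ℝ) + 1) := by positivity
        exact mul_ne_zero (Complex.ofReal_ne_zero.2 this.ne') Complex.I_ne_zero
    refine hlim.frequently (Eventually.of_forall fun n => ?_).frequently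
    exact heq _ (Complex.norm_exp_ofReal_mul_I _)
  have := (ha hh).eqOn_of_preconnected_of_frequently_eq (ha hh') hconn h0 hfreq
  intro z hz
  have hz0 := ne_zero_of_mem_annulus hε hz
  have h1 := this (x := Complex.log z) (by rw [← exp_mem_annulus hε, Complex.exp_log hz0]; exact hz)
  simpa [Complex.exp_log hz0] using h1

/-! ### Uniform `L²` bounds on vertical lines -/

/-- Uniform `L²` bounds on the lines `Re ζ = ξ`, `L < ξ < 0`, as the top condition of a tower with a
single member. -/
def UL2 (L : ℝ) (a : Unit → ℂ → ℂ) : Prop :=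
  ∃ C : NNReal, ∀ ξ ∈ Ioo L 0,
    AEStronglyMeasurable (fun t : ℝ => a () (ξ + t * Complex.I))
      (volume.restrict (Ioc 0 (2 * Real.pi))) ∧ lineNorm (a ()) ξ ≤ C

lemma lineNorm_le_of_bdd {a : ℂ → ℂ} {ξ C : ℝ} (h : ∀ t : ℝ, ‖a (ξ + t * Complex.I)‖ ≤ C) :
    lineNorm a ξ ≤ ENNReal.ofReal (2 * Real.pi) ^ (1 / 2 : ℝ) * ENNReal.ofReal C := by
  refine (eLpNorm_le_of_ae_bound (Eventually.of_forall h)).trans ?_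
  simp

lemma isTop_UL2 (L : ℝ) : IsTop (strip L 0) (univ : Set Unit) (UL2 L) where
  of_bdd a ha hd := by
    obtain ⟨C, hC⟩ := ha
    refine ⟨(ENNReal.ofReal (2 * Real.pi) ^ (1 / 2 : ℝ) * ENNReal.ofReal C).toNNReal,
      fun ξ hξ => ⟨(continuous_line (hd () trivial).continuousOn hξ).aestronglyMeasurable, ?_⟩⟩
    rw [ENNReal.coe_toNNReal (ENNReal.mul_ne_top
      (ENNReal.rpow_ne_top_of_nonneg (by norm_num) ENNReal.ofReal_ne_top) ENNReal.ofReal_ne_top)]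
    exact lineNorm_le_of_bdd fun t => hC () trivial _ ((mem_strip_line t).2 hξ)
  add a b ha hb := by
    obtain ⟨C, hC⟩ := ha
    obtain ⟨D, hD⟩ := hb
    refine ⟨C + D, fun ξ hξ => ⟨(hC ξ hξ).1.add (hD ξ hξ).1, ?_⟩⟩
    refine (eLpNorm_add_le (hC ξ hξ).1 (hD ξ hξ).1 (by norm_num)).trans ?_
    push_cast
    exact add_le_add (hC ξ hξ).2 (hD ξ hξ).2
  mul a b ha hb hd := by
    obtain ⟨C, hC⟩ := ha
    obtain ⟨D, hD⟩ := hb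
    refine ⟨D.toNNReal * C, fun ξ hξ => ⟨(hC ξ hξ).1.mul
      (continuous_line (hd () trivial).continuousOn hξ).aestronglyMeasurable, ?_⟩⟩
    refine (eLpNorm_le_mul_eLpNorm_of_ae_le_mul (g := fun t : ℝ => a () (ξ + t * Complex.I))
      (c := D) (Eventually.of_forall fun t => ?_) 2).trans ?_
    · rw [norm_mul, mul_comm]
      gcongr
      exact hD () trivial _ ((mem_strip_line t).2 hξ)
    · push_cast
      exact mul_le_mul_right (hC ξ hξ).2 _
  congr a b h ha := by
    obtain ⟨C, hC⟩ := ha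
    refine ⟨C, fun ξ hξ => ?_⟩
    have e : (fun t : ℝ => b () (ξ + t * Complex.I)) = fun t : ℝ => a () (ξ + t * Complex.I) :=
      funext fun t => (h () trivial _ ((mem_strip_line t).2 hξ)).symm
    simpa only [lineNorm, e] using hC ξ hξ

/-- The single function `a` lies in the tower of height `n` over `UL2 L`. -/
def RegL2 (L : ℝ) (n : ℕ) (a : ℂ → ℂ) : Prop :=
  Tower (strip L 0) (univ : Set Unit) (UL2 L) n (fun _ => a)

/-- Regularity in the coordinate `ζ` gives regularity in `z = e^ζ`. -/
lemma RegL2.eulerPow {ε : ℝ} (hε : 0 < ε) (hε1 : ε < 1) {n : ℕ} {h : ℂ → ℂ}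
    (hh : DifferentiableOn ℂ h (annulus ε))
    (hreg : RegL2 (Real.log ε) n fun ζ => h (Complex.exp ζ)) {m : ℕ} (hm : m ≤ n) :
    RegL2 (Real.log ε) (n - m) (eulerPow h m) := by
  have hL := Real.log_neg hε hε1
  have hQ := isTop_UL2 (Real.log ε)
  induction m with
  | zero =>
    refine Tower.congr (isOpen_strip _ _) hQ (fun _ _ z _ => ?_) hreg
    simp [VState.eulerPow]
  | succ m ih =>
    have h1 := ih (by omega)
    have e : n - m = (n - (m + 1)) + 1 := by omega
    rw [e] at h1
    have h0 := Tower.pred hQ h1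
    obtain ⟨-, a', h2, h3⟩ := h1
    refine Tower.congr (isOpen_strip _ _) hQ (fun i hi z hz => ?_)
      (h3.add hQ (h0.const_mul hQ (fun _ => -(m : ℂ)) ⟨_, fun _ _ => le_rfl⟩))
    have h4 := hasDerivAt_eulerPow (isOpen_annulus ε) hh m
      ((exp_mem_annulus hε).2 (strip_subset le_rfl (by linarith) hz))
    rw [(h2 i hi z hz).unique h4]
    ring

lemma boundaryNorm_lt_top_of_regL2 {ε : ℝ} (hε : 0 < ε) {h : ℂ → ℂ} {m : ℕ}
    (hreg : RegL2 (Real.log ε) 0 (eulerPow h m)) : boundaryNorm ε (iteratedDeriv m h) < ⊤ := by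
  obtain ⟨C, hC⟩ := hreg
  refine lt_of_le_of_lt (iSup₂_le fun ρ hρ => ?_)
    (ENNReal.mul_lt_top (ENNReal.ofReal_lt_top (r := (ε⁻¹) ^ m)) (ENNReal.coe_lt_top (r := C)))
  have hρ0 : 0 < ρ := hε.trans hρ.1
  have h1 := circleNorm_le_lineNorm_eulerPow h m (Real.log ρ)
  rw [Real.exp_log hρ0, Real.exp_neg, Real.exp_log hρ0] at h1
  refine h1.trans (mul_le_mul' (ENNReal.ofReal_le_ofReal ?_)
    (hC (Real.log ρ) ⟨Real.log_lt_log hε hρ.1, Real.log_neg hρ0 hρ.2⟩).2)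
  have := inv_anti₀ hε hρ.1.le
  gcongr

/-- Membership in `spaceY` from a function in the logarithmic coordinate. -/
lemma comp_log_mem_spaceY {ε : ℝ} (hε : 0 < ε) (hε1 : ε < 1) {l : ℕ} {H : ℂ → ℂ}
    (hH : DifferentiableOn ℂ H (strip (Real.log ε) (-Real.log ε)))
    (hper : Function.Periodic H (2 * Real.pi * Complex.I)) (hodd : ∀ ζ, H (-ζ) = -H ζ)
    (hreal : ∀ t : ℝ, (starRingEnd ℂ) (H (t * Complex.I)) = H (t * Complex.I))
    (hreg : RegL2 (Real.log ε) l H) : (fun z => H (Complex.log z)) ∈ spaceY ε l := by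
  have hd := differentiableOn_comp_log hε hH hper
  obtain ⟨c, hc⟩ := exists_hasSum_sine (Real.log_neg hε hε1) hH hper hodd hreal
  have hreg' : RegL2 (Real.log ε) l fun ζ => (fun z => H (Complex.log z)) (Complex.exp ζ) := by
    simpa only [periodic_comp_log hper] using hreg
  refine ⟨⟨hd, c, fun z hz => ?_⟩, ?_, ?_⟩
  · have hz0 := ne_zero_of_mem_annulus hε hz
    have := hc (Complex.log z) (by rw [← exp_mem_annulus hε, Complex.exp_log hz0]; exact hz)
    rwa [Complex.exp_log hz0] at this
  · have h0 := RegL2.eulerPow hε hε1 hd hreg' (m := 0) (Nat.zero_le _)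
    have := boundaryNorm_lt_top_of_regL2 hε (h0.mono (isTop_UL2 _) (Nat.zero_le _))
    rwa [iteratedDeriv_zero] at this
  · have h0 := RegL2.eulerPow hε hε1 hd hreg' (m := l) le_rfl
    rw [Nat.sub_self] at h0
    exact boundaryNorm_lt_top_of_regL2 hε h0

/-! ### Families depending on the angle -/

/-- The angles in `[-π, π]` off the singularity `θ = 0`. -/
def angles : Set ℝ := {θ | -Real.pi ≤ θ ∧ θ ≤ Real.pi ∧ θ ≠ 0}

/-- The measure `dθ` on `(-π, π]`. -/
def angleMeasure : Measure ℝ := volume.restrict (Ioc (-Real.pi) Real.pi)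

/-- An integrable weight which is at least `1`. -/
def angleWt (θ : ℝ) : ℝ := 1 + |θ| ^ (-(3 / 4) : ℝ)

/-- Domination by the integrable weight, uniformly on `U`. -/
def QWt (U : Set ℂ) (a : ℝ → ℂ → ℂ) : Prop :=
  ∃ C : ℝ, ∀ θ ∈ angles, ∀ z ∈ U, ‖a θ z‖ ≤ C * angleWt θ

instance : IsFiniteMeasure angleMeasure := by unfold angleMeasure; infer_instance

lemma neg_mem_angles {θ : ℝ} (h : θ ∈ angles) : -θ ∈ angles :=
  ⟨by linarith [h.2.1], by linarith [h.1], neg_ne_zero.2 h.2.2⟩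

lemma abs_le_pi_of_mem_angles {θ : ℝ} (h : θ ∈ angles) : |θ| ≤ Real.pi :=
  abs_le.2 ⟨h.1, h.2.1⟩

lemma ae_mem_angles : ∀ᵐ θ ∂angleMeasure, θ ∈ angles := by
  unfold angleMeasure
  have h1 : ∀ᵐ θ : ℝ ∂volume.restrict (Ioc (-Real.pi) Real.pi), θ ∈ Ioc (-Real.pi) Real.pi :=
    ae_restrict_mem measurableSet_Ioc
  have h2 : ∀ᵐ θ : ℝ ∂volume.restrict (Ioc (-Real.pi) Real.pi), θ ≠ 0 :=
    Measure.ae_ne _ 0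
  filter_upwards [h1, h2] with θ a1 a2 using ⟨a1.1.le, a1.2, a2⟩

lemma one_le_angleWt (θ : ℝ) : 1 ≤ angleWt θ := by
  unfold angleWt; linarith [Real.rpow_nonneg (abs_nonneg θ) (-(3 / 4) : ℝ)]

lemma integrable_angleWt : Integrable angleWt angleMeasure := by
  have h0 : IntervalIntegrable (fun x : ℝ => |x| ^ (-(3 / 4) : ℝ)) volume 0 Real.pi := by
    refine (intervalIntegral.intervalIntegrable_rpow' (by norm_num : (-1 : ℝ) < -(3 / 4))).congr ?_
    intro x hx
    rw [uIoc_of_le Real.pi_pos.le] at hx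
    simp only [abs_of_pos hx.1]
  have h1 : IntervalIntegrable (fun x : ℝ => |x| ^ (-(3 / 4) : ℝ)) volume (-Real.pi) 0 := by
    have := (IntervalIntegrable.iff_comp_neg (a := 0) (b := Real.pi)).1 h0
    simpa using this.symm
  have h2 := (h1.trans h0).1
  exact (integrable_const (1 : ℝ)).add h2

lemma isTop_QWt (U : Set ℂ) : IsTop U angles (QWt U) where
  of_bdd a ha _ := by
    obtain ⟨C, hC⟩ := ha
    refine ⟨|C|, fun θ hθ z hz => ?_⟩
    calc ‖a θ z‖ ≤ |C| * 1 := by rw [mul_one]; exact (hC θ hθ z hz).trans (le_abs_self C)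
      _ ≤ _ := by gcongr; exact one_le_angleWt θ
  add a b ha hb := by
    obtain ⟨C, hC⟩ := ha
    obtain ⟨D, hD⟩ := hb
    refine ⟨C + D, fun θ hθ z hz => ?_⟩
    rw [add_mul]
    exact (norm_add_le _ _).trans (add_le_add (hC θ hθ z hz) (hD θ hθ z hz))
  mul a b ha hb _ := by
    obtain ⟨C, hC⟩ := ha
    obtain ⟨D, hD⟩ := hb
    refine ⟨C * D, fun θ hθ z hz => ?_⟩
    rw [norm_mul, mul_right_comm]
    exact mul_le_mul (hC θ hθ z hz) (hD θ hθ z hz) (norm_nonneg _)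
      ((norm_nonneg _).trans (hC θ hθ z hz))
  congr a b h ha := by
    obtain ⟨C, hC⟩ := ha
    exact ⟨C, fun θ hθ z hz => h θ hθ z hz ▸ hC θ hθ z hz⟩

/-- A member of `Tower _ _ (QWt _) 0` is integrable in the angle, with a uniform bound. -/
lemma QWt.norm_integral_le {U : Set ℂ} {a : ℝ → ℂ → ℂ} (ha : QWt U a) :
    ∃ C : ℝ, ∀ z ∈ U, ‖∫ θ, a θ z ∂angleMeasure‖ ≤ C := by
  obtain ⟨C, hC⟩ := ha
  refine ⟨∫ θ, C * angleWt θ ∂angleMeasure, fun z hz => ?_⟩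
  refine norm_integral_le_of_norm_le (integrable_angleWt.const_mul C) ?_
  filter_upwards [ae_mem_angles] with θ hθ using hC θ hθ z hz

lemma QWt.integrable {U : Set ℂ} {a : ℝ → ℂ → ℂ} (ha : QWt U a) {z : ℂ} (hz : z ∈ U)
    (hm : AEStronglyMeasurable (fun θ => a θ z) angleMeasure) :
    Integrable (fun θ => a θ z) angleMeasure := by
  obtain ⟨C, hC⟩ := ha
  refine (integrable_angleWt.const_mul C).mono' hm ?_
  filter_upwards [ae_mem_angles] with θ hθ using hC θ hθ z hz

lemma UL2.mono {L : ℝ} {D T : ℂ → ℂ} (hD : UL2 L fun _ => D) (hT : ContinuousOn T (strip L 0))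
    (h : ∀ ζ ∈ strip L 0, ‖T ζ‖ ≤ ‖D ζ‖) : UL2 L fun _ => T := by
  obtain ⟨C, hC⟩ := hD
  exact ⟨C, fun ξ hξ => ⟨(continuous_line hT hξ).aestronglyMeasurable,
    (eLpNorm_mono fun t => h _ ((mem_strip_line t).2 hξ)).trans (hC ξ hξ).2⟩⟩

lemma UL2.norm_add_const {L : ℝ} {D : ℂ → ℂ} (hD : UL2 L fun _ => D) (C : ℝ) :
    UL2 L fun _ ζ => (‖D ζ‖ : ℂ) + (C : ℂ) := by
  have hQ := isTop_UL2 L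
  have h1 : UL2 L fun _ ζ => (‖D ζ‖ : ℂ) := by
    obtain ⟨M, hM⟩ := hD
    refine ⟨M, fun ξ hξ => ⟨?_, ?_⟩⟩
    · exact Complex.continuous_ofReal.comp_aestronglyMeasurable (hM ξ hξ).1.norm
    · exact (eLpNorm_mono fun t => by simp).trans (hM ξ hξ).2
  exact hQ.add _ _ h1 (hQ.of_bdd (fun _ _ => (C : ℂ)) ⟨‖(C : ℂ)‖, fun _ _ _ _ => le_rfl⟩
    fun _ _ => differentiableOn_const _)

/-- Regularity of an integral `∫ (X W + e) dθ`. All derivatives of `X` of order less than `n`, and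
all terms in which a derivative falls on `W`, are dominated by an integrable weight; only
`∫ X⁽ⁿ⁾ W dθ` has to be estimated by other means, and this is what `hD` provides. -/
lemma regL2_integral {L : ℝ} {n N : ℕ} (hnN : n ≤ N + 1) (hN : 1 ≤ N) {X : ℕ → ℝ → ℂ → ℂ}
    {W e : ℝ → ℂ → ℂ} (hW : Tower (strip L 0) angles (QWt (strip L 0)) (N + 1) W)
    (hX : ∀ l < n, ∀ θ ∈ angles, ∀ z ∈ strip L 0, HasDerivAt (X l θ) (X (l + 1) θ z) z)
    (hXt : ∀ l < n, Tower (strip L 0) angles (QWt (strip L 0)) (n - 1 - l) (X l))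
    (he : Tower (strip L 0) angles (QWt (strip L 0)) n e)
    (hm : ∀ z ∈ strip L 0,
      AEStronglyMeasurable (fun θ => X 0 θ z * W θ z + e θ z) angleMeasure)
    {D : ℂ → ℂ} (hD : UL2 L fun _ => D)
    (hYW : ∀ z ∈ strip L 0, Integrable (fun θ => X n θ z * W θ z) angleMeasure ∧
      ‖∫ θ, X n θ z * W θ z ∂angleMeasure‖ ≤ ‖D z‖)
    (hT : ContinuousOn (fun z => ∫ θ, (X 0 θ z * W θ z + e θ z) ∂angleMeasure) (strip L 0)) :
    RegL2 L n fun z => ∫ θ, (X 0 θ z * W θ z + e θ z) ∂angleMeasure := by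
  have hQ := isTop_QWt (strip L 0)
  induction n generalizing X e with
  | zero =>
    have he0 : QWt (strip L 0) e := he
    obtain ⟨C, hC⟩ := he0.norm_integral_le
    refine UL2.mono (hD.norm_add_const |C|) hT fun z hz => ?_
    have h1 := hYW z hz
    have h2 : AEStronglyMeasurable (fun θ => e θ z) angleMeasure := by
      have := (hm z hz).sub h1.1.aestronglyMeasurable
      refine this.congr (Eventually.of_forall fun θ => ?_)
      simp
    rw [integral_add h1.1 (he0.integrable hz h2)]
    refine (norm_add_le _ _).trans ?_
    rw [← Complex.ofReal_add, Complex.norm_real, Real.norm_eq_abs,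
      abs_of_nonneg (by positivity : 0 ≤ ‖D z‖ + |C|)]
    exact add_le_add h1.2 ((hC z hz).trans (le_abs_self C))
  | succ n ih =>
    have he0 := he
    obtain ⟨-, e', he1, he2⟩ := he
    have hW0 := hW
    obtain ⟨-, W', hW1, hW2⟩ := hW
    have hX0 := hXt 0 n.succ_pos
    simp only [Nat.add_sub_cancel, Nat.sub_zero] at hX0
    have hXW : Tower (strip L 0) angles (QWt (strip L 0)) n (fun θ z => X 0 θ z * W θ z) :=
      hX0.mul hQ (by omega) (by omega) hW0
    have hXWe : QWt (strip L 0) fun θ z => X 0 θ z * W θ z + e θ z :=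
      (hXW.mono hQ (Nat.zero_le _)).add hQ (he0.mono hQ (Nat.zero_le _))
    set e₁ : ℝ → ℂ → ℂ := fun θ z => X 0 θ z * W' θ z + e' θ z with he₁
    have he₁t : Tower (strip L 0) angles (QWt (strip L 0)) n e₁ :=
      (hX0.mul hQ (by omega) hN hW2).add hQ he2
    have hder : ∀ θ ∈ angles, ∀ z ∈ strip L 0,
        HasDerivAt (fun z => X 0 θ z * W θ z + e θ z) (X 1 θ z * W θ z + e₁ θ z) z := by
      intro θ hθ z hz
      refine (((hX 0 n.succ_pos θ hθ z hz).mul (hW1 θ hθ z hz)).add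
        (he1 θ hθ z hz)).congr_deriv ?_
      simp only [he₁]
      ring
    obtain ⟨K, hK⟩ := hXWe
    have hint := fun (z : ℂ) (hz : z ∈ strip L 0) =>
      hasDerivAt_integral_of_holomorphic (μ := angleMeasure) ae_mem_angles (isOpen_strip L 0)
        (a := fun θ z => X 0 θ z * W θ z + e θ z) (a' := fun θ z => X 1 θ z * W θ z + e₁ θ z)
        (integrable_angleWt.const_mul K) hder hm hK hz
    obtain ⟨C, hC⟩ := QWt.norm_integral_le ⟨K, hK⟩
    refine ⟨⟨C, fun _ _ => hC⟩, fun _ z => ∫ θ, (X 1 θ z * W θ z + e₁ θ z) ∂angleMeasure,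
      fun _ _ z hz => (hint z hz).2, ?_⟩
    refine ih (X := fun l => X (l + 1)) (e := e₁) (by omega)
      (fun l hl => hX (l + 1) (by omega)) (fun l hl => ?_) he₁t (fun z hz => (hint z hz).1) hYW ?_
    · have := hXt (l + 1) (by omega)
      rwa [show n + 1 - 1 - (l + 1) = n - 1 - l by omega] at this
    · have hd : DifferentiableOn ℂ
          (fun z => ∫ θ, (X 0 θ z * W θ z + e θ z) ∂angleMeasure) (strip L 0) :=
        fun z hz => (hint z hz).2.differentiableAt.differentiableWithinAt
      refine (hd.deriv (isOpen_strip L 0)).continuousOn.congr fun z hz => ?_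
      exact (hint z hz).2.deriv.symm

/-! ### The factors of the kernel -/

/-- The kernel denominator `β e^{iθ} - β'` of the unperturbed circles of radii `β` and `β'`. -/
def kap (β β' θ : ℝ) : ℂ := β * Complex.exp (θ * Complex.I) - β'

/-- The unimodular factor `κ / |κ|`. -/
def kapSign (β β' θ : ℝ) : ℂ := kap β β' θ / ‖kap β β' θ‖

/-- The quotients `(φ⁽ˡ⁾(ζ + iθ) - ψ⁽ˡ⁾(ζ)) / (β e^{iθ} - β')` for `φ(ζ) = β e^ζ + expS c ζ` and
`ψ(ζ) = β' e^ζ + expS c' ζ`. For `θ = 0` and `β = β'` the denominator vanishes; this is why `angles`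
omits `θ = 0`. -/
def famA (c c' : ℕ → ℝ) (β β' : ℝ) (l : ℕ) (θ : ℝ) (ζ : ℂ) : ℂ :=
  Complex.exp ζ
    + (expS (dcoef c l) (ζ + θ * Complex.I) - expS (dcoef c' l) ζ) / kap β β' θ

/-- The derivatives of the reflected quotient `ζ ↦ famA c c' β β' 0 (-θ) (-ζ)`. -/
def famB (c c' : ℕ → ℝ) (β β' : ℝ) (l : ℕ) (θ : ℝ) (ζ : ℂ) : ℂ :=
  (-1) ^ l * famA c c' β β' l (-θ) (-ζ)

/-- On `Re ζ = 0`, where `ζ ↦ -ζ` is complex conjugation, this is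
`|Φ(τ) - Ψ(ω)|² / |β e^{iθ} - β'|²`; it is the continuation of that function to the strip. -/
def famP (c c' : ℕ → ℝ) (β β' : ℝ) (θ : ℝ) (ζ : ℂ) : ℂ :=
  famA c c' β β' 0 θ ζ * famB c c' β β' 0 θ ζ

/-- The inverse square root of `famP`. -/
def famW (c c' : ℕ → ℝ) (β β' : ℝ) (θ : ℝ) (ζ : ℂ) : ℂ :=
  famP c c' β β' θ ζ ^ ((-(1 / 2) : ℝ) : ℂ)

section Families

variable {c c' : ℕ → ℝ} {β β' L : ℝ}

lemma norm_kapSign_le (θ : ℝ) : ‖kapSign β β' θ‖ ≤ 1 := by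
  rw [kapSign, norm_div, Complex.norm_real, norm_norm]
  exact div_self_le_one _

lemma hasDerivAt_famA (hc : Decay L c) (hc' : Decay L c') (l : ℕ) (θ : ℝ) {ζ : ℂ}
    (hζ : L < ζ.re) :
    HasDerivAt (famA c c' β β' l θ) (famA c c' β β' (l + 1) θ ζ) ζ := by
  have h1 : HasDerivAt (fun ζ => expS (dcoef c l) (ζ + θ * Complex.I))
      (expS (dcoef c (l + 1)) (ζ + θ * Complex.I)) ζ :=
    HasDerivAt.comp_add_const ζ _ (hasDerivAt_expS_dcoef hc l (by simpa using hζ))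
  exact (Complex.hasDerivAt_exp ζ).add
    ((h1.sub (hasDerivAt_expS_dcoef hc' l hζ)).div_const _)

lemma hasDerivAt_famB (hc : Decay L c) (hc' : Decay L c') (l : ℕ) (θ : ℝ) {ζ : ℂ}
    (hζ : ζ.re < -L) :
    HasDerivAt (famB c c' β β' l θ) (famB c c' β β' (l + 1) θ ζ) ζ := by
  have h1 := (hasDerivAt_famA (β := β) (β' := β') hc hc' l (-θ) (ζ := -ζ)
    (by simp; linarith)).scomp ζ (hasDerivAt_neg ζ)
  refine (h1.const_mul ((-1) ^ l)).congr_deriv ?_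
  simp only [famB, pow_succ, smul_eq_mul]
  ring

lemma famP_neg (θ : ℝ) (ζ : ℂ) : famP c c' β β' (-θ) (-ζ) = famP c c' β β' θ ζ := by
  simp only [famP, famB, neg_neg, pow_zero, one_mul]
  ring

lemma famW_neg (θ : ℝ) (ζ : ℂ) : famW c c' β β' (-θ) (-ζ) = famW c c' β β' θ ζ := by
  rw [famW, famP_neg, famW]

lemma famA_periodic (l : ℕ) (θ : ℝ) :
    Function.Periodic (famA c c' β β' l θ) (2 * Real.pi * Complex.I) := by
  intro ζ
  have h1 := expS_periodic (dcoef c l) (ζ + θ * Complex.I)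
  rw [add_right_comm] at h1
  rw [famA, famA, Complex.exp_periodic ζ, h1, expS_periodic (dcoef c' l) ζ]

lemma famW_periodic (θ : ℝ) :
    Function.Periodic (famW c c' β β' θ) (2 * Real.pi * Complex.I) := by
  intro ζ
  have h1 := famA_periodic (c := c) (c' := c') (β := β) (β' := β') 0 θ ζ
  have h2 := (famA_periodic (c := c) (c' := c') (β := β) (β' := β') 0 (-θ)).sub_eq (-ζ)
  rw [famW, famW, famP, famP, famB, famB, h1, neg_add', h2]

lemma measurable_famA (hc : Decay L c) (l : ℕ) {ζ : ℂ} (hζ : L < ζ.re) :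
    Measurable fun θ => famA c c' β β' l θ ζ := by
  have h1 : Continuous fun θ : ℝ => expS (dcoef c l) (ζ + θ * Complex.I) :=
    (continuousOn_expS (hc.dcoef l)).comp_continuous (by fun_prop) fun θ => by simpa using hζ
  have h2 : Continuous fun θ : ℝ => kap β β' θ := by unfold kap; fun_prop
  exact measurable_const.add ((h1.sub continuous_const).measurable.div h2.measurable)

lemma measurable_famB (hc : Decay L c) (l : ℕ) {ζ : ℂ} (hζ : ζ.re < -L) :
    Measurable fun θ => famB c c' β β' l θ ζ :=
  ((measurable_famA hc l (by simp; linarith)).comp measurable_neg).const_mul _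

lemma measurable_famW (hc : Decay L c) {ζ : ℂ} (hζ : ζ ∈ strip L (-L)) :
    Measurable fun θ => famW c c' β β' θ ζ :=
  ((measurable_famA hc 0 hζ.1).mul (measurable_famB hc 0 hζ.2)).pow_const _

lemma measurable_kapSign : Measurable fun θ => kapSign β β' θ := by
  have h2 : Continuous fun θ : ℝ => kap β β' θ := by unfold kap; fun_prop
  exact h2.measurable.div (Complex.measurable_ofReal.comp h2.measurable.norm)

end Families

/-- The bounds on a pair of boundary curves that make the kernel amenable: the perturbation is small
compared with the unperturbed kernel, and its derivatives of order less than `k` are controlled.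
For the order `k - 1` the bound is only integrable in `θ`. On the right half-plane, which lies away
from the boundary line `Re ζ = L`, all orders are bounded. -/
structure PairBd (L : ℝ) (k : ℕ) (c c' : ℕ → ℝ) (β β' : ℝ) : Prop where
  decay : Decay L c
  decay' : Decay L c'
  small : ∀ θ ∈ angles, ∀ ζ : ℂ, L < ζ.re →
    ‖famA c c' β β' 0 θ ζ - Complex.exp ζ‖ ≤ Real.exp L / 8
  bdd : ∀ l, l + 2 ≤ k → ∃ C : ℝ, ∀ θ ∈ angles, ∀ ζ : ℂ, L < ζ.re →
    ‖famA c c' β β' l θ ζ - Complex.exp ζ‖ ≤ C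
  top : ∃ C : ℝ, ∀ θ ∈ angles, ∀ ζ : ℂ, L < ζ.re →
    ‖famA c c' β β' (k - 1) θ ζ - Complex.exp ζ‖ ≤ C * angleWt θ
  right : ∀ l, ∃ C : ℝ, ∀ θ ∈ angles, ∀ ζ : ℂ, 0 ≤ ζ.re →
    ‖famA c c' β β' l θ ζ - Complex.exp ζ‖ ≤ C

section Pair

variable {c c' : ℕ → ℝ} {β β' L : ℝ} {k : ℕ}

lemma norm_exp_le_of_mem_strip {L : ℝ} {ζ : ℂ} (hζ : ζ ∈ strip L (-L)) :
    ‖Complex.exp ζ‖ ≤ Real.exp (-L) := by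
  rw [Complex.norm_exp]; exact Real.exp_le_exp.2 hζ.2.le

lemma neg_mem_strip {L : ℝ} {ζ : ℂ} (hζ : ζ ∈ strip L (-L)) : -ζ ∈ strip L (-L) :=
  ⟨by simp; linarith [hζ.2], by simp; linarith [hζ.1]⟩

lemma strip_left_subset {L : ℝ} (hL : L < 0) : strip L 0 ⊆ strip L (-L) :=
  strip_subset le_rfl (by linarith)

/-- Small perturbations of the two factors of `1 = e^ζ e^{-ζ}`. -/
lemma norm_mul_sub_one_le (hL : L < 0) {ζ : ℂ} (hζ : ζ ∈ strip L (-L)) {a b : ℂ}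
    (ha : ‖a - Complex.exp ζ‖ ≤ Real.exp L / 8) (hb : ‖b - Complex.exp (-ζ)‖ ≤ Real.exp L / 8) :
    ‖a * b - 1‖ ≤ 1 / 2 := by
  have e : a * b - 1 = (a - Complex.exp ζ) * Complex.exp (-ζ)
      + Complex.exp ζ * (b - Complex.exp (-ζ))
      + (a - Complex.exp ζ) * (b - Complex.exp (-ζ)) := by
    have : Complex.exp ζ * Complex.exp (-ζ) = 1 := by rw [← Complex.exp_add]; simp
    linear_combination this
  have h1 := norm_exp_le_of_mem_strip hζ
  have h2 := norm_exp_le_of_mem_strip (neg_mem_strip hζ)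
  have h3 : Real.exp L * Real.exp (-L) = 1 := by rw [← Real.exp_add]; simp
  have h4 : Real.exp L ≤ 1 := Real.exp_le_one_iff.2 hL.le
  have h5 := Real.exp_pos L
  rw [e]
  calc _ ≤ ‖a - Complex.exp ζ‖ * ‖Complex.exp (-ζ)‖ + ‖Complex.exp ζ‖ * ‖b - Complex.exp (-ζ)‖
        + ‖a - Complex.exp ζ‖ * ‖b - Complex.exp (-ζ)‖ := by
        rw [← norm_mul, ← norm_mul, ← norm_mul]; exact norm_add₃_le
    _ ≤ Real.exp L / 8 * Real.exp (-L) + Real.exp (-L) * (Real.exp L / 8)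
        + Real.exp L / 8 * (Real.exp L / 8) := by gcongr
    _ ≤ 1 / 2 := by nlinarith

lemma PairBd.norm_famP_sub_one_le (h : PairBd L k c c' β β') (hL : L < 0) {θ : ℝ}
    (hθ : θ ∈ angles) {ζ : ℂ} (hζ : ζ ∈ strip L (-L)) : ‖famP c c' β β' θ ζ - 1‖ ≤ 1 / 2 := by
  rw [famP, famB, pow_zero, one_mul]
  exact norm_mul_sub_one_le hL hζ (h.small θ hθ ζ hζ.1)
    (h.small _ (neg_mem_angles hθ) _ (neg_mem_strip hζ).1)

lemma mem_slitPlane_of_norm_sub_one_le {w : ℂ} (hw : ‖w - 1‖ ≤ 1 / 2) : w ∈ Complex.slitPlane := by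
  left
  have := (abs_le.1 ((Complex.abs_re_le_norm (w - 1)).trans hw)).1
  simp at this
  linarith

lemma half_le_norm {w : ℂ} (hw : ‖w - 1‖ ≤ 1 / 2) : 1 / 2 ≤ ‖w‖ := by
  have := norm_sub_norm_le (1 : ℂ) w
  rw [norm_one, norm_sub_rev] at this
  linarith

lemma norm_cpow_neg_half_le {w : ℂ} (hw : ‖w - 1‖ ≤ 1 / 2) :
    ‖w ^ ((-(1 / 2) : ℝ) : ℂ)‖ ≤ 2 := by
  rw [Complex.norm_cpow_real]
  calc ‖w‖ ^ (-(1 / 2) : ℝ) ≤ (1 / 2 : ℝ) ^ (-(1 / 2) : ℝ) :=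
        Real.rpow_le_rpow_of_nonpos (by norm_num) (half_le_norm hw) (by norm_num)
    _ ≤ (1 / 2 : ℝ) ^ (-1 : ℝ) :=
        Real.rpow_le_rpow_of_exponent_ge (by norm_num) (by norm_num) (by norm_num)
    _ = 2 := by rw [Real.rpow_neg_one]; norm_num

lemma hasDerivAt_cpow_neg_half {w : ℂ} (hw : ‖w - 1‖ ≤ 1 / 2) :
    HasDerivAt (fun w : ℂ => w ^ ((-(1 / 2) : ℝ) : ℂ))
      (-(1 / 2) * (w ^ ((-(1 / 2) : ℝ) : ℂ)) ^ 3) w := by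
  have h1 := (hasDerivAt_id w).cpow_const (c := ((-(1 / 2) : ℝ) : ℂ))
    (mem_slitPlane_of_norm_sub_one_le hw)
  refine h1.congr_deriv ?_
  rw [← Complex.cpow_nat_mul]
  simp only [id, mul_one]
  congr 2
  · push_cast; ring
  · push_cast; ring

lemma norm_cpow_neg_half_sub_le {w w' : ℂ} (hw : ‖w - 1‖ ≤ 1 / 2) (hw' : ‖w' - 1‖ ≤ 1 / 2) :
    ‖w ^ ((-(1 / 2) : ℝ) : ℂ) - w' ^ ((-(1 / 2) : ℝ) : ℂ)‖ ≤ 4 * ‖w - w'‖ := by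
  refine (convex_closedBall (1 : ℂ) (1 / 2)).norm_image_sub_le_of_norm_hasDerivWithin_le
    (f := fun w : ℂ => w ^ ((-(1 / 2) : ℝ) : ℂ))
    (fun x hx => (hasDerivAt_cpow_neg_half (by simpa [dist_eq_norm] using hx)).hasDerivWithinAt)
    (fun x hx => ?_) (by simpa [dist_eq_norm] using hw') (by simpa [dist_eq_norm] using hw)
  have hx' : ‖x - 1‖ ≤ 1 / 2 := by simpa [dist_eq_norm] using hx
  rw [norm_mul, norm_pow]
  calc _ ≤ (1 / 2 : ℝ) * 2 ^ 3 := by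
        gcongr
        · norm_num
        · exact norm_cpow_neg_half_le hx'
    _ = 4 := by norm_num

lemma PairBd.norm_famW_le (h : PairBd L k c c' β β') (hL : L < 0) {θ : ℝ}
    (hθ : θ ∈ angles) {ζ : ℂ} (hζ : ζ ∈ strip L (-L)) : ‖famW c c' β β' θ ζ‖ ≤ 2 :=
  norm_cpow_neg_half_le (h.norm_famP_sub_one_le hL hθ hζ)

/-- The `ζ`-derivative of `famP`. -/
def famP' (c c' : ℕ → ℝ) (β β' : ℝ) (θ : ℝ) (ζ : ℂ) : ℂ :=
  famA c c' β β' 1 θ ζ * famB c c' β β' 0 θ ζ + famA c c' β β' 0 θ ζ * famB c c' β β' 1 θ ζ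

lemma PairBd.hasDerivAt_famW (h : PairBd L k c c' β β') (hL : L < 0) {θ : ℝ}
    (hθ : θ ∈ angles) {ζ : ℂ} (hζ : ζ ∈ strip L (-L)) :
    HasDerivAt (famW c c' β β' θ)
      (-(1 / 2) * famW c c' β β' θ ζ ^ 3 * famP' c c' β β' θ ζ) ζ := by
  have h1 : HasDerivAt (famP c c' β β' θ) (famP' c c' β β' θ ζ) ζ :=
    (hasDerivAt_famA h.decay h.decay' 0 θ hζ.1).mul (hasDerivAt_famB h.decay h.decay' 0 θ hζ.2)
  exact (hasDerivAt_cpow_neg_half (h.norm_famP_sub_one_le hL hθ hζ)).comp ζ h1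

lemma PairBd.uBdd_famA (h : PairBd L k c c' β β') {l : ℕ} (hl : l + 2 ≤ k) :
    UBdd (strip L (-L)) angles (famA c c' β β' l) := by
  obtain ⟨C, hC⟩ := h.bdd l hl
  refine ⟨C + Real.exp (-L), fun θ hθ ζ hζ => ?_⟩
  have := norm_add_le (famA c c' β β' l θ ζ - Complex.exp ζ) (Complex.exp ζ)
  rw [sub_add_cancel] at this
  exact this.trans (add_le_add (hC θ hθ ζ hζ.1) (norm_exp_le_of_mem_strip hζ))

lemma UBdd.mono {ι : Type*} {U V : Set ℂ} {I : Set ι} {a : ι → ℂ → ℂ} (h : UBdd V I a)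
    (hUV : U ⊆ V) : UBdd U I a := by
  obtain ⟨C, hC⟩ := h
  exact ⟨C, fun i hi z hz => hC i hi z (hUV hz)⟩

lemma PairBd.uBdd_famB (h : PairBd L k c c' β β') (hL : L < 0) (l : ℕ) :
    UBdd (strip L 0) angles (famB c c' β β' l) := by
  obtain ⟨C, hC⟩ := h.right l
  refine ⟨C + Real.exp (-L), fun θ hθ ζ hζ => ?_⟩
  have := norm_add_le (famA c c' β β' l (-θ) (-ζ) - Complex.exp (-ζ)) (Complex.exp (-ζ))
  rw [sub_add_cancel] at this
  rw [famB, norm_mul, norm_pow, norm_neg, norm_one, one_pow, one_mul]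
  exact this.trans (add_le_add (hC _ (neg_mem_angles hθ) _ (by simpa using hζ.2.le))
    (norm_exp_le_of_mem_strip (neg_mem_strip (strip_left_subset hL hζ))))

lemma PairBd.tower_famA (h : PairBd L k c c' β β') (hL : L < 0) (hk : 3 ≤ k) {l : ℕ}
    (hl : l + 1 ≤ k) :
    Tower (strip L 0) angles (QWt (strip L 0)) (k - 1 - l) (famA c c' β β' l) := by
  have := Tower.of_seq (U := strip L 0) (I := angles) (Q := QWt (strip L 0)) (n := k - 1 - l)
    (a := fun m => famA c c' β β' (l + m))
    (fun m _ θ _ z hz => hasDerivAt_famA h.decay h.decay' (l + m) θ hz.1)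
    (fun m hm => (h.uBdd_famA (by omega)).mono (strip_left_subset hL)) ?_
  · simpa using this
  · obtain ⟨C, hC⟩ := h.top
    rw [show l + (k - 1 - l) = k - 1 by omega]
    refine ⟨C + Real.exp (-L), fun θ hθ ζ hζ => ?_⟩
    have := norm_add_le (famA c c' β β' (k - 1) θ ζ - Complex.exp ζ) (Complex.exp ζ)
    rw [sub_add_cancel] at this
    refine this.trans ?_
    rw [add_mul]
    refine add_le_add (hC θ hθ ζ hζ.1) ((norm_exp_le_of_mem_strip (strip_left_subset hL hζ)).trans ?_)
    exact le_mul_of_one_le_right (Real.exp_pos _).le (one_le_angleWt θ)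

lemma PairBd.tower_famB (h : PairBd L k c c' β β') (hL : L < 0) (l n : ℕ) :
    Tower (strip L 0) angles (QWt (strip L 0)) n (famB c c' β β' l) := by
  have hd : ∀ m, ∀ θ ∈ angles, ∀ z ∈ strip L 0,
      HasDerivAt (famB c c' β β' m θ) (famB c c' β β' (m + 1) θ z) z := fun m θ _ z hz =>
    hasDerivAt_famB h.decay h.decay' m θ (strip_left_subset hL hz).2
  exact Tower.of_seq (a := fun m => famB c c' β β' (l + m)) (fun m _ => hd (l + m))
    (fun m _ => h.uBdd_famB hL (l + m)) ((isTop_QWt _).of_bdd _ (h.uBdd_famB hL _)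
      fun θ hθ z hz => (hd _ θ hθ z hz).differentiableAt.differentiableWithinAt)

lemma PairBd.tower_famW (h : PairBd L k c c' β β') (hL : L < 0) (hk : 3 ≤ k) :
    Tower (strip L 0) angles (QWt (strip L 0)) (k - 1) (famW c c' β β') := by
  have hQ := isTop_QWt (strip L 0)
  have hP' : Tower (strip L 0) angles (QWt (strip L 0)) (k - 2) (famP' c c' β β') := by
    have h1 := h.tower_famA hL hk (l := 1) (by omega)
    have h0 := h.tower_famA hL hk (l := 0) (by omega)
    rw [show k - 1 - 1 = k - 2 by omega] at h1
    exact (h1.mul hQ le_rfl (by omega) (h.tower_famB hL 0 _)).add hQ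
      ((h0.mono hQ (by omega)).mul hQ le_rfl (by omega) (h.tower_famB hL 1 _))
  have := Tower.of_cube (isOpen_strip L 0) hQ hP' (W := famW c c' β β')
    ⟨2, fun θ hθ ζ hζ => h.norm_famW_le hL hθ (strip_left_subset hL hζ)⟩
    fun θ hθ ζ hζ => h.hasDerivAt_famW hL hθ (strip_left_subset hL hζ)
  rwa [show k - 2 + 1 = k - 1 by omega] at this

/-- The holomorphic extension of `S(Φ, Ψ)` in the coordinate `ζ`. -/
def extS (c c' : ℕ → ℝ) (β β' : ℝ) (ζ : ℂ) : ℂ :=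
  (2 * Real.pi : ℂ)⁻¹ *
    ∫ θ, kapSign β β' θ * famA c c' β β' 1 θ ζ * famW c c' β β' θ ζ ∂angleMeasure

lemma extS_periodic : Function.Periodic (extS c c' β β') (2 * Real.pi * Complex.I) := by
  intro ζ
  simp only [extS, famA_periodic 1 _ ζ, famW_periodic _ ζ]

lemma PairBd.differentiableOn_extS (h : PairBd L k c c' β β') (hL : L < 0) (hk : 3 ≤ k) :
    DifferentiableOn ℂ (extS c c' β β') (strip L (-L)) := by
  intro ζ hζ
  obtain ⟨C, hC⟩ := h.uBdd_famA (l := 1) (by omega)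
  refine DifferentiableAt.differentiableWithinAt (DifferentiableAt.const_mul ?_ _)
  refine (hasDerivAt_integral_of_holomorphic (μ := angleMeasure) ae_mem_angles (isOpen_strip L (-L))
    (a := fun θ ζ => kapSign β β' θ * famA c c' β β' 1 θ ζ * famW c c' β β' θ ζ)
    (q := fun _ => 1 * C * 2)
    (integrable_const _) (fun θ hθ z hz =>
      (((hasDerivAt_famA h.decay h.decay' 1 θ hz.1).const_mul (kapSign β β' θ)).mul
        (h.hasDerivAt_famW hL hθ hz))) (fun z hz => ?_) (fun θ hθ z hz => ?_) hζ).2.differentiableAt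
  · exact ((measurable_kapSign.mul (measurable_famA h.decay 1 hz.1)).mul
      (measurable_famW h.decay hz)).aestronglyMeasurable
  · have h1 := hC θ hθ z hz
    have h2 := (norm_nonneg _).trans h1
    rw [norm_mul, norm_mul]
    gcongr
    · exact norm_kapSign_le θ
    · exact h.norm_famW_le hL hθ hz

/-- Reflection `ζ ↦ -ζ` of the extension, after the substitution `θ ↦ -θ`. -/
lemma extS_neg (ζ : ℂ) : extS c c' β β' (-ζ) = (2 * Real.pi : ℂ)⁻¹ *
    ∫ θ, (-kapSign β β' (-θ)) * famB c c' β β' 1 θ ζ * famW c c' β β' θ ζ ∂angleMeasure := by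
  rw [extS]
  congr 1
  have hpi : -Real.pi ≤ Real.pi := by linarith [Real.pi_pos]
  simp only [angleMeasure]
  rw [← intervalIntegral.integral_of_le hpi, ← intervalIntegral.integral_of_le hpi]
  have h1 := intervalIntegral.integral_comp_neg (a := -Real.pi) (b := Real.pi)
    (fun θ => kapSign β β' θ * famA c c' β β' 1 θ (-ζ) * famW c c' β β' θ (-ζ))
  rw [neg_neg] at h1
  rw [← h1]
  congr 1
  ext θ
  rw [famW_neg, famB]
  ring

end Pair

/-! ### Integrals over the circle -/

lemma integral_shift {E : Type*} [NormedAddCommGroup E] [NormedSpace ℝ E] {p : ℝ → E}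
    (hp : Function.Periodic p (2 * Real.pi)) (t : ℝ) :
    ∫ s in (0 : ℝ)..(2 * Real.pi), p s = ∫ θ, p (t + θ) ∂angleMeasure := by
  have hpi : -Real.pi ≤ Real.pi := by linarith [Real.pi_pos]
  have h1 := hp.intervalIntegral_add_eq 0 (t + -Real.pi)
  rw [zero_add, show t + -Real.pi + 2 * Real.pi = t + Real.pi by ring] at h1
  rw [h1, angleMeasure, ← intervalIntegral.integral_of_le hpi,
    intervalIntegral.integral_comp_add_left]

lemma circleMap_periodic : Function.Periodic (circleMap 0 1) (2 * Real.pi) :=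
  periodic_circleMap 0 1

lemma circleIntegral_div (g : ℂ → ℂ) (t : ℝ) :
    (∮ τ in C(0, 1), g τ / τ) = Complex.I * ∫ θ, g (circleMap 0 1 (t + θ)) ∂angleMeasure := by
  rw [← integral_shift (p := fun s => g (circleMap 0 1 s))
    (fun s => by simp only [circleMap_periodic s]) t, circleIntegral,
    ← intervalIntegral.integral_const_mul]
  congr 1
  ext s
  have : circleMap 0 1 s ≠ 0 := circleMap_ne_center one_ne_zero
  rw [deriv_circleMap, smul_eq_mul]
  field_simp

lemma norm_circleMap_sub (t θ : ℝ) :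
    ‖circleMap 0 1 (t + θ) - circleMap 0 1 t‖ = ‖Complex.exp (θ * Complex.I) - 1‖ := by
  have : circleMap 0 1 (t + θ) - circleMap 0 1 t
      = circleMap 0 1 t * (Complex.exp (θ * Complex.I) - 1) := by
    simp only [circleMap]; push_cast; rw [add_mul, Complex.exp_add]; ring
  rw [this, norm_mul, norm_circleMap_zero, abs_one, one_mul]

/-- The singular integral `∫ (G(ζ + iθ) - G(ζ)) / |e^{iθ} - 1| dθ`. -/
def logInt (G : ℂ → ℂ) (ζ : ℂ) : ℂ :=
  ∫ θ, (G (ζ + θ * Complex.I) - G ζ) / (‖Complex.exp (θ * Complex.I) - 1‖ : ℂ) ∂angleMeasure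

lemma logIntegral_eq (F : ℂ → ℂ) (ξ t : ℝ) :
    logIntegral F (Real.exp ξ) (circleMap 0 1 t)
      = Complex.I * logInt (fun ζ => F (Complex.exp ζ)) (ξ + t * Complex.I) := by
  rw [logIntegral, circleIntegral_div (fun τ => (F ((Real.exp ξ : ℂ) * τ)
    - F ((Real.exp ξ : ℂ) * circleMap 0 1 t)) / (‖τ - circleMap 0 1 t‖ : ℂ)) t, logInt]
  congr 2
  ext θ
  rw [norm_circleMap_sub, exp_line, show (ξ : ℂ) + t * Complex.I + θ * Complex.I
    = ξ + ((t + θ : ℝ) : ℂ) * Complex.I by push_cast; ring, exp_line]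

/-- The norm of the singular integral in `normX` is a uniform `L²` bound for `logInt`. -/
lemma uL2_logInt {L : ℝ} {F : ℂ → ℂ} {C : NNReal}
    (hF : ContinuousOn (fun ζ => F (Complex.exp ζ)) (strip L 0))
    (h : ∀ ξ ∈ Ioo L 0, circleNorm (logIntegral F (Real.exp ξ)) ≤ C) :
    UL2 L fun _ => logInt fun ζ => F (Complex.exp ζ) := by
  refine ⟨C, fun ξ hξ => ⟨?_, ?_⟩⟩
  · set g : ℝ → ℂ := fun t => F (Complex.exp (ξ + t * Complex.I)) with hg
    have hgc : Continuous g := continuous_line hF hξ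
    have hm : StronglyMeasurable fun p : ℝ × ℝ =>
        (g (p.1 + p.2) - g p.1) / (‖Complex.exp (p.2 * Complex.I) - 1‖ : ℂ) := by
      apply Measurable.stronglyMeasurable
      refine Measurable.div ?_ ?_
      · exact (Continuous.sub (by fun_prop) (by fun_prop)).measurable
      · exact Continuous.measurable (by fun_prop)
    have := (hm.integral_prod_right' (ν := angleMeasure)).aestronglyMeasurable
      (μ := volume.restrict (Ioc 0 (2 * Real.pi)))
    refine this.congr (Eventually.of_forall fun t => ?_)
    simp only [logInt, hg]
    congr 1
    ext θ
    congr 4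
    push_cast
    ring
  · refine le_trans (eLpNorm_mono fun t => ?_) (h ξ hξ)
    rw [logIntegral_eq, norm_mul, Complex.norm_I, one_mul]

/-! ### Lower bounds for the kernel denominator -/

lemma half_abs_le_norm_exp_sub_one {θ : ℝ} (hθ : |θ| ≤ Real.pi) :
    |θ| / 2 ≤ ‖Complex.exp (θ * Complex.I) - 1‖ := by
  rw [mul_comm, Complex.norm_exp_I_mul_ofReal_sub_one, norm_mul, Real.norm_eq_abs, Real.norm_eq_abs,
    abs_two]
  have h1 := Real.mul_abs_le_abs_sin (x := θ / 2) (by rw [abs_div, abs_two]; linarith)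
  rw [abs_div, abs_two] at h1
  have h2 : (1 / 2 : ℝ) ≤ 2 / Real.pi := by
    rw [div_le_div_iff₀ (by norm_num) Real.pi_pos]; linarith [Real.pi_le_four]
  nlinarith [abs_nonneg θ]

lemma kap_self (β θ : ℝ) : kap β β θ = β * (Complex.exp (θ * Complex.I) - 1) := by
  rw [kap]; ring

lemma norm_kap_self {β : ℝ} (hβ : 0 < β) (θ : ℝ) :
    ‖kap β β θ‖ = β * ‖Complex.exp (θ * Complex.I) - 1‖ := by
  rw [kap_self, norm_mul, Complex.norm_real, Real.norm_eq_abs, abs_of_pos hβ]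

lemma le_norm_kap_self {β : ℝ} (hβ : 0 < β) {θ : ℝ} (hθ : θ ∈ angles) :
    β * |θ| / 2 ≤ ‖kap β β θ‖ := by
  rw [norm_kap_self hβ]
  have := mul_le_mul_of_nonneg_left
    (half_abs_le_norm_exp_sub_one (abs_le_pi_of_mem_angles hθ)) hβ.le
  linarith

lemma le_norm_kap {β β' : ℝ} (hβ : 0 ≤ β) (hβ' : 0 ≤ β') (θ : ℝ) : |β - β'| ≤ ‖kap β β' θ‖ := by
  have := abs_norm_sub_norm_le ((β : ℂ) * Complex.exp (θ * Complex.I)) (β' : ℂ)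
  rw [norm_mul, Complex.norm_exp_ofReal_mul_I, mul_one, Complex.norm_real, Complex.norm_real,
    Real.norm_eq_abs, Real.norm_eq_abs, abs_of_nonneg hβ, abs_of_nonneg hβ'] at this
  exact this

lemma rpow_quarter_div {θ : ℝ} (hθ : θ ≠ 0) :
    |θ| ^ (1 / 4 : ℝ) / |θ| = |θ| ^ (-(3 / 4) : ℝ) := by
  have h : 0 < |θ| := abs_pos.2 hθ
  rw [← Real.rpow_sub_one h.ne']; norm_num

section Pair

variable {c c' : ℕ → ℝ} {β β' L B : ℝ} {k : ℕ}

lemma famA_sub_exp (l : ℕ) (θ : ℝ) (ζ : ℂ) : famA c c' β β' l θ ζ - Complex.exp ζ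
    = (expS (dcoef c l) (ζ + θ * Complex.I) - expS (dcoef c' l) ζ) / kap β β' θ := by
  rw [famA, add_sub_cancel_left]

lemma norm_famA_self_le (hβ : 0 < β) {l : ℕ} {θ C : ℝ} (hθ : θ ∈ angles) {ζ : ℂ}
    (h : ‖expS (dcoef c l) (ζ + θ * Complex.I) - expS (dcoef c l) ζ‖ ≤ C * |θ|) :
    ‖famA c c β β l θ ζ - Complex.exp ζ‖ ≤ 2 * C / β := by
  have h0 : 0 < |θ| := abs_pos.2 hθ.2.2
  have h1 := le_norm_kap_self hβ hθ
  have h2 : 0 < β * |θ| / 2 := by positivity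
  rw [famA_sub_exp, norm_div]
  calc _ ≤ C * |θ| / (β * |θ| / 2) := div_le_div₀ ((norm_nonneg _).trans h) h h2 h1
    _ = _ := by field_simp

lemma CoefBd.pairBd_self (h : CoefBd L k B c) (hL : L < 0) (hk : 3 ≤ k) (hβ : 0 < β)
    (hB : 2 * B / β ≤ Real.exp L / 8) : PairBd L k c c β β where
  decay := h.decay
  decay' := h.decay
  small θ hθ ζ hζ := (norm_famA_self_le hβ hθ (h.shift_le (by omega) hζ θ)).trans hB
  bdd l hl := ⟨2 * B / β, fun θ hθ ζ hζ => norm_famA_self_le hβ hθ (h.shift_le hl hζ θ)⟩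
  top := by
    refine ⟨4 * B / β, fun θ hθ ζ hζ => ?_⟩
    have h0 : 0 < |θ| := abs_pos.2 hθ.2.2
    have h1 := le_norm_kap_self hβ hθ
    have h2 : 0 < β * |θ| / 2 := by positivity
    have h3 := h.shift_le_rpow (h.decay.dcoef (k - 1)) zero_le_one
      (fun n => by rw [abs_dcoef, one_mul]) hζ θ
    have hB0 := h.nonneg
    rw [famA_sub_exp, norm_div]
    calc _ ≤ 2 * (1 * B) * |θ| ^ (1 / 4 : ℝ) / (β * |θ| / 2) :=
          div_le_div₀ ((norm_nonneg _).trans h3) h3 h2 h1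
      _ = 4 * B / β * (|θ| ^ (1 / 4 : ℝ) / |θ|) := by field_simp; ring
      _ ≤ _ := by
        rw [rpow_quarter_div hθ.2.2, angleWt]
        gcongr
        linarith
  right l := by
    obtain ⟨C, -, hC⟩ := h.decay.exists_bound hL l
    exact ⟨2 * C / β, fun θ hθ ζ hζ => norm_famA_self_le hβ hθ ((hC ζ hζ).2 θ)⟩

lemma norm_famA_le (hβ : 0 ≤ β) (hβ' : 0 ≤ β') (hne : β ≠ β') {l : ℕ} {θ C C' : ℝ} {ζ : ℂ}
    (h : ‖expS (dcoef c l) (ζ + θ * Complex.I)‖ ≤ C) (h' : ‖expS (dcoef c' l) ζ‖ ≤ C') :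
    ‖famA c c' β β' l θ ζ - Complex.exp ζ‖ ≤ (C + C') / |β - β'| := by
  have h1 := le_norm_kap hβ hβ' θ
  have h2 : 0 < |β - β'| := abs_pos.2 (sub_ne_zero.2 hne)
  rw [famA_sub_exp, norm_div]
  have h3 : ‖expS (dcoef c l) (ζ + θ * Complex.I) - expS (dcoef c' l) ζ‖ ≤ C + C' :=
    (norm_sub_le _ _).trans (add_le_add h h')
  exact div_le_div₀ ((norm_nonneg _).trans h3) h3 h2 h1

lemma CoefBd.pairBd (h : CoefBd L k B c) (h' : CoefBd L k B c') (hL : L < 0) (hk : 3 ≤ k)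
    (hβ : 0 ≤ β) (hβ' : 0 ≤ β') (hne : β ≠ β')
    (hB : 2 * B / |β - β'| ≤ Real.exp L / 8) : PairBd L k c c' β β' := by
  have key : ∀ l, l + 1 ≤ k → ∀ θ : ℝ, ∀ ζ : ℂ, L < ζ.re →
      ‖famA c c' β β' l θ ζ - Complex.exp ζ‖ ≤ 2 * B / |β - β'| := by
    intro l hl θ ζ hζ
    rw [two_mul]
    exact norm_famA_le hβ hβ' hne (h.norm_le hl (by simpa using hζ)) (h'.norm_le hl hζ)
  refine ⟨h.decay, h'.decay, fun θ _ ζ hζ => (key 0 (by omega) θ ζ hζ).trans hB,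
    fun l hl => ⟨_, fun θ _ ζ hζ => key l (by omega) θ ζ hζ⟩, ⟨_, fun θ _ ζ hζ =>
      (key (k - 1) (by omega) θ ζ hζ).trans (le_mul_of_one_le_right ?_ (one_le_angleWt θ))⟩,
    fun l => ?_⟩
  · have := h.nonneg
    positivity
  · obtain ⟨C, -, hC⟩ := h.decay.exists_bound hL l
    obtain ⟨C', -, hC'⟩ := h'.decay.exists_bound hL l
    exact ⟨_, fun θ _ ζ hζ => norm_famA_le hβ hβ' hne (hC _ (by simpa using hζ)).1 (hC' ζ hζ).1⟩

/-! ### The top order terms -/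

/-- The top derivative of `expS c` is `z^k f^{(k)}` up to a function that is bounded and Hölder
continuous in the vertical direction. -/
lemma CoefBd.exists_top_split (h : CoefBd L k B c) (hk : 1 ≤ k) :
    ∃ (ρ : ℂ → ℂ) (C : ℝ), 0 ≤ C ∧ ∀ ζ : ℂ, L < ζ.re →
      expS (dcoef c k) ζ = expS (fallCoef c k) ζ + ρ ζ ∧ ‖ρ ζ‖ ≤ C ∧
      ∀ θ : ℝ, ‖ρ (ζ + θ * Complex.I) - ρ ζ‖ ≤ C * |θ| ^ (1 / 4 : ℝ) := by
  obtain ⟨C, hC, hCd⟩ := exists_abs_dcoef_sub_fallCoef_le (k - 1)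
  rw [Nat.sub_add_cancel hk] at hCd
  have hB0 := h.nonneg
  set d : ℕ → ℝ := fun n => dcoef c k n - 1 * fallCoef c k n with hd
  have hdle : ∀ n : ℕ, |d n| ≤ C * (((n : ℝ) + 1) ^ (k - 1) * |c n|) := fun n => by
    simp only [hd, one_mul]; exact hCd c n
  have hdd : Decay L d := by
    refine (h.decay.dcoef (k - 1)).of_le C fun n => (hdle n).trans ?_
    rw [abs_dcoef]
    have hn : (1 : ℝ) ≤ (n : ℝ) + 1 := by simp
    exact mul_le_mul_of_nonneg_left (le_mul_of_one_le_left (by positivity) hn) hC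
  refine ⟨expS d, 2 * (C * B), by positivity, fun ζ hζ => ⟨?_, ?_, fun θ =>
    h.shift_le_rpow hdd hC hdle hζ θ⟩⟩
  · rw [hd, expS_comb (h.decay.dcoef k) (h.decay.fallCoef k) 1 hζ]; push_cast; ring
  · have h1 := h.pow (m := k - 1) (by omega)
    have hle : ∀ n, |d n| * wt L n ≤ C * (((n : ℝ) + 1) ^ (k - 1) * |c n| * wt L n) := fun n => by
      have := mul_le_mul_of_nonneg_right (hdle n) (wt_pos L n).le
      linarith
    have hs := Summable.of_nonneg_of_le (fun n => mul_nonneg (abs_nonneg _) (wt_pos L n).le) hle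
      (h1.1.mul_left C)
    refine (norm_expS_le hs hζ.le).trans ((hs.tsum_le_tsum hle (h1.1.mul_left C)).trans ?_)
    rw [tsum_mul_left]
    nlinarith [mul_le_mul_of_nonneg_left h1.2 hC, mul_nonneg hC hB0]

lemma UL2.norm_comb {D D' : ℂ → ℂ} (hD : UL2 L fun _ => D) (hD' : UL2 L fun _ => D')
    (a b C : ℝ) : UL2 L fun _ ζ => ((a * ‖D ζ‖ + b * ‖D' ζ‖ + C : ℝ) : ℂ) := by
  have hQ := isTop_UL2 L
  have hc : ∀ s : ℝ, UBdd (strip L 0) (univ : Set Unit) (fun _ _ => (s : ℂ)) :=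
    fun s => ⟨‖(s : ℂ)‖, fun _ _ _ _ => le_rfl⟩
  have h1 := hQ.mul _ _ (hD.norm_add_const 0) (hc a) fun _ _ => differentiableOn_const _
  have h2 := hQ.mul _ _ (hD'.norm_add_const 0) (hc b) fun _ _ => differentiableOn_const _
  have h3 := hQ.of_bdd _ (hc C) fun _ _ => differentiableOn_const _
  refine hQ.congr _ _ (fun _ _ ζ _ => ?_) (hQ.add _ _ (hQ.add _ _ h1 h2) h3)
  push_cast
  ring

lemma continuous_expS_vert {d : ℕ → ℝ} (hd : Decay L d) {ζ : ℂ} (hζ : L < ζ.re) :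
    Continuous fun θ : ℝ => expS d (ζ + θ * Complex.I) :=
  (continuousOn_expS hd).comp_continuous (by fun_prop) fun θ => by simpa using hζ

lemma integrable_of_continuous {E : Type*} [NormedAddCommGroup E] {p : ℝ → E} (hp : Continuous p) :
    Integrable p angleMeasure :=
  hp.integrableOn_Ioc

/-- A uniform `L²` bound gives a uniform `L¹` bound. -/
lemma exists_integral_norm_le {d : ℕ → ℝ} (hv : UL2 L fun _ => expS d) :
    ∃ M : ℝ, ∀ ζ ∈ strip L 0, ∫ θ, ‖expS d (ζ + θ * Complex.I)‖ ∂angleMeasure ≤ M := by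
  obtain ⟨C, hC⟩ := hv
  refine ⟨C * (2 * Real.pi) ^ (1 / 2 : ℝ), fun ζ hζ => ?_⟩
  have hpi : (0 : ℝ) ≤ 2 * Real.pi := by positivity
  have h1 := hC ζ.re hζ
  have hper : Function.Periodic (fun t : ℝ => ‖expS d (ζ.re + t * Complex.I)‖) (2 * Real.pi) := by
    intro t
    have := expS_periodic d (ζ.re + t * Complex.I)
    simp only
    rw [← this]
    congr 2
    push_cast
    ring
  have h2 := integral_shift hper ζ.im
  have e : ∀ θ : ℝ, ((ζ.re : ℂ) + ((ζ.im + θ : ℝ) : ℂ) * Complex.I) = ζ + θ * Complex.I := by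
    intro θ
    nth_rw 3 [← Complex.re_add_im ζ]
    push_cast
    ring
  simp only [e] at h2
  rw [← h2, intervalIntegral.integral_of_le hpi, integral_norm_eq_lintegral_enorm h1.1,
    ← eLpNorm_one_eq_lintegral_enorm]
  have h3 := eLpNorm_le_eLpNorm_mul_rpow_measure_univ (p := 1) (q := 2) (by norm_num) h1.1
  have h4 : eLpNorm (fun t : ℝ => expS d (ζ.re + t * Complex.I)) 1
      (volume.restrict (Ioc 0 (2 * Real.pi)))
      ≤ ENNReal.ofReal (C * (2 * Real.pi) ^ (1 / 2 : ℝ)) := by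
    refine h3.trans ?_
    rw [ENNReal.ofReal_mul (NNReal.coe_nonneg C), ENNReal.ofReal_coe_nnreal]
    refine mul_le_mul' h1.2 (le_of_eq ?_)
    rw [Measure.restrict_apply_univ, Real.volume_Ioc, sub_zero,
      ENNReal.ofReal_rpow_of_nonneg hpi (by norm_num)]
    norm_num
  exact ENNReal.toReal_le_of_le_ofReal (by positivity) h4

end Pair

section Pair

variable {c c' : ℕ → ℝ} {β β' L B : ℝ} {k : ℕ}

/-- The bound that `regL2_integral` requires for the integral with the top derivative. -/
def TopBd (L : ℝ) (k : ℕ) (c c' : ℕ → ℝ) (β β' : ℝ) : Prop :=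
  ∃ D : ℂ → ℂ, UL2 L (fun _ => D) ∧ ∀ ζ ∈ strip L 0,
    Integrable (fun θ => kapSign β β' θ * famA c c' β β' k θ ζ * famW c c' β β' θ ζ)
      angleMeasure ∧
    ‖∫ θ, kapSign β β' θ * famA c c' β β' k θ ζ * famW c c' β β' θ ζ ∂angleMeasure‖ ≤ ‖D ζ‖

lemma aestronglyMeasurable_top (hc : Decay L c) {ζ : ℂ} (hL : L < 0) (hζ : ζ ∈ strip L 0) (l : ℕ) :
    AEStronglyMeasurable
      (fun θ => kapSign β β' θ * famA c c' β β' l θ ζ * famW c c' β β' θ ζ) angleMeasure :=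
  ((measurable_kapSign.mul (measurable_famA hc l hζ.1)).mul
    (measurable_famW hc (strip_left_subset hL hζ))).aestronglyMeasurable

lemma norm_exp_le_one {ζ : ℂ} (hζ : ζ ∈ strip L 0) : ‖Complex.exp ζ‖ ≤ 1 := by
  rw [Complex.norm_exp]; exact Real.exp_le_one_iff.2 hζ.2.le

/-- For curves at positive distance, the kernel is not singular. -/
lemma CoefBd.topBd (h : CoefBd L k B c) (h' : CoefBd L k B c') (hL : L < 0) (hk : 1 ≤ k)
    (hβ : 0 ≤ β) (hβ' : 0 ≤ β') (hne : β ≠ β') (hP : PairBd L k c c' β β')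
    (hv : UL2 L fun _ => expS (fallCoef c k)) (hv' : UL2 L fun _ => expS (fallCoef c' k)) :
    TopBd L k c c' β β' := by
  obtain ⟨ρ, C, hC, hρ⟩ := h.exists_top_split hk
  obtain ⟨ρ', C', hC', hρ'⟩ := h'.exists_top_split hk
  obtain ⟨M, hM⟩ := exists_integral_norm_le hv
  set v := expS (fallCoef c k)
  set v' := expS (fallCoef c' k)
  have hδ : 0 < |β - β'| := abs_pos.2 (sub_ne_zero.2 hne)
  set δ := |β - β'|
  set m := angleMeasure.real univ with hm
  refine ⟨_, hv'.norm_comb hv' (2 / δ * m) 0 (m * (2 + 2 / δ * (C + C')) + 2 / δ * M),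
    fun ζ hζ => ?_⟩
  have hvi : Integrable (fun θ : ℝ => ‖v (ζ + θ * Complex.I)‖) angleMeasure :=
    (integrable_of_continuous (continuous_expS_vert (h.decay.fallCoef k) hζ.1)).norm
  have hbound : ∀ θ ∈ angles, ‖kapSign β β' θ * famA c c' β β' k θ ζ * famW c c' β β' θ ζ‖
      ≤ (2 + 2 / δ * (C + C') + 2 / δ * ‖v' ζ‖) + 2 / δ * ‖v (ζ + θ * Complex.I)‖ := by
    intro θ hθ
    have hζθ : L < (ζ + θ * Complex.I).re := by simpa using hζ.1
    have e1 : ‖expS (dcoef c k) (ζ + θ * Complex.I)‖ ≤ ‖v (ζ + θ * Complex.I)‖ + C := by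
      rw [(hρ _ hζθ).1]
      exact (norm_add_le _ _).trans (add_le_add le_rfl (hρ _ hζθ).2.1)
    have e2 : ‖expS (dcoef c' k) ζ‖ ≤ ‖v' ζ‖ + C' := by
      rw [(hρ' _ hζ.1).1]
      exact (norm_add_le _ _).trans (add_le_add le_rfl (hρ' _ hζ.1).2.1)
    have e3 := norm_famA_le hβ hβ' hne e1 e2
    have e4 := norm_add_le (famA c c' β β' k θ ζ - Complex.exp ζ) (Complex.exp ζ)
    rw [sub_add_cancel] at e4
    have e5 := norm_exp_le_one hζ
    have e6 := h.nonneg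
    have e7 : ‖famA c c' β β' k θ ζ‖
        ≤ (‖v (ζ + θ * Complex.I)‖ + C + (‖v' ζ‖ + C')) / δ + 1 :=
      e4.trans (add_le_add e3 e5)
    rw [norm_mul, norm_mul]
    calc _ ≤ 1 * ((‖v (ζ + θ * Complex.I)‖ + C + (‖v' ζ‖ + C')) / δ + 1) * 2 := by
          gcongr
          · exact norm_kapSign_le θ
          · exact hP.norm_famW_le hL hθ (strip_left_subset hL hζ)
      _ = _ := by ring
  have hgi := (integrable_const (μ := angleMeasure)
    (2 + 2 / δ * (C + C') + 2 / δ * ‖v' ζ‖)).add (hvi.const_mul (2 / δ))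
  have hae := ae_mem_angles.mono hbound
  refine ⟨hgi.mono' (aestronglyMeasurable_top h.decay hL hζ k) hae, ?_⟩
  refine (norm_integral_le_of_norm_le hgi hae).trans ?_
  rw [Complex.norm_real, Real.norm_eq_abs]
  refine le_trans ?_ (le_abs_self _)
  have e8 : ∫ θ, (2 + 2 / δ * (C + C') + 2 / δ * ‖v' ζ‖ + 2 / δ * ‖v (ζ + θ * Complex.I)‖)
      ∂angleMeasure = m * (2 + 2 / δ * (C + C') + 2 / δ * ‖v' ζ‖)
        + 2 / δ * ∫ θ, ‖v (ζ + θ * Complex.I)‖ ∂angleMeasure := by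
    rw [integral_add (integrable_const _) (hvi.const_mul _), integral_const, integral_const_mul,
      smul_eq_mul]
  refine e8.le.trans ?_
  have := mul_le_mul_of_nonneg_left (hM ζ hζ) (by positivity : 0 ≤ 2 / δ)
  linarith

lemma norm_one_sub_exp_neg_le (k : ℕ) (θ : ℝ) :
    ‖1 - Complex.exp (-(k * (θ * Complex.I)))‖ ≤ k * |θ| := by
  have := norm_exp_I_sub_one_le (-(k * θ))
  rw [abs_neg, abs_mul, Nat.abs_cast, norm_sub_rev] at this
  refine le_trans (le_of_eq ?_) this
  congr 3
  push_cast
  ring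

/-- The limit of `famP c c β β θ ζ` as `θ → 0`. -/
def diagP (c : ℕ → ℝ) (β : ℝ) (ζ : ℂ) : ℂ :=
  (Complex.exp ζ + expS (dcoef c 1) ζ / β) * (Complex.exp (-ζ) + expS (dcoef c 1) (-ζ) / β)

lemma CoefBd.norm_diagP_sub_one_le (h : CoefBd L k B c) (hL : L < 0) (hk : 3 ≤ k) (hβ : 0 < β)
    (hB : 2 * B / β ≤ Real.exp L / 8) {ζ : ℂ} (hζ : ζ ∈ strip L (-L)) :
    ‖diagP c β ζ - 1‖ ≤ 1 / 2 := by
  have key : ∀ ζ : ℂ, L < ζ.re →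
      ‖Complex.exp ζ + expS (dcoef c 1) ζ / β - Complex.exp ζ‖ ≤ Real.exp L / 8 := by
    intro ζ hζ
    rw [add_sub_cancel_left, norm_div, Complex.norm_real, Real.norm_eq_abs, abs_of_pos hβ]
    refine le_trans ?_ hB
    have := h.norm_le (l := 1) (by omega) hζ
    have := h.nonneg
    gcongr
    linarith
  exact norm_mul_sub_one_le hL hζ (key ζ hζ.1) (key _ (neg_mem_strip hζ).1)

lemma CoefBd.norm_famA_sub_le (h : CoefBd L k B c) (hk : 3 ≤ k) (hβ : 0 < β) {θ : ℝ}
    (hθ : θ ∈ angles) {ζ : ℂ} (hζ : L < ζ.re) :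
    ‖famA c c β β 0 θ ζ - (Complex.exp ζ + expS (dcoef c 1) ζ / β)‖ ≤ 8 * B / β * |θ| := by
  have h0 : 0 < |θ| := abs_pos.2 hθ.2.2
  have h1 := le_norm_kap_self hβ hθ
  have h2 : 0 < β * |θ| / 2 := by positivity
  have hκ : kap β β θ ≠ 0 := norm_pos_iff.1 (h2.trans_le h1)
  have hβ0 : (β : ℂ) ≠ 0 := Complex.ofReal_ne_zero.2 hβ.ne'
  have h3 := h.taylor_le hk hζ θ
  have e : famA c c β β 0 θ ζ - (Complex.exp ζ + expS (dcoef c 1) ζ / β)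
      = (expS c (ζ + θ * Complex.I) - expS c ζ
        - expS (dcoef c 1) ζ * (Complex.exp (θ * Complex.I) - 1)) / kap β β θ := by
    have hx : Complex.exp (θ * Complex.I) - 1 ≠ 0 := by
      intro hx; rw [kap_self, hx, mul_zero] at hκ; exact hκ rfl
    rw [famA, dcoef_zero, kap_self]
    field_simp
    ring
  rw [e, norm_div]
  calc _ ≤ 4 * B * θ ^ 2 / (β * |θ| / 2) := div_le_div₀ ((norm_nonneg _).trans h3) h3 h2 h1
    _ = _ := by rw [← sq_abs θ]; field_simp; ring

/-- Freezing the inverse square root at `θ = 0` costs a factor `|θ|`, which cancels the singularity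
of the kernel. -/
lemma CoefBd.exists_norm_famW_sub_le (h : CoefBd L k B c) (hL : L < 0) (hk : 3 ≤ k) (hβ : 0 < β)
    (hB : 2 * B / β ≤ Real.exp L / 8) : ∃ K : ℝ, 0 ≤ K ∧ ∀ θ ∈ angles, ∀ ζ ∈ strip L 0,
      ‖famW c c β β θ ζ - diagP c β ζ ^ ((-(1 / 2) : ℝ) : ℂ)‖ ≤ K * |θ| := by
  have hP := h.pairBd_self hL hk hβ hB
  obtain ⟨M, hM⟩ := hP.uBdd_famB hL 0
  have hB0 := h.nonneg
  refine ⟨4 * (8 * B / β * |M| + (1 + B / β) * (8 * B / β)), by positivity, fun θ hθ ζ hζ => ?_⟩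
  have hζ' := strip_left_subset hL hζ
  refine (norm_cpow_neg_half_sub_le (hP.norm_famP_sub_one_le hL hθ hζ')
    (h.norm_diagP_sub_one_le hL hk hβ hB hζ')).trans ?_
  have hA := h.norm_famA_sub_le hk hβ hθ hζ.1
  have hA' := h.norm_famA_sub_le hk hβ (neg_mem_angles hθ) (neg_mem_strip hζ').1
  rw [abs_neg] at hA'
  have e : famP c c β β θ ζ - diagP c β ζ
      = (famA c c β β 0 θ ζ - (Complex.exp ζ + expS (dcoef c 1) ζ / β)) * famB c c β β 0 θ ζ
        + (Complex.exp ζ + expS (dcoef c 1) ζ / β)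
          * (famA c c β β 0 (-θ) (-ζ) - (Complex.exp (-ζ) + expS (dcoef c 1) (-ζ) / β)) := by
    simp only [famP, diagP, famB, pow_zero, one_mul]; ring
  have h1 : ‖Complex.exp ζ + expS (dcoef c 1) ζ / β‖ ≤ 1 + B / β := by
    refine (norm_add_le _ _).trans (add_le_add (norm_exp_le_one hζ) ?_)
    rw [norm_div, Complex.norm_real, Real.norm_eq_abs, abs_of_pos hβ]
    have := h.norm_le (l := 1) (by omega) hζ.1
    gcongr
  have h2 : ‖famB c c β β 0 θ ζ‖ ≤ |M| := (hM θ hθ ζ hζ).trans (le_abs_self M)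
  rw [e]
  calc _ ≤ 4 * (8 * B / β * |θ| * |M| + (1 + B / β) * (8 * B / β * |θ|)) := by
        gcongr
        refine (norm_add_le _ _).trans ?_
        rw [norm_mul, norm_mul]
        gcongr
    _ = _ := by ring

/-- On the diagonal, the kernel of the top derivative is, up to an integrable error, a multiple of
the kernel of the singular integral `logInt`, where `G` stands for `ζ ↦ f^{(k)}(e^ζ)`. -/
lemma CoefBd.topBd_self (h : CoefBd L k B c) (hL : L < 0) (hk : 3 ≤ k) (hβ : 0 < β)
    (hB : 2 * B / β ≤ Real.exp L / 8) (hv : UL2 L fun _ => expS (fallCoef c k)) {G : ℂ → ℂ}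
    (hG : ∀ ζ : ℂ, L < ζ.re → Complex.exp ζ ^ k * G ζ = expS (fallCoef c k) ζ)
    (hlog : UL2 L fun _ => logInt G) : TopBd L k c c β β := by
  have hP := h.pairBd_self hL hk hβ hB
  obtain ⟨ρ, C, hC, hρ⟩ := h.exists_top_split (by omega)
  obtain ⟨M, hM⟩ := exists_integral_norm_le hv
  obtain ⟨K, hK0, hK⟩ := h.exists_norm_famW_sub_le hL hk hβ hB
  set v := expS (fallCoef c k)
  set m := angleMeasure.real univ with hm
  set q := ∫ θ, angleWt θ ∂angleMeasure with hq
  -- constants in the bound of the error term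
  set a₁ : ℝ := 2 + K * Real.pi + 4 * C / β + 4 * C * K / β with ha₁
  set a₂ : ℝ := 2 * K / β + 4 * k / β with ha₂
  have ha₂0 : 0 ≤ a₂ := by positivity
  refine ⟨_, hlog.norm_comb hv (2 / β) (a₂ * m) (a₁ * q + a₂ * M), fun ζ hζ => ?_⟩
  have hζ' := strip_left_subset hL hζ
  -- The kernel is `Y * famW`. Its model is `Z * W₀`, with the inverse square root frozen at `θ = 0`
  -- and `z ^ k f^{(k)}` in place of the top derivative, the power of `z` being taken at the base
  -- point; the phase `e^{-ikθ}` achieves this. `E` is the error.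
  set W₀ := diagP c β ζ ^ ((-(1 / 2) : ℝ) : ℂ) with hW₀
  have hW₀le : ‖W₀‖ ≤ 2 := norm_cpow_neg_half_le (h.norm_diagP_sub_one_le hL hk hβ hB hζ')
  set Y : ℝ → ℂ := fun θ => kapSign β β θ * famA c c β β k θ ζ with hY
  set Z : ℝ → ℂ := fun θ => (Complex.exp (-(k * (θ * Complex.I))) * v (ζ + θ * Complex.I) - v ζ)
    / (‖kap β β θ‖ : ℂ) with hZ
  set E : ℝ → ℂ := fun θ => Y θ * famW c c β β θ ζ - Z θ * W₀ with hE
  have hvc : Continuous fun θ : ℝ => v (ζ + θ * Complex.I) :=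
    continuous_expS_vert (h.decay.fallCoef k) hζ.1
  have hvi : Integrable (fun θ : ℝ => ‖v (ζ + θ * Complex.I)‖) angleMeasure :=
    (integrable_of_continuous hvc).norm
  have hκ : ∀ θ ∈ angles, 0 < ‖kap β β θ‖ := fun θ hθ => by
    have h0 : 0 < |θ| := abs_pos.2 hθ.2.2
    exact (by positivity : 0 < β * |θ| / 2).trans_le (le_norm_kap_self hβ hθ)
  have hYeq : ∀ θ ∈ angles, Y θ = kapSign β β θ * Complex.exp ζ
      + (expS (dcoef c k) (ζ + θ * Complex.I) - expS (dcoef c k) ζ) / (‖kap β β θ‖ : ℂ) := by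
    intro θ hθ
    have h1 : (‖kap β β θ‖ : ℂ) ≠ 0 := Complex.ofReal_ne_zero.2 (hκ θ hθ).ne'
    have h2 : kap β β θ ≠ 0 := norm_pos_iff.1 (hκ θ hθ)
    simp only [hY, famA, kapSign]
    field_simp
  have hinv : ∀ θ ∈ angles, ∀ s : ℝ, 0 ≤ s → s / ‖kap β β θ‖ ≤ 2 / β * (s / |θ|) := by
    intro θ hθ s hs
    have h0 : 0 < |θ| := abs_pos.2 hθ.2.2
    calc s / ‖kap β β θ‖ ≤ s / (β * |θ| / 2) :=
          div_le_div_of_nonneg_left hs (by positivity) (le_norm_kap_self hβ hθ)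
      _ = _ := by field_simp
  have hYW : ∀ θ ∈ angles, ‖Y θ * (famW c c β β θ ζ - W₀)‖
      ≤ K * Real.pi + 4 * C * K / β
        + 2 * K / β * ‖v (ζ + θ * Complex.I)‖ + 2 * K / β * ‖v ζ‖ := by
    intro θ hθ
    have h0 : 0 < |θ| := abs_pos.2 hθ.2.2
    have hζθ : L < (ζ + θ * Complex.I).re := by simpa using hζ.1
    set s := ‖v (ζ + θ * Complex.I)‖ + ‖v ζ‖ + 2 * C with hs
    have h1 : ‖expS (dcoef c k) (ζ + θ * Complex.I) - expS (dcoef c k) ζ‖ ≤ s := by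
      rw [(hρ _ hζθ).1, (hρ _ hζ.1).1]
      refine (norm_sub_le _ _).trans ?_
      have := norm_add_le (v (ζ + θ * Complex.I)) (ρ (ζ + θ * Complex.I))
      have := norm_add_le (v ζ) (ρ ζ)
      have := (hρ _ hζθ).2.1
      have := (hρ _ hζ.1).2.1
      rw [hs]
      linarith
    have hs0 : 0 ≤ s := (norm_nonneg _).trans h1
    have h2 : ‖Y θ‖ ≤ 1 + 2 / β * (s / |θ|) := by
      rw [hYeq θ hθ]
      refine (norm_add_le _ _).trans (add_le_add ?_ ?_)
      · rw [norm_mul]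
        exact mul_le_one₀ (norm_kapSign_le θ) (norm_nonneg _) (norm_exp_le_one hζ)
      · rw [norm_div, Complex.norm_real, norm_norm]
        refine le_trans ?_ (hinv θ hθ s hs0)
        gcongr
    rw [norm_mul]
    calc _ ≤ (1 + 2 / β * (s / |θ|)) * (K * |θ|) := by
          gcongr
          exact hK θ hθ ζ hζ
      _ = K * |θ| + 2 * K / β * s := by field_simp
      _ ≤ K * Real.pi + 2 * K / β * s := by
          gcongr
          exact (abs_le_pi_of_mem_angles hθ)
      _ = _ := by rw [hs]; ring
  have hYZ : ∀ θ ∈ angles, ‖Y θ - Z θ‖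
      ≤ 1 + 2 * C / β * angleWt θ + 2 * k / β * ‖v (ζ + θ * Complex.I)‖ := by
    intro θ hθ
    have h0 : 0 < |θ| := abs_pos.2 hθ.2.2
    have hζθ : L < (ζ + θ * Complex.I).re := by simpa using hζ.1
    have e1 : Y θ - Z θ = kapSign β β θ * Complex.exp ζ
        + ((1 - Complex.exp (-(k * (θ * Complex.I)))) * v (ζ + θ * Complex.I)
          + (ρ (ζ + θ * Complex.I) - ρ ζ)) / (‖kap β β θ‖ : ℂ) := by
      rw [hYeq θ hθ, (hρ _ hζθ).1, (hρ _ hζ.1).1]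
      simp only [hZ]
      ring
    set s := k * |θ| * ‖v (ζ + θ * Complex.I)‖ + C * |θ| ^ (1 / 4 : ℝ) with hs
    have h1 : ‖(1 - Complex.exp (-(k * (θ * Complex.I)))) * v (ζ + θ * Complex.I)
          + (ρ (ζ + θ * Complex.I) - ρ ζ)‖ ≤ s := by
      refine (norm_add_le _ _).trans (add_le_add ?_ ((hρ _ hζ.1).2.2 θ))
      rw [norm_mul]
      gcongr
      exact norm_one_sub_exp_neg_le k θ
    rw [e1]
    refine (norm_add_le _ _).trans ?_
    rw [add_assoc]
    refine add_le_add ?_ ?_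
    · rw [norm_mul]
      exact mul_le_one₀ (norm_kapSign_le θ) (norm_nonneg _) (norm_exp_le_one hζ)
    · rw [norm_div, Complex.norm_real, norm_norm]
      calc _ ≤ s / ‖kap β β θ‖ := by gcongr
        _ ≤ 2 / β * (s / |θ|) := hinv θ hθ s ((norm_nonneg _).trans h1)
        _ = 2 * k / β * ‖v (ζ + θ * Complex.I)‖
            + 2 * C / β * (|θ| ^ (1 / 4 : ℝ) / |θ|) := by rw [hs]; field_simp
        _ ≤ 2 * k / β * ‖v (ζ + θ * Complex.I)‖ + 2 * C / β * angleWt θ := by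
            rw [rpow_quarter_div hθ.2.2, angleWt]
            gcongr
            linarith
        _ = _ := by ring
  have hEle : ∀ θ ∈ angles, ‖E θ‖
      ≤ (a₁ * angleWt θ + a₂ * ‖v (ζ + θ * Complex.I)‖) + a₂ * ‖v ζ‖ := by
    intro θ hθ
    have e1 : E θ = Y θ * (famW c c β β θ ζ - W₀) + (Y θ - Z θ) * W₀ := by simp only [hE]; ring
    have h1 := hYW θ hθ
    have h2 : ‖(Y θ - Z θ) * W₀‖
        ≤ (1 + 2 * C / β * angleWt θ + 2 * k / β * ‖v (ζ + θ * Complex.I)‖) * 2 := by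
      rw [norm_mul]
      have := hYZ θ hθ
      have := (norm_nonneg _).trans this
      gcongr
    rw [e1]
    refine (norm_add_le _ _).trans ((add_le_add h1 h2).trans ?_)
    have hw := one_le_angleWt θ
    have h3 : K * Real.pi + 4 * C * K / β + 2
        ≤ (K * Real.pi + 4 * C * K / β + 2) * angleWt θ :=
      le_mul_of_one_le_right (by positivity) hw
    have h4 : 0 ≤ 4 * k / β * ‖v ζ‖ := by positivity
    have e2 : (a₁ * angleWt θ + a₂ * ‖v (ζ + θ * Complex.I)‖) + a₂ * ‖v ζ‖
        = (K * Real.pi + 4 * C * K / β + 2) * angleWt θ + 4 * C / β * angleWt θ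
          + (2 * K / β + 4 * k / β) * ‖v (ζ + θ * Complex.I)‖
          + 2 * K / β * ‖v ζ‖ + 4 * k / β * ‖v ζ‖ := by
      rw [ha₁, ha₂]; ring
    rw [e2]
    have e3 : (1 + 2 * C / β * angleWt θ + 2 * k / β * ‖v (ζ + θ * Complex.I)‖) * 2
      = 2 + 4 * C / β * angleWt θ + 4 * k / β * ‖v (ζ + θ * Complex.I)‖ := by ring
    rw [e3]
    linarith
  have hgi : Integrable (fun θ => (a₁ * angleWt θ + a₂ * ‖v (ζ + θ * Complex.I)‖) + a₂ * ‖v ζ‖)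
      angleMeasure :=
    ((integrable_angleWt.const_mul a₁).add (hvi.const_mul a₂)).add (integrable_const _)
  have hmYW : AEStronglyMeasurable (fun θ => Y θ * famW c c β β θ ζ) angleMeasure :=
    aestronglyMeasurable_top h.decay hL hζ k
  have hmE : AEStronglyMeasurable E angleMeasure := by
    refine hmYW.sub (Measurable.aestronglyMeasurable ?_)
    refine Measurable.mul_const (Measurable.div ?_ ?_) _
    · exact (((by fun_prop : Continuous fun θ : ℝ => Complex.exp (-(k * (θ * Complex.I)))).mul
        hvc).sub continuous_const).measurable
    · have : Continuous fun θ : ℝ => (‖kap β β θ‖ : ℂ) := by unfold kap; fun_prop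
      exact this.measurable
  have hEi : Integrable E angleMeasure := hgi.mono' hmE (ae_mem_angles.mono hEle)
  -- absolute integrability comes from a Lipschitz bound that degenerates as `Re ζ → L`
  have hYWi : Integrable (fun θ => Y θ * famW c c β β θ ζ) angleMeasure := by
    obtain ⟨N, hN, hNb⟩ := h.decay.exists_bound hζ.1 k
    refine (integrable_const ((1 + 2 * N / β) * 2)).mono' hmYW (ae_mem_angles.mono fun θ hθ => ?_)
    have h1 := norm_famA_self_le hβ hθ ((hNb ζ le_rfl).2 θ)
    have h2 := norm_add_le (famA c c β β k θ ζ - Complex.exp ζ) (Complex.exp ζ)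
    rw [sub_add_cancel] at h2
    have h3 : ‖famA c c β β k θ ζ‖ ≤ 1 + 2 * N / β := by
      linarith [norm_exp_le_one hζ]
    rw [norm_mul, norm_mul]
    calc _ ≤ 1 * (1 + 2 * N / β) * 2 := by
          gcongr
          · exact norm_kapSign_le θ
          · exact hP.norm_famW_le hL hθ hζ'
      _ = _ := by ring
  refine ⟨hYWi, ?_⟩
  have hZi : Integrable (fun θ => Z θ * W₀) angleMeasure := by
    refine (hYWi.sub hEi).congr (Eventually.of_forall fun θ => ?_)
    simp only [hE, Pi.sub_apply]
    ring
  have hsplit : ∫ θ, Y θ * famW c c β β θ ζ ∂angleMeasure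
      = (∫ θ, Z θ * W₀ ∂angleMeasure) + ∫ θ, E θ ∂angleMeasure := by
    rw [← integral_add hZi hEi]
    congr 1
    ext θ
    simp only [hE]
    ring
  have hZint : ∫ θ, Z θ * W₀ ∂angleMeasure = Complex.exp ζ ^ k / β * W₀ * logInt G ζ := by
    rw [logInt, ← integral_const_mul]
    congr 1
    ext θ
    have hβ0 : (β : ℂ) ≠ 0 := Complex.ofReal_ne_zero.2 hβ.ne'
    have hζθ : L < (ζ + θ * Complex.I).re := by simpa using hζ.1
    have e1 : Complex.exp (-(k * (θ * Complex.I))) * v (ζ + θ * Complex.I)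
        = Complex.exp ζ ^ k * G (ζ + θ * Complex.I) := by
      rw [← hG _ hζθ, Complex.exp_add, mul_pow, ← Complex.exp_nat_mul (θ * Complex.I), ← mul_assoc,
        mul_left_comm, ← Complex.exp_add, neg_add_cancel, Complex.exp_zero, mul_one]
    simp only [hZ]
    rw [e1, ← hG ζ hζ.1, norm_kap_self hβ, Complex.ofReal_mul, ← mul_sub]
    ring
  have h1 : ‖∫ θ, E θ ∂angleMeasure‖ ≤ a₁ * q + a₂ * M + m * (a₂ * ‖v ζ‖) := by
    refine (norm_integral_le_of_norm_le hgi (ae_mem_angles.mono hEle)).trans ?_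
    have e8 : ∫ θ, ((a₁ * angleWt θ + a₂ * ‖v (ζ + θ * Complex.I)‖) + a₂ * ‖v ζ‖) ∂angleMeasure
        = a₁ * q + a₂ * (∫ θ, ‖v (ζ + θ * Complex.I)‖ ∂angleMeasure) + m * (a₂ * ‖v ζ‖) := by
      have h3 := (integrable_angleWt.const_mul a₁).add (hvi.const_mul a₂)
      have h4 := integral_add h3 (integrable_const (a₂ * ‖v ζ‖))
      have h5 := integral_add (integrable_angleWt.const_mul a₁) (hvi.const_mul a₂)
      simp only [Pi.add_apply] at h4
      rw [h4, h5, integral_const, integral_const_mul, integral_const_mul, smul_eq_mul]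
    rw [e8]
    have := mul_le_mul_of_nonneg_left (hM ζ hζ) ha₂0
    linarith
  have h2 : ‖Complex.exp ζ ^ k / β * W₀ * logInt G ζ‖ ≤ 2 / β * ‖logInt G ζ‖ := by
    rw [norm_mul, norm_mul, norm_div, norm_pow, Complex.norm_real, Real.norm_eq_abs, abs_of_pos hβ]
    calc _ ≤ 1 / β * 2 * ‖logInt G ζ‖ := by
          gcongr
          exact pow_le_one₀ (norm_nonneg _) (norm_exp_le_one hζ)
      _ = _ := by ring
  rw [Complex.norm_real, Real.norm_eq_abs]
  refine le_trans ?_ (le_abs_self _)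
  have h3 : ‖∫ θ, Y θ * famW c c β β θ ζ ∂angleMeasure‖
      ≤ 2 / β * ‖logInt G ζ‖ + (a₁ * q + a₂ * M + m * (a₂ * ‖v ζ‖)) := by
    rw [hsplit, hZint]
    exact (norm_add_le _ _).trans (add_le_add h2 h1)
  refine h3.trans (le_of_eq ?_)
  ring

/-! ### Regularity of the extension -/

lemma Tower.zero {ι : Type*} {U : Set ℂ} {I : Set ι} {Q : (ι → ℂ → ℂ) → Prop} (hQ : IsTop U I Q)
    (n : ℕ) : Tower U I Q n fun _ _ => 0 :=
  Tower.of_seq (a := fun _ _ _ => 0) (fun _ _ _ _ z _ => hasDerivAt_const z 0)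
    (fun _ _ => ⟨0, fun _ _ _ _ => by simp⟩)
    (hQ.of_bdd _ ⟨0, fun _ _ _ _ => by simp⟩ fun _ _ => differentiableOn_const _)

lemma RegL2.const_mul {n : ℕ} {a : ℂ → ℂ} (ha : RegL2 L n a) (s : ℂ) :
    RegL2 L n fun z => s * a z :=
  Tower.const_mul (isTop_UL2 L) (fun _ => s) ⟨_, fun _ _ => le_rfl⟩ ha

lemma PairBd.regL2_extS (hP : PairBd L k c c' β β') (hL : L < 0) (hk : 3 ≤ k)
    (hT : TopBd L k c c' β β') : RegL2 L (k - 1) (extS c c' β β') := by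
  obtain ⟨D, hD, hDb⟩ := hT
  have hQ := isTop_QWt (strip L 0)
  have hW := hP.tower_famW hL hk
  rw [show k - 1 = k - 2 + 1 by omega] at hW
  have hpi0 : (2 * Real.pi : ℂ) ≠ 0 := by
    simp [Real.pi_ne_zero]
  refine RegL2.const_mul ?_ _
  have := regL2_integral (L := L) (n := k - 1) (N := k - 2) (by omega) (by omega)
    (X := fun l θ ζ => kapSign β β' θ * famA c c' β β' (l + 1) θ ζ) hW
    (fun l _ θ _ z hz => (hasDerivAt_famA hP.decay hP.decay' (l + 1) θ hz.1).const_mul _)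
    (fun l hl => ?_) (Tower.zero hQ _) (fun z hz => ?_) hD (fun z hz => ?_) ?_
  · simpa only [add_zero, zero_add] using this
  · have := (hP.tower_famA hL hk (l := l + 1) (by omega)).const_mul hQ (kapSign β β')
      ⟨1, fun θ _ => norm_kapSign_le θ⟩
    rwa [show k - 1 - (l + 1) = k - 1 - 1 - l by omega] at this
  · simpa using aestronglyMeasurable_top hP.decay hL hz 1
  · simpa only [show k - 1 + 1 = k by omega] using hDb z hz
  · have h1 := ((hP.differentiableOn_extS hL hk).continuousOn.mono
      (strip_left_subset hL)).const_smul (2 * Real.pi : ℂ)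
    refine h1.congr fun z _ => ?_
    simp only [Pi.smul_apply, extS, smul_eq_mul, mul_inv_cancel_left₀ hpi0, add_zero, zero_add]

/-- On the reflected side `Re (-ζ) > 0`, away from the boundary line, all derivatives of the curves
are bounded and the top order needs no special estimate. -/
lemma PairBd.regL2_extS_neg (hP : PairBd L k c c' β β') (hL : L < 0) (hk : 3 ≤ k) :
    RegL2 L (k - 1) fun ζ => extS c c' β β' (-ζ) := by
  have hQ := isTop_QWt (strip L 0)
  have hW := hP.tower_famW hL hk
  rw [show k - 1 = k - 2 + 1 by omega] at hW
  have hpi0 : (2 * Real.pi : ℂ) ≠ 0 := by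
    simp [Real.pi_ne_zero]
  obtain ⟨C, hC⟩ := hP.uBdd_famB hL k
  have hb : ∀ θ ∈ angles, ∀ z ∈ strip L 0,
      ‖-kapSign β β' (-θ) * famB c c' β β' k θ z * famW c c' β β' θ z‖ ≤ 1 * C * 2 := by
    intro θ hθ z hz
    have h1 := hC θ hθ z hz
    have h2 := (norm_nonneg _).trans h1
    rw [norm_mul, norm_mul, norm_neg]
    gcongr
    · exact norm_kapSign_le _
    · exact hP.norm_famW_le hL hθ (strip_left_subset hL hz)
  have hmeas : ∀ l, ∀ z ∈ strip L 0, AEStronglyMeasurable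
      (fun θ => -kapSign β β' (-θ) * famB c c' β β' l θ z * famW c c' β β' θ z) angleMeasure :=
    fun l z hz => (((measurable_kapSign.comp measurable_neg).neg.mul
      (measurable_famB hP.decay l (strip_left_subset hL hz).2)).mul
      (measurable_famW hP.decay (strip_left_subset hL hz))).aestronglyMeasurable
  simp only [extS_neg]
  refine RegL2.const_mul ?_ _
  have hD : UL2 L fun _ _ => ((∫ _, 1 * C * 2 ∂angleMeasure : ℝ) : ℂ) :=
    (isTop_UL2 L).of_bdd _ ⟨_, fun _ _ _ _ => le_rfl⟩ fun _ _ => differentiableOn_const _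
  have := regL2_integral (L := L) (n := k - 1) (N := k - 2) (by omega) (by omega)
    (X := fun l θ ζ => -kapSign β β' (-θ) * famB c c' β β' (l + 1) θ ζ) hW
    (fun l _ θ _ z hz =>
      (hasDerivAt_famB hP.decay hP.decay' (l + 1) θ (strip_left_subset hL hz).2).const_mul _)
    (fun l hl => (hP.tower_famB hL (l + 1) _).const_mul hQ (fun θ => -kapSign β β' (-θ))
      ⟨1, fun θ _ => by rw [norm_neg]; exact norm_kapSign_le _⟩)
    (Tower.zero hQ _) (fun z hz => by simpa using hmeas 1 z hz) hD (fun z hz => ?_) ?_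
  · simpa only [add_zero, zero_add] using this
  · rw [show k - 1 + 1 = k by omega]
    have hae : ∀ᵐ θ ∂angleMeasure,
        ‖-kapSign β β' (-θ) * famB c c' β β' k θ z * famW c c' β β' θ z‖ ≤ 1 * C * 2 :=
      ae_mem_angles.mono fun θ hθ => hb θ hθ z hz
    refine ⟨(integrable_const _).mono' (hmeas k z hz) hae, ?_⟩
    rw [Complex.norm_real]
    exact (norm_integral_le_of_norm_le (integrable_const _) hae).trans (le_abs_self _)
  · have h0 : ContinuousOn (fun ζ => extS c c' β β' (-ζ)) (strip L 0) :=
      (hP.differentiableOn_extS hL hk).continuousOn.comp continuous_neg.continuousOn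
        fun z hz => neg_mem_strip (strip_left_subset hL hz)
    refine (h0.const_smul (2 * Real.pi : ℂ)).congr fun z _ => ?_
    simp only [Pi.smul_apply, extS_neg, smul_eq_mul, mul_inv_cancel_left₀ hpi0, add_zero, zero_add]

end Pair

/-! ### The kernel on the unit circle -/

/-- The values on the unit circle of `Φ(z) = β z + f(z)` and of `z Φ'(z)` in the coordinate
`z = e^{is}`, where `c` are the coefficients of `f`. -/
structure CircleData (Φ : ℂ → ℂ) (c : ℕ → ℝ) (β : ℝ) : Prop where
  val : ∀ s : ℝ, Φ (Complex.exp (s * Complex.I))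
    = β * Complex.exp (s * Complex.I) + expS c (s * Complex.I)
  der : ∀ s : ℝ, Complex.exp (s * Complex.I) * deriv Φ (Complex.exp (s * Complex.I))
    = β * Complex.exp (s * Complex.I) + expS (dcoef c 1) (s * Complex.I)

section Circle

variable {c c' : ℕ → ℝ} {β β' L : ℝ} {k : ℕ} {Φ Ψ : ℂ → ℂ}

lemma circleMap_eq_exp (s : ℝ) : circleMap 0 1 s = Complex.exp (s * Complex.I) := by
  simp [circleMap]

lemma famA_mul_kap {l : ℕ} {θ : ℝ} (hκ : kap β β' θ ≠ 0) (t : ℝ) :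
    famA c c' β β' l θ (t * Complex.I) * kap β β' θ
      = (β * Complex.exp (((t + θ : ℝ) : ℂ) * Complex.I)
          + expS (dcoef c l) (((t + θ : ℝ) : ℂ) * Complex.I))
        - (β' * Complex.exp (t * Complex.I) + expS (dcoef c' l) (t * Complex.I)) := by
  have e : ((t + θ : ℝ) : ℂ) * Complex.I = t * Complex.I + θ * Complex.I := by push_cast; ring
  rw [famA, add_mul, div_mul_cancel₀ _ hκ, e, Complex.exp_add, kap]
  ring

lemma axis_mem_strip (hL : L < 0) (t : ℝ) : (t * Complex.I : ℂ) ∈ strip L (-L) := by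
  have := (mem_strip_line (a := L) (b := -L) (ξ := 0) t).2 ⟨hL, by linarith⟩
  simpa using this

lemma famA_zero_ne_zero (hL : L < 0) {θ t : ℝ}
    (h : ‖famA c c' β β' 0 θ (t * Complex.I) - Complex.exp (t * Complex.I)‖ ≤ Real.exp L / 8) :
    famA c c' β β' 0 θ (t * Complex.I) ≠ 0 := by
  intro h0
  rw [h0, zero_sub, norm_neg, Complex.norm_exp_ofReal_mul_I] at h
  have := Real.exp_le_one_iff.2 hL.le
  linarith

lemma CircleData.sub_eq (hΦ : CircleData Φ c β) (hΨ : CircleData Ψ c' β') {θ : ℝ}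
    (hκ : kap β β' θ ≠ 0) (t : ℝ) :
    Φ (Complex.exp (((t + θ : ℝ) : ℂ) * Complex.I)) - Ψ (Complex.exp (t * Complex.I))
      = famA c c' β β' 0 θ (t * Complex.I) * kap β β' θ := by
  rw [famA_mul_kap hκ, hΦ.val, hΨ.val, dcoef_zero, dcoef_zero]

lemma famA_conj (l : ℕ) (θ : ℝ) (ζ : ℂ) :
    famA c c' β β' l (-θ) ((starRingEnd ℂ) ζ) = (starRingEnd ℂ) (famA c c' β β' l θ ζ) := by
  have e : (starRingEnd ℂ) ζ + ((-θ : ℝ) : ℂ) * Complex.I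
      = (starRingEnd ℂ) (ζ + θ * Complex.I) := by simp
  have e2 : kap β β' (-θ) = (starRingEnd ℂ) (kap β β' θ) := by
    simp [kap, ← Complex.exp_conj]
  rw [famA, famA, e, expS_conj, expS_conj, e2, map_add, map_div₀, map_sub, ← Complex.exp_conj]

lemma neg_axis (t : ℝ) : -(t * Complex.I : ℂ) = (starRingEnd ℂ) (t * Complex.I) := by simp

lemma famP_axis (θ t : ℝ) : famP c c' β β' θ (t * Complex.I)
    = ((‖famA c c' β β' 0 θ (t * Complex.I)‖ ^ 2 : ℝ) : ℂ) := by
  rw [famP, famB, pow_zero, one_mul, neg_axis, famA_conj, Complex.mul_conj']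
  push_cast
  rfl

lemma famW_axis (θ t : ℝ) : famW c c' β β' θ (t * Complex.I)
    = ((‖famA c c' β β' 0 θ (t * Complex.I)‖⁻¹ : ℝ) : ℂ) := by
  rw [famW, famP_axis, ← Complex.ofReal_cpow (by positivity), ← Real.rpow_natCast,
    ← Real.rpow_mul (norm_nonneg _)]
  norm_num
  rw [Real.rpow_neg_one]
  push_cast
  rfl

/-- On the circle, `κ` can be taken out of the numerator and out of the modulus in the denominator. -/
lemma kernelS_eq (hΦ : CircleData Φ c β) (hΨ : CircleData Ψ c' β') {θ : ℝ}
    (hκ : kap β β' θ ≠ 0) (t : ℝ) :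
    kernelS Φ Ψ (Complex.exp (t * Complex.I)) (Complex.exp (((t + θ : ℝ) : ℂ) * Complex.I))
      = kapSign β β' θ * famA c c' β β' 1 θ (t * Complex.I) * famW c c' β β' θ (t * Complex.I)
        / Complex.exp (((t + θ : ℝ) : ℂ) * Complex.I) := by
  rw [kernelS, hΦ.der, hΨ.der, ← famA_mul_kap hκ, hΦ.sub_eq hΨ hκ, norm_mul, famW_axis, kapSign]
  push_cast
  congr 1
  rw [div_eq_mul_inv, mul_inv]
  ring

lemma PairBd.conformal_ne (hP : PairBd L k c c' β β') (hL : L < 0) (hΦ : CircleData Φ c β)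
    (hΨ : CircleData Ψ c' β') {θ : ℝ} (hθ : θ ∈ angles) (hκ : kap β β' θ ≠ 0) (t : ℝ) :
    Φ (Complex.exp (((t + θ : ℝ) : ℂ) * Complex.I)) ≠ Ψ (Complex.exp (t * Complex.I)) := by
  rw [← sub_ne_zero, hΦ.sub_eq hΨ hκ]
  exact mul_ne_zero (famA_zero_ne_zero hL (hP.small θ hθ _ (axis_mem_strip hL t).1)) hκ

lemma PairBd.circleIntegrable_kernelS (hP : PairBd L k c c' β β') (hL : L < 0) (hk : 3 ≤ k)
    (hΦ : CircleData Φ c β) (hΨ : CircleData Ψ c' β') (hκ : ∀ θ ∈ angles, kap β β' θ ≠ 0) (t : ℝ) :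
    CircleIntegrable (kernelS Φ Ψ (Complex.exp (t * Complex.I))) 0 1 := by
  set p : ℝ → ℂ := fun s => kernelS Φ Ψ (Complex.exp (t * Complex.I)) (circleMap 0 1 s) with hp
  have hper : Function.Periodic p (2 * Real.pi) := fun s => by
    simp only [hp, circleMap_periodic s]
  have hpi : -Real.pi ≤ Real.pi := by linarith [Real.pi_pos]
  have hax := axis_mem_strip hL t
  obtain ⟨C, hC⟩ := hP.uBdd_famA (l := 1) (by omega)
  have h1 : Integrable (fun θ => p (t + θ)) angleMeasure := by
    have hint : Integrable (fun θ : ℝ => kapSign β β' θ * famA c c' β β' 1 θ (t * Complex.I)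
        * famW c c' β β' θ (t * Complex.I) / Complex.exp (((t + θ : ℝ) : ℂ) * Complex.I))
        angleMeasure := by
      refine (integrable_const (1 * C * 2)).mono' (Measurable.aestronglyMeasurable ?_)
        (ae_mem_angles.mono fun θ hθ => ?_)
      · exact ((measurable_kapSign.mul (measurable_famA hP.decay 1 hax.1)).mul
          (measurable_famW hP.decay hax)).div (Continuous.measurable (by fun_prop))
      · have h1 := hC θ hθ _ hax
        have h2 := (norm_nonneg _).trans h1
        rw [norm_div, Complex.norm_exp_ofReal_mul_I, div_one, norm_mul, norm_mul]
        gcongr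
        · exact norm_kapSign_le θ
        · exact hP.norm_famW_le hL hθ hax
    refine hint.congr (ae_mem_angles.mono fun θ hθ => ?_)
    simp only [hp]
    rw [circleMap_eq_exp, kernelS_eq hΦ hΨ (hκ θ hθ)]
  have h2 : IntervalIntegrable (fun θ => p (t + θ)) volume (-Real.pi) Real.pi :=
    (intervalIntegrable_iff_integrableOn_Ioc_of_le hpi).2 h1
  have h3 := h2.comp_add_left (-t)
  simp only [add_neg_cancel_left, sub_neg_eq_add] at h3
  exact hper.intervalIntegrable Real.two_pi_pos.ne' (t := -Real.pi + t)
    (by convert h3 using 1; ring) 0 (2 * Real.pi)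

lemma S_eq_extS (hΦ : CircleData Φ c β) (hΨ : CircleData Ψ c' β')
    (hκ : ∀ θ ∈ angles, kap β β' θ ≠ 0) (t : ℝ) :
    S Φ Ψ (Complex.exp (t * Complex.I)) = extS c c' β β' (t * Complex.I) := by
  have h1 := circleIntegral_div (fun τ => (τ * deriv Φ τ
    - Complex.exp (t * Complex.I) * deriv Ψ (Complex.exp (t * Complex.I)))
      / (‖Φ τ - Ψ (Complex.exp (t * Complex.I))‖ : ℂ)) t
  have hpi0 : (Real.pi : ℂ) ≠ 0 := Complex.ofReal_ne_zero.2 Real.pi_ne_zero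
  simp only [S, kernelS]
  rw [h1, extS, ← mul_assoc]
  congr 1
  · field_simp
  · refine integral_congr_ae (ae_mem_angles.mono fun θ hθ => ?_)
    have h2 := kernelS_eq hΦ hΨ (hκ θ hθ) t
    rw [kernelS, div_left_inj' (Complex.exp_ne_zero _)] at h2
    simp only [circleMap_eq_exp]
    exact h2

lemma PairBd.extS_conj (hP : PairBd L k c c' β β') (hL : L < 0) {ζ : ℂ} (hζ : ζ ∈ strip L (-L)) :
    extS c c' β β' ((starRingEnd ℂ) ζ) = (starRingEnd ℂ) (extS c c' β β' ζ) := by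
  have hpi : -Real.pi ≤ Real.pi := by linarith [Real.pi_pos]
  have h1 : ∫ θ, kapSign β β' θ * famA c c' β β' 1 θ ((starRingEnd ℂ) ζ)
        * famW c c' β β' θ ((starRingEnd ℂ) ζ) ∂angleMeasure
      = ∫ θ, kapSign β β' (-θ) * famA c c' β β' 1 (-θ) ((starRingEnd ℂ) ζ)
        * famW c c' β β' (-θ) ((starRingEnd ℂ) ζ) ∂angleMeasure := by
    simp only [angleMeasure]
    rw [← intervalIntegral.integral_of_le hpi, ← intervalIntegral.integral_of_le hpi]
    have h1 := intervalIntegral.integral_comp_neg (a := -Real.pi) (b := Real.pi)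
      (fun θ => kapSign β β' θ * famA c c' β β' 1 θ ((starRingEnd ℂ) ζ)
        * famW c c' β β' θ ((starRingEnd ℂ) ζ))
    rw [neg_neg] at h1
    exact h1.symm
  rw [extS, extS, h1, map_mul, ← integral_conj]
  congr 1
  · simp [Complex.conj_ofNat]
  · refine integral_congr_ae (ae_mem_angles.mono fun θ hθ => ?_)
    have e2 : kap β β' (-θ) = (starRingEnd ℂ) (kap β β' θ) := by
      simp [kap, ← Complex.exp_conj]
    have e3 : famP c c' β β' (-θ) ((starRingEnd ℂ) ζ) = (starRingEnd ℂ) (famP c c' β β' θ ζ) := by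
      have := famA_conj (c := c) (c' := c') (β := β) (β' := β') 0 (-θ) (-ζ)
      simp only [famP, famB, pow_zero, one_mul, map_mul]
      rw [famA_conj, ← this, map_neg]
    have e4 : famW c c' β β' (-θ) ((starRingEnd ℂ) ζ) = (starRingEnd ℂ) (famW c c' β β' θ ζ) := by
      have hs := mem_slitPlane_of_norm_sub_one_le (hP.norm_famP_sub_one_le hL hθ hζ)
      rw [famW, famW, e3, Complex.conj_cpow _ _ (Complex.slitPlane_arg_ne_pi hs),
        Complex.conj_ofReal]
    simp only
    rw [famA_conj, e4, kapSign, e2, map_mul, map_mul, kapSign, map_div₀, Complex.conj_ofReal,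
      Complex.norm_conj]

end Circle

/-! ### Regularity of the boundary curves -/

section Curves

variable {c : ℕ → ℝ} {L B : ℝ} {k : ℕ}

lemma RegL2.add {n : ℕ} {a b : ℂ → ℂ} (ha : RegL2 L n a) (hb : RegL2 L n b) :
    RegL2 L n fun z => a z + b z :=
  Tower.add (isTop_UL2 L) ha hb

lemma RegL2.mul {n : ℕ} (hn : 1 ≤ n) {a b : ℂ → ℂ} (ha : RegL2 L n a) (hb : RegL2 L n b) :
    RegL2 L n fun z => a z * b z :=
  Tower.mul (isTop_UL2 L) le_rfl hn ha hb

lemma regL2_of_seq {n : ℕ} {a : ℕ → ℂ → ℂ}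
    (hd : ∀ l < n, ∀ z ∈ strip L 0, HasDerivAt (a l) (a (l + 1) z) z)
    (hb : ∀ l < n, ∃ C : ℝ, ∀ z ∈ strip L 0, ‖a l z‖ ≤ C) (ht : UL2 L fun _ => a n) :
    RegL2 L n (a 0) :=
  Tower.of_seq (a := fun l (_ : Unit) => a l) (fun l hl _ _ => hd l hl)
    (fun l hl => (hb l hl).imp fun _ h _ _ => h) ht

lemma regL2_of_seq_bdd {n : ℕ} {a : ℕ → ℂ → ℂ}
    (hd : ∀ l, ∀ z ∈ strip L 0, HasDerivAt (a l) (a (l + 1) z) z)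
    (hb : ∀ l ≤ n, ∃ C : ℝ, ∀ z ∈ strip L 0, ‖a l z‖ ≤ C) : RegL2 L n (a 0) :=
  regL2_of_seq (fun l _ => hd l) (fun l hl => hb l hl.le)
    ((isTop_UL2 L).of_bdd _ ((hb n le_rfl).imp fun _ h _ _ => h)
      fun _ _ z hz => (hd n z hz).differentiableAt.differentiableWithinAt)

lemma regL2_exp (n : ℕ) : RegL2 L n Complex.exp :=
  regL2_of_seq_bdd (a := fun _ => Complex.exp) (fun _ z _ => Complex.hasDerivAt_exp z)
    fun _ _ => ⟨1, fun _ hz => norm_exp_le_one hz⟩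

lemma regL2_exp_neg (hL : L < 0) (n : ℕ) : RegL2 L n fun ζ => Complex.exp (-ζ) := by
  have := regL2_of_seq_bdd (L := L) (n := n) (a := fun l ζ => (-1) ^ l * Complex.exp (-ζ))
    (fun l z _ => ?_) fun l _ => ⟨Real.exp (-L), fun z hz => ?_⟩
  · simpa using this
  · refine (((hasDerivAt_neg z).cexp).const_mul ((-1) ^ l)).congr_deriv ?_
    rw [pow_succ]; ring
  · rw [norm_mul, norm_pow, norm_neg, norm_one, one_pow, one_mul]
    exact norm_exp_le_of_mem_strip (neg_mem_strip (strip_left_subset hL hz))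

lemma regL2_expS_neg {d : ℕ → ℝ} (hd : Decay L d) (hL : L < 0) (n : ℕ) :
    RegL2 L n fun ζ => expS d (-ζ) := by
  have := regL2_of_seq_bdd (L := L) (n := n) (a := fun l ζ => (-1) ^ l * expS (dcoef d l) (-ζ))
    (fun l z hz => ?_) fun l _ => ?_
  · simpa [dcoef_zero] using this
  · have h1 := (hasDerivAt_expS_dcoef hd l (ζ := -z)
      (neg_mem_strip (strip_left_subset hL hz)).1).scomp z (hasDerivAt_neg z)
    refine (h1.const_mul ((-1) ^ l)).congr_deriv ?_
    rw [pow_succ, smul_eq_mul]; ring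
  · obtain ⟨C, -, hC⟩ := hd.exists_bound hL l
    refine ⟨C, fun z hz => ?_⟩
    rw [norm_mul, norm_pow, norm_neg, norm_one, one_pow, one_mul]
    exact (hC _ (by simpa using hz.2.le)).1

lemma CoefBd.regL2_expS (h : CoefBd L k B c) (hk : 1 ≤ k) : RegL2 L (k - 1) (expS c) := by
  have := regL2_of_seq_bdd (L := L) (n := k - 1) (a := fun l => expS (dcoef c l))
    (fun l z hz => hasDerivAt_expS_dcoef h.decay l hz.1)
    fun l hl => ⟨B, fun z hz => h.norm_le (by omega) hz.1⟩
  simpa only [dcoef_zero] using this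

/-- The `(k-1)`-st derivative of `z Φ'(z)` is of order `k`, hence only `L²`. -/
lemma CoefBd.regL2_expS_dcoef_one (h : CoefBd L k B c) (hk : 1 ≤ k)
    (hv : UL2 L fun _ => expS (fallCoef c k)) : RegL2 L (k - 1) (expS (dcoef c 1)) := by
  obtain ⟨ρ, C, hC, hρ⟩ := h.exists_top_split hk
  refine regL2_of_seq (L := L) (n := k - 1) (a := fun l => expS (dcoef c (l + 1)))
    (fun l _ z hz => hasDerivAt_expS_dcoef h.decay (l + 1) hz.1)
    (fun l hl => ⟨B, fun z hz => h.norm_le (by omega) hz.1⟩) ?_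
  rw [Nat.sub_add_cancel hk]
  refine UL2.mono (hv.norm_add_const C)
    ((continuousOn_expS (h.decay.dcoef k)).mono fun z hz => hz.1) fun z hz => ?_
  rw [(hρ z hz.1).1, ← Complex.ofReal_add, Complex.norm_real, Real.norm_eq_abs,
    abs_of_nonneg (by positivity)]
  exact (norm_add_le _ _).trans (add_le_add le_rfl (hρ z hz.1).2.1)

end Curves

/-- What membership in the ball `V_r` gives in the logarithmic coordinate. -/
lemma exists_coefBd_of_mem_ballV {ε r : ℝ} {k : ℕ} (hε : 0 < ε) (hε1 : ε < 1) (hr : 0 ≤ r)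
    (hk : 1 ≤ k) {f : ℂ → ℂ} (hf : f ∈ ballV ε k r) :
    ∃ c : ℕ → ℝ, CoefBd (Real.log ε) k (r * csConst) c ∧
      (∀ ζ : ℂ, Real.log ε < ζ.re → f (Complex.exp ζ) = expS c ζ ∧
        Complex.exp ζ * deriv f (Complex.exp ζ) = expS (dcoef c 1) ζ ∧
        Complex.exp ζ ^ k * iteratedDeriv k f (Complex.exp ζ) = expS (fallCoef c k) ζ) ∧
      UL2 (Real.log ε) (fun _ => expS (fallCoef c k)) ∧
      UL2 (Real.log ε) (fun _ => logInt fun ζ => iteratedDeriv k f (Complex.exp ζ)) := by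
  obtain ⟨⟨hA, -⟩, hnorm⟩ := hf
  obtain ⟨c, hc, hcm⟩ := exists_coef hε hA
  have hL := Real.log_neg hε hε1
  have hmem : ∀ ξ ∈ Ioo (Real.log ε) 0, Real.exp ξ ∈ Ioo ε 1 := fun ξ hξ =>
    ⟨(Real.log_lt_iff_lt_exp hε).1 hξ.1, by rw [← Real.exp_zero]; exact Real.exp_lt_exp.2 hξ.2⟩
  have hv : ∀ ξ ∈ Ioo (Real.log ε) 0, lineNorm (expS (fallCoef c k)) ξ ≤ ENNReal.ofReal r := by
    intro ξ hξ
    have e : lineNorm (expS (fallCoef c k)) ξ = lineNorm (eulerPow f k) ξ := by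
      unfold lineNorm
      congr 1
      ext t
      exact (hcm k _ (by simpa using hξ.1)).symm
    rw [e]
    refine (lineNorm_eulerPow_le f k hξ.2.le).trans (le_trans ?_ hnorm)
    have h1 : circleNorm (fun ω => iteratedDeriv k f ((Real.exp ξ : ℂ) * ω))
        ≤ boundaryNorm ε (iteratedDeriv k f) :=
      le_iSup₂ (f := fun ρ (_ : ρ ∈ Ioo ε 1) =>
        circleNorm (fun ω => iteratedDeriv k f ((ρ : ℂ) * ω))) (Real.exp ξ) (hmem ξ hξ)
    exact h1.trans (le_add_right (le_add_left le_rfl))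
  have hlog : ∀ ξ ∈ Ioo (Real.log ε) 0,
      circleNorm (logIntegral (iteratedDeriv k f) (Real.exp ξ)) ≤ (r.toNNReal : ENNReal) := by
    intro ξ hξ
    have h1 : circleNorm (logIntegral (iteratedDeriv k f) (Real.exp ξ))
        ≤ boundaryLogNorm ε (iteratedDeriv k f) :=
      le_iSup₂ (f := fun ρ (_ : ρ ∈ Ioo ε 1) =>
        circleNorm (logIntegral (iteratedDeriv k f) ρ)) (Real.exp ξ) (hmem ξ hξ)
    exact (h1.trans (le_add_left le_rfl)).trans hnorm
  have hcont : ContinuousOn (fun ζ => iteratedDeriv k f (Complex.exp ζ))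
      (strip (Real.log ε) 0) := by
    have h1 : ContinuousOn (fun ζ => (Complex.exp ζ ^ k)⁻¹ * expS (fallCoef c k) ζ)
        (strip (Real.log ε) 0) :=
      ((Complex.continuous_exp.pow k).inv₀ fun ζ => pow_ne_zero _ (Complex.exp_ne_zero ζ)).continuousOn.mul
        ((continuousOn_expS (hc.fallCoef k)).mono fun ζ hζ => hζ.1)
    refine h1.congr fun ζ hζ => ?_
    simp only
    rw [← hcm k ζ hζ.1, eulerPow, inv_mul_cancel_left₀ (pow_ne_zero _ (Complex.exp_ne_zero ζ))]
  refine ⟨c, coefBd_of_lineNorm_le hL hk hc hr hv, fun ζ hζ => ⟨?_, ?_, ?_⟩, ?_,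
    uL2_logInt hcont hlog⟩
  · have := hcm 0 ζ hζ
    simpa [eulerPow, fallCoef] using this
  · have := hcm 1 ζ hζ
    simpa [eulerPow, fallCoef] using this
  · exact hcm k ζ hζ
  · exact ⟨r.toNNReal, fun ξ hξ =>
      ⟨(continuous_expS_line (hc.fallCoef k) hξ.1).aestronglyMeasurable, hv ξ hξ⟩⟩

/-! ### The holomorphic extension of the functional -/

/-- The function `β e^ζ + expS d ζ`: the curve `Φ(z) = β z + f(z)`, or its derivative `z Φ'(z)`, in
the coordinate `z = e^ζ`. -/
def profile (β : ℝ) (d : ℕ → ℝ) (ζ : ℂ) : ℂ := β * Complex.exp ζ + expS d ζ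

/-- The holomorphic extension, in the coordinate `ζ`, of the complex quantity whose imaginary part
is `G`. The conjugate of `ω Φ'(ω)` is written as the value of `z Φ'(z)` at the reflected point
`-ζ`. -/
def extF (Ω : ℝ) (c : Fin 2 → ℕ → ℝ) (β : Fin 2 → ℝ) (j : Fin 2) (ζ : ℂ) : ℂ :=
  (Ω * profile (β j) (c j) ζ - extS (c 0) (c j) (β 0) (β j) ζ + extS (c 1) (c j) (β 1) (β j) ζ)
    * profile (β j) (dcoef (c j) 1) (-ζ)

/-- The holomorphic extension of `G`: twice `i` times it is the odd part of `extF`. -/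
def extG (Ω : ℝ) (c : Fin 2 → ℕ → ℝ) (β : Fin 2 → ℝ) (j : Fin 2) (ζ : ℂ) : ℂ :=
  (2 * Complex.I)⁻¹ * (extF Ω c β j ζ + (-1) * extF Ω c β j (-ζ))

lemma profile_periodic (β : ℝ) (d : ℕ → ℝ) :
    Function.Periodic (profile β d) (2 * Real.pi * Complex.I) := fun ζ => by
  rw [profile, Complex.exp_periodic ζ, expS_periodic d ζ, profile]

lemma profile_conj (β : ℝ) (d : ℕ → ℝ) (ζ : ℂ) :
    profile β d ((starRingEnd ℂ) ζ) = (starRingEnd ℂ) (profile β d ζ) := by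
  rw [profile, profile, expS_conj, map_add, map_mul, Complex.conj_ofReal, Complex.exp_conj]

lemma differentiableAt_profile {L : ℝ} (β : ℝ) {d : ℕ → ℝ} (hd : Decay L d) {ζ : ℂ}
    (hζ : L < ζ.re) : DifferentiableAt ℂ (profile β d) ζ :=
  (Complex.differentiableAt_exp.const_mul _).add (hasDerivAt_expS hd hζ).differentiableAt

section Extension

variable {c : Fin 2 → ℕ → ℝ} {β : Fin 2 → ℝ} {L B Ω : ℝ} {k : ℕ} {j : Fin 2}

lemma extF_periodic : Function.Periodic (extF Ω c β j) (2 * Real.pi * Complex.I) := fun ζ => by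
  rw [extF, extF, neg_add, ← sub_eq_add_neg, profile_periodic _ _ ζ, extS_periodic ζ,
    extS_periodic ζ, (profile_periodic _ _).sub_eq]

lemma extG_periodic : Function.Periodic (extG Ω c β j) (2 * Real.pi * Complex.I) := fun ζ => by
  rw [extG, extG, neg_add, ← sub_eq_add_neg, extF_periodic ζ, extF_periodic.sub_eq]

lemma extG_neg (ζ : ℂ) : extG Ω c β j (-ζ) = -extG Ω c β j ζ := by
  rw [extG, extG, neg_neg]
  ring

lemma differentiableOn_extF (hP : ∀ i, PairBd L k (c i) (c j) (β i) (β j)) (hL : L < 0)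
    (hk : 3 ≤ k) : DifferentiableOn ℂ (extF Ω c β j) (strip L (-L)) := by
  have hd : Decay L (c j) := (hP j).decay
  have h1 : DifferentiableOn ℂ (profile (β j) (c j)) (strip L (-L)) := fun ζ hζ =>
    (differentiableAt_profile _ hd hζ.1).differentiableWithinAt
  have h2 : DifferentiableOn ℂ (fun ζ => profile (β j) (dcoef (c j) 1) (-ζ)) (strip L (-L)) :=
    fun ζ hζ => ((differentiableAt_profile _ (hd.dcoef 1) (neg_mem_strip hζ).1).comp ζ
      differentiableAt_id.neg).differentiableWithinAt
  exact (((h1.const_mul _).sub ((hP 0).differentiableOn_extS hL hk)).add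
    ((hP 1).differentiableOn_extS hL hk)).mul h2

lemma differentiableOn_extG (hP : ∀ i, PairBd L k (c i) (c j) (β i) (β j)) (hL : L < 0)
    (hk : 3 ≤ k) : DifferentiableOn ℂ (extG Ω c β j) (strip L (-L)) :=
  ((differentiableOn_extF hP hL hk).add (((differentiableOn_extF hP hL hk).comp
    differentiableOn_id.neg fun _ hζ => neg_mem_strip hζ).const_mul _)).const_mul _

lemma extF_conj (hP : ∀ i, PairBd L k (c i) (c j) (β i) (β j)) (hL : L < 0) {ζ : ℂ}
    (hζ : ζ ∈ strip L (-L)) :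
    extF Ω c β j ((starRingEnd ℂ) ζ) = (starRingEnd ℂ) (extF Ω c β j ζ) := by
  rw [extF, ← map_neg, profile_conj, profile_conj, (hP 0).extS_conj hL hζ, (hP 1).extS_conj hL hζ,
    extF]
  simp only [map_mul, map_add, map_sub, Complex.conj_ofReal]

lemma extG_axis (hP : ∀ i, PairBd L k (c i) (c j) (β i) (β j)) (hL : L < 0) (t : ℝ) :
    extG Ω c β j (t * Complex.I) = ((extF Ω c β j (t * Complex.I)).im : ℂ) := by
  rw [extG, neg_axis, extF_conj hP hL (axis_mem_strip hL t), neg_one_mul, ← sub_eq_add_neg,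
    Complex.sub_conj]
  push_cast
  field_simp

lemma regL2_profile {d : ℕ → ℝ} {n : ℕ} (b : ℝ) (h : RegL2 L n (expS d)) :
    RegL2 L n (profile b d) :=
  ((regL2_exp n).const_mul b).add h

lemma regL2_profile_neg {d : ℕ → ℝ} (b : ℝ) (hd : Decay L d) (hL : L < 0) (n : ℕ) :
    RegL2 L n fun ζ => profile b d (-ζ) :=
  ((regL2_exp_neg hL n).const_mul b).add (regL2_expS_neg hd hL n)

/-- In `extF Ω c β j ζ` the integrals are evaluated at `ζ` and the derivative of the curve at `-ζ`,
in `extF Ω c β j (-ζ)` the other way round. The factors evaluated at `-ζ` are smooth up to the line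
`Re ζ = L`. -/
lemma regL2_extG (hP : ∀ i, PairBd L k (c i) (c j) (β i) (β j)) (hL : L < 0) (hk : 3 ≤ k)
    (hT : ∀ i, TopBd L k (c i) (c j) (β i) (β j)) (hc : CoefBd L k B (c j))
    (hv : UL2 L fun _ => expS (fallCoef (c j) k)) : RegL2 L (k - 1) (extG Ω c β j) := by
  have hn : 1 ≤ k - 1 := by omega
  have hk1 : 1 ≤ k := by omega
  have h1 := (((((regL2_profile (β j) (hc.regL2_expS hk1)).const_mul Ω).add
    (((hP 0).regL2_extS hL hk (hT 0)).const_mul (-1))).add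
      ((hP 1).regL2_extS hL hk (hT 1))).mul hn
        (regL2_profile_neg (β j) (hc.decay.dcoef 1) hL (k - 1)))
  have h2 := (((((regL2_profile_neg (β j) hc.decay hL (k - 1)).const_mul Ω).add
    (((hP 0).regL2_extS_neg hL hk).const_mul (-1))).add
      ((hP 1).regL2_extS_neg hL hk)).mul hn
        (regL2_profile (β j) (hc.regL2_expS_dcoef_one hk1 hv)))
  have h3 := (h1.add (h2.const_mul (-1))).const_mul (2 * Complex.I)⁻¹
  convert h3 using 2 with ζ
  simp only [extG, extF, neg_neg, neg_one_mul, ← sub_eq_add_neg]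

end Extension

/-! ### The functional on a small ball -/

lemma differentiableAt_of_mem_ballV {ε r : ℝ} {k : ℕ} {f : ℂ → ℂ} (hf : f ∈ ballV ε k r) {z : ℂ}
    (hz : ε < ‖z‖) : DifferentiableAt ℂ f z :=
  hf.1.1.1.differentiableAt ((isOpen_lt continuous_const continuous_norm).mem_nhds hz)

lemma exists_eq_exp_mul_I {ω : ℂ} (hω : ‖ω‖ = 1) : ∃ t : ℝ, ω = Complex.exp (t * Complex.I) := by
  refine ⟨ω.arg, ?_⟩
  have := Complex.norm_mul_exp_arg_mul_I ω
  rw [hω, Complex.ofReal_one, one_mul] at this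
  exact this.symm

lemma exists_angle {τ : ℂ} (hτ : ‖τ‖ = 1) (t : ℝ) :
    ∃ θ : ℝ, |θ| ≤ Real.pi ∧ τ = Complex.exp (((t + θ : ℝ) : ℂ) * Complex.I) := by
  refine ⟨(τ / Complex.exp (t * Complex.I)).arg, Complex.abs_arg_le_pi _, ?_⟩
  have := Complex.norm_mul_exp_arg_mul_I (τ / Complex.exp (t * Complex.I))
  rw [norm_div, hτ, Complex.norm_exp_ofReal_mul_I, div_one, Complex.ofReal_one, one_mul] at this
  rw [Complex.ofReal_add, add_mul, Complex.exp_add, this, mul_div_cancel₀ _ (Complex.exp_ne_zero _)]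

lemma circleData_conformal {b ε r : ℝ} {k : ℕ} (hε1 : ε < 1) {f : Fin 2 → ℂ → ℂ} {i : Fin 2}
    (hf : f i ∈ ballV ε k r) {c : ℕ → ℝ}
    (h0 : ∀ t : ℝ, f i (Complex.exp (t * Complex.I)) = expS c (t * Complex.I))
    (h1 : ∀ t : ℝ, Complex.exp (t * Complex.I) * deriv (f i) (Complex.exp (t * Complex.I))
      = expS (dcoef c 1) (t * Complex.I)) :
    CircleData (conformal b f i) c (b ^ (i : ℕ)) where
  val t := by rw [conformal, h0]; push_cast; rfl
  der t := by
    have hd := differentiableAt_of_mem_ballV hf (z := Complex.exp (t * Complex.I))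
      (by rwa [Complex.norm_exp_ofReal_mul_I])
    have : HasDerivAt (conformal b f i)
        ((b : ℂ) ^ (i : ℕ) * 1 + deriv (f i) (Complex.exp (t * Complex.I)))
        (Complex.exp (t * Complex.I)) :=
      ((hasDerivAt_id _).const_mul _).add hd.hasDerivAt
    rw [this.deriv, mul_add, h1]
    push_cast
    ring

lemma G_eq_im_extF {b Ω : ℝ} {f : Fin 2 → ℂ → ℂ} {c : Fin 2 → ℕ → ℝ} {j : Fin 2}
    (hΦ : ∀ i : Fin 2, CircleData (conformal b f i) (c i) (b ^ (i : ℕ)))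
    (hκ : ∀ i : Fin 2, ∀ θ ∈ angles, kap (b ^ (i : ℕ)) (b ^ (j : ℕ)) θ ≠ 0) (t : ℝ) :
    G b j Ω f (Complex.exp (t * Complex.I))
      = (extF Ω c (fun i => b ^ (i : ℕ)) j (t * Complex.I)).im := by
  rw [G, extF, neg_axis, profile_conj, mul_assoc, ← map_mul,
    mul_comm (deriv _ _) (Complex.exp _), (hΦ j).der, (hΦ j).val,
    S_eq_extS (hΦ 0) (hΦ j) (hκ 0), S_eq_extS (hΦ 1) (hΦ j) (hκ 1)]
  rfl

lemma abs_pow_sub_pow_fin_two {b : ℝ} (hb1 : b < 1) {i j : Fin 2} (hij : i ≠ j) :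
    |b ^ (i : ℕ) - b ^ (j : ℕ)| = 1 - b := by
  fin_cases i <;> fin_cases j <;> simp at hij ⊢
  · linarith
  · rw [abs_sub_comm, abs_of_pos (by linarith)]

lemma le_pow_fin_two {b : ℝ} (hb1 : b < 1) (i : Fin 2) : b ≤ b ^ (i : ℕ) := by
  fin_cases i <;> simp
  exact hb1.le

/-- The two curves do not meet each other, and neither of them meets itself. -/
lemma conformal_ne_conformal {b L B : ℝ} {k : ℕ} {f : Fin 2 → ℂ → ℂ} {c : Fin 2 → ℕ → ℝ}
    {i j : Fin 2} (hb : 0 < b) (hL : L < 0) (hk : 1 ≤ k) (hc : ∀ i, CoefBd L k B (c i))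
    (hB : i ≠ j → 2 * B / |b ^ (i : ℕ) - b ^ (j : ℕ)| ≤ Real.exp L / 8)
    (hne : i ≠ j → b ^ (i : ℕ) ≠ b ^ (j : ℕ))
    (hP : PairBd L k (c i) (c j) (b ^ (i : ℕ)) (b ^ (j : ℕ)))
    (hΦ : ∀ i : Fin 2, CircleData (conformal b f i) (c i) (b ^ (i : ℕ)))
    (hκ : ∀ θ ∈ angles, kap (b ^ (i : ℕ)) (b ^ (j : ℕ)) θ ≠ 0) {τ ω : ℂ} (hτ : ‖τ‖ = 1)
    (hω : ‖ω‖ = 1) (h : ¬(i = j ∧ τ = ω)) : conformal b f i τ ≠ conformal b f j ω := by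
  obtain ⟨t, rfl⟩ := exists_eq_exp_mul_I hω
  obtain ⟨θ, hθ, rfl⟩ := exists_angle hτ t
  rcases eq_or_ne θ 0 with rfl | h0
  · -- equal angles are possible only on different curves
    have hij : i ≠ j := fun hij => h ⟨hij, by rw [add_zero]⟩
    have hbi : 0 ≤ b ^ (i : ℕ) := by positivity
    have hbj : 0 ≤ b ^ (j : ℕ) := by positivity
    have hκ0 : kap (b ^ (i : ℕ)) (b ^ (j : ℕ)) 0 ≠ 0 := norm_pos_iff.1
      ((abs_pos.2 (sub_ne_zero.2 (hne hij))).trans_le (le_norm_kap hbi hbj 0))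
    rw [← sub_ne_zero, (hΦ i).sub_eq (hΦ j) hκ0]
    refine mul_ne_zero (famA_zero_ne_zero hL (le_trans ?_ (hB hij))) hκ0
    rw [two_mul]
    exact norm_famA_le hbi hbj (hne hij)
      ((hc i).norm_le (by omega) (by simpa using hL)) ((hc j).norm_le (by omega) (by simpa using hL))
  · exact hP.conformal_ne hL (hΦ i) (hΦ j)
      ⟨(abs_le.1 hθ).1, (abs_le.1 hθ).2, h0⟩ (hκ θ ⟨(abs_le.1 hθ).1, (abs_le.1 hθ).2, h0⟩) t

end VState

end

theorem mainTheorem4 (b ε : ℝ) (hb : b ∈ Set.Ioo (0 : ℝ) 1) (hε : ε ∈ Set.Ioo (0 : ℝ) 1)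
    (j : Fin 2) (k : ℕ) (hk : 3 ≤ k) :
    ∃ r ∈ Set.Ioo (0 : ℝ) 1, ∀ (Ω : ℝ) (f : Fin 2 → ℂ → ℂ),
      (∀ i, f i ∈ VState.ballV ε k r) →
      -- the integrals that define `G_j` make sense at every point of the unit circle
      (∀ ω : ℂ, ‖ω‖ = 1 → ∀ i : Fin 2,
        (∀ τ : ℂ, ‖τ‖ = 1 → ¬(i = j ∧ τ = ω) →
          VState.conformal b f i τ ≠ VState.conformal b f j ω) ∧
        CircleIntegrable
          (VState.kernelS (VState.conformal b f i) (VState.conformal b f j) ω) 0 1) ∧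
      -- `G_j` is the restriction to the unit circle of an element of `Y^{k-1}`, unique on `C_ε`
      ∃ h ∈ VState.spaceY ε (k - 1),
        (∀ ω : ℂ, ‖ω‖ = 1 → h ω = (VState.G b j Ω f ω : ℂ)) ∧
        ∀ h' ∈ VState.spaceY ε (k - 1),
          (∀ ω : ℂ, ‖ω‖ = 1 → h' ω = (VState.G b j Ω f ω : ℂ)) →
            Set.EqOn h' h (VState.annulus ε) := by
  open VState in
  obtain ⟨hb0, hb1⟩ := hb
  obtain ⟨hε0, hε1⟩ := hε
  have hL := Real.log_neg hε0 hε1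
  have hK : 0 ≤ csConst := Real.sqrt_nonneg _
  -- `m` is a lower bound for the radii `1`, `b` and for their distance
  set m := min b (1 - b) with hm
  have hm0 : 0 < m := lt_min hb0 (by linarith)
  set r := min (1 / 2) (ε * m / (16 * (csConst + 1))) with hr
  have hr0 : 0 < r := lt_min (by norm_num) (by positivity)
  have hr1 : r < 1 := (min_le_left _ _).trans_lt (by norm_num)
  -- the coefficients are bounded by `B = r * csConst`; this is the smallness that keeps the perturbed
  -- kernel close to the unperturbed one, for radii and distances `x`
  have hB : ∀ x, m ≤ x → 2 * (r * csConst) / x ≤ Real.exp (Real.log ε) / 8 := by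
    intro x hx
    have hx0 := hm0.trans_le hx
    rw [Real.exp_log hε0, div_le_div_iff₀ hx0 (by norm_num)]
    have h1 : r * (16 * (csConst + 1)) ≤ ε * m :=
      (le_div_iff₀ (by positivity)).1 (min_le_right _ _)
    have h2 : ε * m ≤ ε * x := by gcongr
    nlinarith
  refine ⟨r, ⟨hr0, hr1⟩, fun Ω f hf => ?_⟩
  choose c hc hf1 hv hlog using fun i =>
    exists_coefBd_of_mem_ballV hε0 hε1 hr0.le (by omega : 1 ≤ k) (hf i)
  have hβ : ∀ i : Fin 2, 0 < b ^ (i : ℕ) := fun i => by positivity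
  have hm_le : ∀ i : Fin 2, m ≤ b ^ (i : ℕ) := fun i =>
    (min_le_left _ _).trans (le_pow_fin_two hb1 i)
  have hne : ∀ i : Fin 2, i ≠ j → b ^ (i : ℕ) ≠ b ^ (j : ℕ) := fun i hij h => by
    have := abs_pow_sub_pow_fin_two hb1 hij
    rw [h, sub_self, abs_zero] at this
    linarith
  have hB' : ∀ i : Fin 2, i ≠ j →
      2 * (r * csConst) / |b ^ (i : ℕ) - b ^ (j : ℕ)| ≤ Real.exp (Real.log ε) / 8 :=
    fun i hij => hB _ (by rw [abs_pow_sub_pow_fin_two hb1 hij]; exact min_le_right _ _)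
  have hκ : ∀ i : Fin 2, ∀ θ ∈ angles, kap (b ^ (i : ℕ)) (b ^ (j : ℕ)) θ ≠ 0 := by
    intro i θ hθ
    rw [← norm_pos_iff]
    rcases eq_or_ne i j with rfl | hij
    · exact (div_pos (mul_pos (hβ i) (abs_pos.2 hθ.2.2)) two_pos).trans_le
        (le_norm_kap_self (hβ i) hθ)
    · exact (abs_pos.2 (sub_ne_zero.2 (hne i hij))).trans_le
        (le_norm_kap (hβ i).le (hβ j).le θ)
  have hP : ∀ i : Fin 2,
      PairBd (Real.log ε) k (c i) (c j) (b ^ (i : ℕ)) (b ^ (j : ℕ)) := by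
    intro i
    rcases eq_or_ne i j with rfl | hij
    · exact (hc i).pairBd_self hL hk (hβ i) (hB _ (hm_le i))
    · exact (hc i).pairBd (hc j) hL hk (hβ i).le (hβ j).le (hne i hij) (hB' i hij)
  have hT : ∀ i : Fin 2,
      TopBd (Real.log ε) k (c i) (c j) (b ^ (i : ℕ)) (b ^ (j : ℕ)) := by
    intro i
    rcases eq_or_ne i j with rfl | hij
    · exact (hc i).topBd_self hL hk (hβ i) (hB _ (hm_le i)) (hv i)
        (fun ζ hζ => (hf1 i ζ hζ).2.2) (hlog i)
    · exact (hc i).topBd (hc j) hL (by omega) (hβ i).le (hβ j).le (hne i hij) (hP i) (hv i) (hv j)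
  have hΦ : ∀ i : Fin 2, CircleData (conformal b f i) (c i) (b ^ (i : ℕ)) := fun i =>
    circleData_conformal hε1 (hf i) (fun t => (hf1 i _ (axis_mem_strip hL t).1).1)
      fun t => (hf1 i _ (axis_mem_strip hL t).1).2.1
  refine ⟨fun ω hω i => ⟨fun τ hτ h => conformal_ne_conformal hb0 hL (by omega) hc (hB' i) (hne i)
    (hP i) hΦ (hκ i) hτ hω h, ?_⟩, fun z => extG Ω c (fun i => b ^ (i : ℕ)) j (Complex.log z),
    comp_log_mem_spaceY hε0 hε1 (differentiableOn_extG hP hL hk) extG_periodic extG_neg ?_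
      (regL2_extG hP hL hk hT (hc j) (hv j)), ?_⟩
  · obtain ⟨t, rfl⟩ := exists_eq_exp_mul_I hω
    exact (hP i).circleIntegrable_kernelS hL hk (hΦ i) (hΦ j) (hκ i) t
  · intro t
    rw [extG_axis hP hL, Complex.conj_ofReal]
  · have hval : ∀ ω : ℂ, ‖ω‖ = 1 →
        extG Ω c (fun i => b ^ (i : ℕ)) j (Complex.log ω) = (G b j Ω f ω : ℂ) := by
      intro ω hω
      obtain ⟨t, rfl⟩ := exists_eq_exp_mul_I hω
      rw [periodic_comp_log extG_periodic, extG_axis hP hL, G_eq_im_extF hΦ hκ]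
    refine ⟨hval, fun h' hh' hval' => eqOn_annulus_of_eq_circle hε0 hε1 hh'.1.1
      (differentiableOn_comp_log hε0 (differentiableOn_extG hP hL hk) extG_periodic)
      fun ω hω => (hval' ω hω).trans (hval ω hω).symm⟩
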